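/- **Setting.** Let $m,n\ge 0$ be integers with $N:=m+n>0$. For $1\le i\le N$ put $\hat i=0$ if $i\le m$ and $\hat i=1$ if $i>m$. Over $\mathbb Q(\upsilon)$ put $\upsilon_i=\upsilon^{(-1)^{\hat i}}$ and $[a]=\frac{\upsilon^a-\upsilon^{-a}}{\upsilon-\upsilon^{-1}}$. On $\mathbb Z^{N}$, with standard basis $e_1,\dots,e_N$, put $\lambda * j=\sum_i(-1)^{\hat i}\lambda_i j_i$, and for $1\le h<N$ let $\alpha_h=e_h-e_{h+1}$, $\beta_h=e_h+e_{h+1}$. Let $\delta_{h,m}$ be the Kronecker delta. $U=U_\upsilon(\mathfrak{gl}_{m|n})$ is the $\mathbb Q(\upsilon)$-superalgebra generated by $E_h,F_h$ $(1\le h<N)$ and $K_i^{\pm1}$ $(1\le i\le N)$, where $E_m,F_m$ (present if $1\le m<N$) are odd and all other generators are even, subject to the following relations, in which $[x,y]=xy-(-1)^{\hat x\hat y}yx$: * $K_aK_b=K_bK_a$, $K_aK_a^{-1}=K_a^{-1}K_a=1$; $K_aE_b=\upsilon^{e_a*\alpha_b}E_bK_a$, $K_aF_b=\upsilon^{-e_a*\alpha_b}F_bK_a$;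 $[E_a,F_b]=\delta_{a,b}\frac{K_aK_{a+1}^{-1}-K_a^{-1}K_{a+1}}{\upsilon_a-\upsilon_a^{-1}}$; * $E_aE_b=E_bE_a$ and $F_aF_b=F_bF_a$ if $|a-b|>1$; * $X_a^2X_b-(\upsilon_a+\upsilon_a^{-1})X_aX_bX_a+X_bX_a^2=0$ for $X=E$ and for $X=F$, if $a\ne m$ and $|a-b|=1$; * $E_m^2=F_m^2=0$ (if $1\le m<N$), and, if $m,n\ge2$, $[E_m,\,E_{m-1}E_mE_{m+1}-\upsilon E_{m-1}E_{m+1}E_m-\upsilon^{-1}E_mE_{m+1}E_{m-1}+E_{m+1}E_mE_{m-1}]=0$ and $[F_m,\,F_{m+1}F_mF_{m-1}-\upsilon^{-1}F_mF_{m+1}F_{m-1}-\upsilon F_{m-1}F_{m+1}F_m+F_{m-1}F_mF_{m+1}]=0$. For $p\in\{0,1\}$ let $S_p$ be the superspace (denoted $\mathcal S_{0|1}$ for $p=0$ and $\mathcal S_{1|0}$ for $p=1$) with basis the divided power monomials $X^{(a)}=\prod_i X_i^{a_i}/[a_i]!$, where $a\in\mathbb N^{N}$ and $a_i\le1$ whenever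 $\hat i\ne p$; $X^{(a)}$ has parity $\sum_{\hat i\neq p}a_i \bmod 2$, and $X^{(a)}:=0$ for other $a\in\mathbb N^N$. The generators act on it by $K_i.X^{(a)}=\upsilon_i^{a_i}X^{(a)}$; $E_h.X^{(a)}=[a_h+1]X^{(a+\alpha_h)}$ if $a_{h+1}>0$ and $0$ otherwise; $F_h.X^{(a)}=[a_{h+1}+1]X^{(a-\alpha_h)}$ if $a_h>0$ and $0$ otherwise. Let $\mathcal S^{m|n}=S_0^{\otimes m}\otimes S_1^{\otimes n}$, on which the generators act via the iterated coproducts of $\Delta(K_i)=K_i\otimes K_i$, $\Delta(E_h)=E_h\otimes K_hK_{h+1}^{-1}+1\otimes E_h$, $\Delta(F_h)=F_h\otimes1+K_h^{-1}K_{h+1}\otimes F_h$ and the sign rule $(u_1\otimes u_2).(v_1\otimes v_2)=(-1)^{\hat u_2\hat v_1}u_1v_1\otimes u_2v_2$. Let $M(m|n)$ be the set of $N\times N$ matrices $A=(a_{i,j})$ over $\mathbb N$ with $a_{i,j}\le1$ whenever $\hat i\ne\hat j$, and $M(m|n)^{\mp}$ its subset of matrices with zero diagonal. For $A\in M(m|n)$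 with columns $c_1,\dots,c_N$ let $X^{[A]}=X^{(c_1)}\otimes\cdots\otimes X^{(c_N)}$, of parity $\hat A=\sum_{\hat i\neq\hat j}a_{i,j} \bmod 2$; for $\mathbb N$-matrices $A\notin M(m|n)$ put $X^{[A]}=0$. Let $\widetilde{\mathcal S}^{m|n}=\prod_{A\in M(m|n)}\mathbb Q(\upsilon)X^{[A]}$ be the space of formal power series. For an $\mathbb N$-matrix $A$ with zero diagonal and $j\in\mathbb Z^{N}$ put $$A(j)=\sum_{\lambda\in\mathbb N^{N}}\upsilon^{\lambda*j}X^{[A+\operatorname{diag}(\lambda)]}\in\widetilde{\mathcal S}^{m|n}$$ (so $A(j)=0$ if $A\notin M(m|n)$), and let $\mathcal U(m|n)$ be the span of the $A(j)$ with $A\in M(m|n)^{\mp}$, $j\in\mathbb Z^{N}$. Finally, let $\sigma(i,A)=\sum_{s>m,\,t<i}a_{s,t}$ if $i\le m$, and $\sigma(i,A)=\sum_{s>m,\,t\le m}a_{s,t}+\sum_{s\le m,\,m<t<i}a_{s,t}$ if $i>m$; and for fixed $h$ and $A$ let $$\varsigma(i)=(-1)^{\delta_{h,m}\sigma(i,A)},$$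 $$f(i)=\sum_{j>i}a_{h,j}-(-1)^{\delta_{h,m}}\sum_{j>i}a_{h+1,j},\qquad g(i)=\sum_{j<i}a_{h+1,j}-(-1)^{\delta_{h,m}}\sum_{j<i}a_{h,j}.$$ Below, $E_{i,j}$ denotes the matrix units. **Theorem.** The above actions of the generators make $\mathcal S^{m|n}$ a $U$-module, and this structure extends to a $U$-module structure on $\widetilde{\mathcal S}^{m|n}$ by $u.\sum_A c_AX^{[A]}=\sum_A c_A\,(u.X^{[A]})$ (for each $u\in U$, each monomial $X^{[B]}$ occurs in $u.X^{[A]}$ for only finitely many $A$). The subspace $\mathcal U(m|n)$ is a $U$-submodule of $\widetilde{\mathcal S}^{m|n}$ with basis $\{A(j)\mid A\in M(m|n)^{\mp},\,j\in\mathbb Z^{N}\}$ (the $A(j)$ being linearly independent for distinct pairs $(A,j)$). For all $A\in M(m|n)^{\mp}$, $j\in\mathbb Z^{N}$, $1\le i\le N$ and $1\le h<N$, $$K_i.A(j)=\upsilon_i^{\sum_{k}a_{i,k}}A(j+e_i),$$ $$\begin{aligned}E_h.A(j)={}&\sum_{i>h+1,\ a_{h+1,i}\ge1}\varsigma(i)\,\upsilon_h^{f(i)}[a_{h,i}+1]\,(A+E_{h,i}-E_{h+1,i})(j)\\&+\sum_{i<h,\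 a_{h+1,i}\ge1}\varsigma(i)\,\upsilon_h^{f(i)}[a_{h,i}+1]\,(A+E_{h,i}-E_{h+1,i})(j+\alpha_h)\\&+\blacktriangleright\varsigma(h)\,\upsilon_h^{f(h)-j_h}\,\frac{(A-E_{h+1,h})(j+\alpha_h)-(A-E_{h+1,h})(j-\beta_h)}{\upsilon_h-\upsilon_h^{-1}}\\&+\varsigma(h+1)\,\upsilon_h^{f(h+1)+(-1)^{\delta_{h,m}}j_{h+1}}[a_{h,h+1}+1]\,(A+E_{h,h+1})(j),\end{aligned}$$ $$\begin{aligned}F_h.A(j)={}&\sum_{i<h,\ a_{h,i}\ge1}\varsigma(i)\,\upsilon_{h+1}^{g(i)}[a_{h+1,i}+1]\,(A-E_{h,i}+E_{h+1,i})(j)\\&+\sum_{i>h+1,\ a_{h,i}\ge1}\varsigma(i)\,\upsilon_{h+1}^{g(i)}[a_{h+1,i}+1]\,(A-E_{h,i}+E_{h+1,i})(j-\alpha_h)\\&+\varsigma(h)\,\upsilon_{h+1}^{g(h)+(-1)^{\delta_{h,m}}j_h}[a_{h+1,h}+1]\,(A+E_{h+1,h})(j)\\&+\blacktriangleleft\varsigma(h+1)\,\upsilon_{h+1}^{g(h+1)-j_{h+1}}\,\frac{(A-E_{h,h+1})(j-\alpha_h)-(A-E_{h,h+1})(j-\beta_h)}{\upsilon_{h+1}-\upsilon_{h+1}^{-1}},\end{aligned}$$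 where $\blacktriangleright$ (resp. $\blacktriangleleft$) is $0$, i.e. the term is omitted, if $a_{h+1,h}=0$ (resp. $a_{h,h+1}=0$), and is $1$ otherwise. Moreover, $\mathcal U(m|n)$ is a $U$-supermodule: for $p\in\mathbb Z/2$ let $\mathcal U(m|n)_p$ be the set of series in $\mathcal U(m|n)$ involving only monomials $X^{[B]}$ of parity $p$, and let $U_p$ be the span of the words in the generators of parity $p$. Then $A(j)\in\mathcal U(m|n)_{\hat A}$, $\mathcal U(m|n)=\mathcal U(m|n)_0\oplus\mathcal U(m|n)_1$, and $U_p\,.\,\mathcal U(m|n)_q\subseteq\mathcal U(m|n)_{p+q}$ for all $p,q\in\mathbb Z/2$. -/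

import Mathlib

open scoped TensorProduct

namespace QuantumGL

noncomputable section

/-! ### Scalars -/

/-- The field of rational functions `ℚ(υ)`. -/
abbrev Qv : Type := RatFunc ℚ

/-- The indeterminate `υ`. -/
def υ : Qv := RatFunc.X

/-- The quantum integer `[a] = (υ^a - υ^{-a}) / (υ - υ⁻¹)`. -/
def qint (a : ℤ) : Qv := (υ ^ a - υ ^ (-a)) / (υ - υ⁻¹)

/-! ### Indices.  The paper's index set `[1, m+n]` is `Fin (m + n)`, so the paper's `i` is `i.val + 1`.
The indices `h` with `1 ≤ h < m + n` form `Fin (m + n - 1)`. -/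

variable {m n : ℕ}

/-- The parity `î ∈ {0, 1}`: even for the first `m` indices, odd for the last `n`. -/
def par (i : Fin (m + n)) : ℕ := if i.val < m then 0 else 1

/-- `υ_i = υ^{(-1)^î}`. -/
def υi (i : Fin (m + n)) : Qv := υ ^ ((-1 : ℤ) ^ par i)

/-- The index `h ∈ [1, m+n-1]` seen in `[1, m+n]`. -/
def lo (h : Fin (m + n - 1)) : Fin (m + n) := ⟨h.val, by omega⟩

/-- The index `h + 1 ∈ [1, m+n]`. -/
def hi (h : Fin (m + n - 1)) : Fin (m + n) := ⟨h.val + 1, by omega⟩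

/-- `δ_{h,m}`. -/
def isOdd (h : Fin (m + n - 1)) : ℕ := if h.val + 1 = m then 1 else 0

/-- The super dot product `λ * j = ∑ (-1)^î λ_i j_i` on `ℤ^{m+n}`. -/
def sdot (l j : Fin (m + n) → ℤ) : ℤ := ∑ i, (-1 : ℤ) ^ par i * l i * j i

/-- The standard basis vector `e_i` of `ℤ^{m+n}`. -/
def e (i : Fin (m + n)) : Fin (m + n) → ℤ := Pi.single i 1

/-- `α_h = e_h - e_{h+1}`. -/
def α (h : Fin (m + n - 1)) : Fin (m + n) → ℤ := e (lo h) - e (hi h)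

/-- `β_h = e_h + e_{h+1}`. -/
def β (h : Fin (m + n - 1)) : Fin (m + n) → ℤ := e (lo h) + e (hi h)

/-! ### The quantum supergroup `U_υ(gl_{m|n})` -/

/-- The generators `E_h`, `F_h`, `K_i`, `K_i⁻¹`. -/
inductive Gen (m n : ℕ) : Type
  | E (h : Fin (m + n - 1))
  | F (h : Fin (m + n - 1))
  | K (i : Fin (m + n))
  | Kinv (i : Fin (m + n))

/-- Only `E_m` and `F_m` are odd. -/
def Gen.parity : Gen m n → ℕ
  | .E h => isOdd h
  | .F h => isOdd h
  | .K _ => 0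
  | .Kinv _ => 0

section Free

variable (m n) in
/-- The free algebra on the generators. -/
abbrev Free : Type := FreeAlgebra Qv (Gen m n)

def xE (h : Fin (m + n - 1)) : Free m n := FreeAlgebra.ι Qv (Gen.E h)
def xF (h : Fin (m + n - 1)) : Free m n := FreeAlgebra.ι Qv (Gen.F h)
def xK (i : Fin (m + n)) : Free m n := FreeAlgebra.ι Qv (Gen.K i)
def xKi (i : Fin (m + n)) : Free m n := FreeAlgebra.ι Qv (Gen.Kinv i)

/-- The super commutator `xy - (-1)^{pq} yx` of elements `x`, `y` of parities `p`, `q`. -/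
def scomm (p q : ℕ) (x y : Free m n) : Free m n := x * y - (-1 : Qv) ^ (p * q) • (y * x)

/-- The defining relations of `U_υ(gl_{m|n})`. -/
inductive Rel : Free m n → Free m n → Prop
  | KK (a b) : Rel (xK a * xK b) (xK b * xK a)
  | KKinv (a) : Rel (xK a * xKi a) 1
  | KinvK (a) : Rel (xKi a * xK a) 1
  | KE (a b) : Rel (xK a * xE b) (υ ^ sdot (e a) (α b) • (xE b * xK a))
  | KF (a b) : Rel (xK a * xF b) (υ ^ sdot (e a) (-α b) • (xF b * xK a))
  | EF (a) : Rel (scomm (isOdd a) (isOdd a) (xE a) (xF a))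
      ((υi (lo a) - (υi (lo a))⁻¹)⁻¹ •
        (xK (lo a) * xKi (hi a) - xKi (lo a) * xK (hi a)))
  | EF_ne (a b) (hab : a ≠ b) : Rel (scomm (isOdd a) (isOdd b) (xE a) (xF b)) 0
  | EE (a b) (hab : a.val + 1 < b.val ∨ b.val + 1 < a.val) : Rel (xE a * xE b) (xE b * xE a)
  | FF (a b) (hab : a.val + 1 < b.val ∨ b.val + 1 < a.val) : Rel (xF a * xF b) (xF b * xF a)
  | serreE (a b) (ha : a.val + 1 ≠ m) (hab : a.val + 1 = b.val ∨ b.val + 1 = a.val) :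
      Rel (xE a ^ 2 * xE b - (υi (lo a) + (υi (lo a))⁻¹) • (xE a * xE b * xE a)
        + xE b * xE a ^ 2) 0
  | serreF (a b) (ha : a.val + 1 ≠ m) (hab : a.val + 1 = b.val ∨ b.val + 1 = a.val) :
      Rel (xF a ^ 2 * xF b - (υi (lo a) + (υi (lo a))⁻¹) • (xF a * xF b * xF a)
        + xF b * xF a ^ 2) 0
  | oddE (b) (hb : b.val + 1 = m) : Rel (xE b ^ 2) 0
  | oddF (b) (hb : b.val + 1 = m) : Rel (xF b ^ 2) 0
  /- Here `a`, `b`, `c` stand for `m - 1`, `m`, `m + 1`. -/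
  | higherE (a b c) (hb : b.val + 1 = m) (ha : a.val + 1 = b.val) (hc : b.val + 1 = c.val) :
      Rel (scomm 1 1 (xE b)
        (xE a * xE b * xE c - υ • (xE a * xE c * xE b)
          - υ⁻¹ • (xE b * xE c * xE a) + xE c * xE b * xE a)) 0
  | higherF (a b c) (hb : b.val + 1 = m) (ha : a.val + 1 = b.val) (hc : b.val + 1 = c.val) :
      Rel (scomm 1 1 (xF b)
        (xF c * xF b * xF a - υ⁻¹ • (xF b * xF c * xF a)
          - υ • (xF a * xF c * xF b) + xF a * xF b * xF c)) 0

end Free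

variable (m n) in
/-- The quantum enveloping superalgebra `U_υ(gl_{m|n})` over `ℚ(υ)`. -/
abbrev Uq : Type := RingQuot (Rel (m := m) (n := n))

/-- The image of a generator in `U_υ(gl_{m|n})`. -/
def gen (g : Gen m n) : Uq m n := RingQuot.mkAlgHom Qv Rel (FreeAlgebra.ι Qv g)

/-- The homogeneous part of `U_υ(gl_{m|n})` of parity `p`, spanned by the words in the generators
with total parity `p`. -/
def Uq.part (p : ZMod 2) : Submodule Qv (Uq m n) :=
  Submodule.span Qv
    {u | ∃ w : List (Gen m n), ((w.map Gen.parity).sum : ZMod 2) = p ∧ u = (w.map gen).prod}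

/-! ### The superspaces `S_{0|1}` and `S_{1|0}` -/

variable (m n) in
/-- Exponents of the divided power monomials `X^{(a)}`: the generator `X_i` of `S_{0|1}` (`p = 0`)
or of `S_{1|0}` (`p = 1`) is odd if and only if `î ≠ p`, and odd generators square to `0`.  Thus
these are `ℕ^m × {0,1}^n` for `p = 0` and `{0,1}^m × ℕ^n` for `p = 1`. -/
abbrev Expo (p : ℕ) : Type := {a : Fin (m + n) → ℕ // ∀ i, par i ≠ p → a i ≤ 1}

variable (m n) in
/-- The underlying space of `S_{0|1}` (`p = 0`) or `S_{1|0}` (`p = 1`), with basis the divided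
power monomials `X^{(a)}`. -/
abbrev SFactor (p : ℕ) : Type := Expo m n p →₀ Qv

open Classical in
/-- The divided power monomial `X^{(a)}`; it is `0` if an odd generator occurs more than once. -/
def dpow (p : ℕ) (a : Fin (m + n) → ℕ) : SFactor m n p :=
  if h : ∀ i, par i ≠ p → a i ≤ 1 then Finsupp.single ⟨a, h⟩ 1 else 0

/-- `K_i . X^{(a)} = υ_i^{a_i} X^{(a)}`. -/
def facK (p : ℕ) (i : Fin (m + n)) : SFactor m n p →ₗ[Qv] SFactor m n p :=
  Finsupp.linearCombination Qv fun a => υi i ^ a.1 i • dpow p a.1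

/-- `K_i⁻¹ . X^{(a)} = υ_i^{-a_i} X^{(a)}`. -/
def facKinv (p : ℕ) (i : Fin (m + n)) : SFactor m n p →ₗ[Qv] SFactor m n p :=
  Finsupp.linearCombination Qv fun a => (υi i ^ a.1 i)⁻¹ • dpow p a.1

/-- `E_h . X^{(a)} = [a_h + 1] X^{(a + α_h)}` if `a_{h+1} > 0`, and `0` otherwise. -/
def facE (p : ℕ) (h : Fin (m + n - 1)) : SFactor m n p →ₗ[Qv] SFactor m n p :=
  Finsupp.linearCombination Qv fun a =>
    if 0 < a.1 (hi h) then
      qint (a.1 (lo h) + 1) • dpow p (a.1 + Pi.single (lo h) 1 - Pi.single (hi h) 1)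
    else 0

/-- `F_h . X^{(a)} = [a_{h+1} + 1] X^{(a - α_h)}` if `a_h > 0`, and `0` otherwise. -/
def facF (p : ℕ) (h : Fin (m + n - 1)) : SFactor m n p →ₗ[Qv] SFactor m n p :=
  Finsupp.linearCombination Qv fun a =>
    if 0 < a.1 (lo h) then
      qint (a.1 (hi h) + 1) • dpow p (a.1 - Pi.single (lo h) 1 + Pi.single (hi h) 1)
    else 0

/-- `K̃_h = K_h K_{h+1}⁻¹`. -/
def facKt (p : ℕ) (h : Fin (m + n - 1)) : SFactor m n p →ₗ[Qv] SFactor m n p :=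
  facK p (lo h) ∘ₗ facKinv p (hi h)

/-- `K̃_h⁻¹ = K_h⁻¹ K_{h+1}`. -/
def facKtinv (p : ℕ) (h : Fin (m + n - 1)) : SFactor m n p →ₗ[Qv] SFactor m n p :=
  facKinv p (lo h) ∘ₗ facK p (hi h)

/-- The Koszul sign `v ↦ (-1)^{q v̂} v` on homogeneous vectors `v`, where the parity of `X^{(a)}` is
the number of odd generators in it. -/
def facSign (p q : ℕ) : SFactor m n p →ₗ[Qv] SFactor m n p :=
  Finsupp.linearCombination Qv fun a =>
    (-1 : Qv) ^ (q * ∑ i with par i ≠ p, a.1 i) • dpow p a.1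

/-! ### The tensor product `S^{m|n} = S_{0|1}^{⊗ m} ⊗ S_{1|0}^{⊗ n}` -/

variable (m n) in
/-- `S^{m|n}`: the `j`-th tensor factor is `S_{0|1}` for the first `m` indices `j` and `S_{1|0}` for
the last `n`. -/
abbrev Smn : Type := ⨂[Qv] j : Fin (m + n), SFactor m n (par j)

/-- `K_i` acts through the iterated coproduct `K_i ⊗ ⋯ ⊗ K_i`. -/
def opK (i : Fin (m + n)) : Smn m n →ₗ[Qv] Smn m n :=
  PiTensorProduct.map fun j => facK (par j) i

/-- `E_h` acts through the iterated coproduct of `Δ(E_h) = E_h ⊗ K̃_h + 1 ⊗ E_h`, namely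
`∑_i 1 ⊗ ⋯ ⊗ 1 ⊗ E_h ⊗ K̃_h ⊗ ⋯ ⊗ K̃_h` with `E_h` in position `i`, and the sign rule
`(u₁ ⊗ u₂).(v₁ ⊗ v₂) = (-1)^{û₂ v̂₁} u₁v₁ ⊗ u₂v₂`. -/
def opE (h : Fin (m + n - 1)) : Smn m n →ₗ[Qv] Smn m n :=
  ∑ i, PiTensorProduct.map fun j =>
    if j < i then facSign (par j) (isOdd h)
    else if j = i then facE (par j) h
    else facKt (par j) h

/-- `F_h` acts through the iterated coproduct of `Δ(F_h) = F_h ⊗ 1 + K̃_h⁻¹ ⊗ F_h`, namely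
`∑_i K̃_h⁻¹ ⊗ ⋯ ⊗ K̃_h⁻¹ ⊗ F_h ⊗ 1 ⊗ ⋯ ⊗ 1` with `F_h` in position `i`, and the sign rule. -/
def opF (h : Fin (m + n - 1)) : Smn m n →ₗ[Qv] Smn m n :=
  ∑ i, PiTensorProduct.map fun j =>
    if j < i then facKtinv (par j) h ∘ₗ facSign (par j) (isOdd h)
    else if j = i then facF (par j) h
    else LinearMap.id

/-- Square matrices of size `m + n` with entries in `ℕ`. -/
abbrev NMat (m n : ℕ) : Type := Matrix (Fin (m + n)) (Fin (m + n)) ℕ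

variable (m n) in
/-- `M(m|n)`: the entries in the two off-diagonal blocks are `0` or `1`. -/
abbrev Mmn : Type := {A : NMat m n // ∀ i j, par i ≠ par j → A i j ≤ 1}

variable (m n) in
/-- `M(m|n)^∓`: the matrices in `M(m|n)` with zero diagonal. -/
abbrev Mmn0 : Type :=
  {A : NMat m n // (∀ i j, par i ≠ par j → A i j ≤ 1) ∧ ∀ i, A i i = 0}

/-- The parity `Â = ∑_{î + ĵ = 1} a_{ij}` of `X^{[A]}`. -/
def matParity (A : NMat m n) : ZMod 2 := ∑ i, ∑ j with par i ≠ par j, (A i j : ZMod 2)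

/-- `X^{[A]} = X^{(c_1)} ⊗ ⋯ ⊗ X^{(c_{m+n})} ∈ S^{m|n}`, where `c_j` is the `j`-th column of `A`. -/
def mon (A : Mmn m n) : Smn m n :=
  PiTensorProduct.tprod Qv fun j => dpow (par j) fun i => A.1 i j

/-- The coefficient of `X^{[B]}` in an element of `S^{m|n}`: on pure tensors it is the product over
`j` of the coefficients of `X^{(c_j(B))}` in the `j`-th factor. -/
def coeff (B : Mmn m n) : Smn m n →ₗ[Qv] Qv :=
  PiTensorProduct.lift
    ((MultilinearMap.mkPiAlgebra Qv (Fin (m + n)) Qv).compLinearMap fun j =>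
      Finsupp.lapply (⟨fun i => B.1 i j, fun i hij => B.2 i j hij⟩ : Expo m n (par j)))

/-! ### The formal power series -/

variable (m n) in
/-- The underlying space `∏_{A ∈ M(m|n)} ℚ(υ) X^{[A]}` of the formal power series algebra; the value
`f A` is the coefficient of `X^{[A]}` in the series `f`. -/
abbrev SSeries : Type := Mmn m n → Qv

/-- The endomorphism `T'` of the space of formal power series is the natural extension of the
endomorphism `T` of `S^{m|n}`: for each `B` only finitely many `T X^{[A]}` involve `X^{[B]}`, and
`T' (∑_A f_A X^{[A]}) = ∑_A f_A (T X^{[A]})`. -/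
def IsExtension (T : Module.End Qv (Smn m n)) (T' : Module.End Qv (SSeries m n)) : Prop :=
  ∀ B : Mmn m n, {A : Mmn m n | coeff B (T (mon A)) ≠ 0}.Finite ∧
    ∀ f : SSeries m n, T' f B = ∑ᶠ A : Mmn m n, f A * coeff B (T (mon A))

open Classical in
/-- The monomial `X^{[A]}` as a formal power series; it is `0` if `A ∉ M(m|n)`, since odd generators
square to `0`. -/
def smon (A : NMat m n) : SSeries m n := fun B => if B.1 = A then 1 else 0

/-- `A(j) = ∑_{λ ∈ ℕ^{m+n}} υ^{λ * j} X^{[A + λ]}`, where `A + λ = A + diag(λ)`.  For each monomial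
at most one `λ` contributes to its coefficient. For a matrix `A` with zero diagonal that is not in
`M(m|n)` it is `0`. -/
def ser (A : NMat m n) (j : Fin (m + n) → ℤ) : SSeries m n := fun B =>
  ∑ᶠ l : Fin (m + n) → ℕ,
    υ ^ sdot (fun i => (l i : ℤ)) j * smon (A + Matrix.diagonal l) B

variable (m n) in
/-- `𝒰(m|n)`: the span of the `A(j)`. -/
def Umn : Submodule Qv (SSeries m n) :=
  Submodule.span Qv (Set.range fun x : Mmn0 m n × (Fin (m + n) → ℤ) => ser x.1.1 x.2)

variable (m n) in
/-- The series all of whose monomials have parity `p`. -/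
def seriesPart (p : ZMod 2) : Submodule Qv (SSeries m n) where
  carrier := {f | ∀ B : Mmn m n, f B ≠ 0 → matParity B.1 = p}
  zero_mem' := fun _ h => absurd rfl h
  add_mem' := by
    intro f g hf hg B hB
    by_cases h : f B = 0
    · exact hg B fun h' => hB (by simp [h, h'])
    · exact hf B h
  smul_mem' := by
    intro c f hf B hB
    exact hf B fun h => hB (by simp [h])

variable (m n) in
/-- The homogeneous part of parity `p` of the superspace `𝒰(m|n)`. -/
def UmnPart (p : ZMod 2) : Submodule Qv (SSeries m n) := Umn m n ⊓ seriesPart m n p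

/-! ### The exponents and signs in the action formulas -/

/-- `σ(i, A)`: for `i ≤ m` it is `∑_{s > m, t < i} a_{st}`, and for `i > m` it is
`∑_{s > m, t ≤ m} a_{st} + ∑_{s ≤ m, m < t < i} a_{st}`. -/
def sig (i : Fin (m + n)) (A : NMat m n) : ℕ :=
  if par i = 0 then
    ∑ s with par s = 1, ∑ t with t < i, A s t
  else
    (∑ s with par s = 1, ∑ t with par t = 0, A s t)
      + ∑ s with par s = 0, ∑ t with par t = 1 ∧ t < i, A s t

/-- The sign `(-1)^{σ_{h,m}(i, A)}`, where `σ_{h,m}(i, A) = δ_{h,m} σ(i, A)`. -/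
def sgn (h : Fin (m + n - 1)) (i : Fin (m + n)) (A : NMat m n) : Qv :=
  (-1) ^ (isOdd h * sig i A)

/-- `f(i, A) = ∑_{j > i} a_{h,j} - (-1)^{δ_{h,m}} ∑_{j > i} a_{h+1,j}`. -/
def fexp (h : Fin (m + n - 1)) (i : Fin (m + n)) (A : NMat m n) : ℤ :=
  (∑ j with i < j, (A (lo h) j : ℤ)) - (-1) ^ isOdd h * ∑ j with i < j, (A (hi h) j : ℤ)

/-- `g(i, A) = ∑_{j < i} a_{h+1,j} - (-1)^{δ_{h,m}} ∑_{j < i} a_{h,j}`. -/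
def gexp (h : Fin (m + n - 1)) (i : Fin (m + n)) (A : NMat m n) : ℤ :=
  (∑ j with j < i, (A (hi h) j : ℤ)) - (-1) ^ isOdd h * ∑ j with j < i, (A (lo h) j : ℤ)

/-- The matrix unit `E_{i,j}`. -/
def unit (i j : Fin (m + n)) : NMat m n := Matrix.single i j 1

end

end QuantumGL

open QuantumGL

/-!
Everything rests on two explicit formulas, one for the generators on a single tensor factor and one
for the iterated coproduct.

On one factor, `E_h = X_h ∂_{h+1}` and `F_h = ∂_h X_{h+1}`, where the creation operators `X_i`
(`osR`) and annihilation operators `∂_i` (`osL`) form a family of independent oscillators, bosonic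
`q`-oscillators or fermionic ones according to parity (`isOscillator_factor`).  The relations among
the `E_h` alone and among the `F_h` alone hold in any oscillator realization
(`IsOscillator.isSerre`).

The iterated coproduct writes `E_h` as a sum of terms, one for each tensor factor, and terms of
`E_i` and `E_j` belonging to different factors commute up to a scalar `braid i j` (`termE_braid`).
For families that commute up to these scalars, the mixed contributions to every relation cancel
(`serre_add`, `higher_serre_add`, `IsSerre.add`), so that the relations pass from one factor to the
tensor product (`isSerre_opE`, `isSerre_opF`).  In the super commutator of `E_h` and `F_h` the terms
of different factors cancel and the others telescope to `K̃_h - K̃_h⁻¹` (`opE_opF_self`).  Together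
with the diagonal action of the `K_i` this gives the module `S^{m|n}` (`rep`).

Each generator, hence each element of `U_υ(gl_{m|n})`, is row finite in the basis of the monomials
`X^{[A]}`, and row finite endomorphisms extend to formal power series compatibly with products
(`extend`, `repSeries`).  The coefficients of `E_h . X^{[A]}` are products of a sign, a power of `υ`
and a quantum integer (`coeff_opE`).  Replacing `A` by `A + diag(λ)` multiplies them by a character
`λ ↦ υ^{λ * j}`, which shifts `j`, except in two columns: in the column `h + 1` the diagonal entry
is lowered, and the summation variable is shifted (`finsum_lower`); in the column `h` it is raised,
and the quantum integer `[λ_h + 1]` is a difference of two characters (`finsum_raise`).  This yields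
the action on `A(j)` (`repSeries_E`, `repSeries_F`), in particular the invariance of the span.

The supports of `A(j)` and `B(j')` are disjoint for `A ≠ B`, and for fixed `A` the linear
independence of the `A(j)` is Dedekind's independence of the characters `λ ↦ υ^{λ * j}`
(`linearIndependent_ser`).  Finally a generator shifts the parity of monomials by its own parity
(`matParity_of_coeff_genOp`).
-/

namespace QuantumGL

noncomputable section

variable {m n : ℕ}

/-! ### The relations among the `E_h` -/

theorem υ_ne_zero : υ ≠ 0 := RatFunc.X_ne_zero

/-- The relations among the `E_h` alone, equivalently among the `F_h` alone, in the definition of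
`U_υ(gl_{m|n})`, imposed on a family of elements of an arbitrary algebra. -/
structure IsSerre {R : Type*} [Ring R] [Algebra Qv R] (X : Fin (m + n - 1) → R) : Prop where
  comm : ∀ a b, (a.val + 1 < b.val ∨ b.val + 1 < a.val) → X a * X b = X b * X a
  serre : ∀ a b, a.val + 1 ≠ m → (a.val + 1 = b.val ∨ b.val + 1 = a.val) →
    X a ^ 2 * X b - (υi (lo a) + (υi (lo a))⁻¹) • (X a * X b * X a) + X b * X a ^ 2 = 0
  odd : ∀ b, b.val + 1 = m → X b ^ 2 = 0
  higher : ∀ a b c, b.val + 1 = m → a.val + 1 = b.val → b.val + 1 = c.val →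
    X b * (X a * X b * X c - υ • (X a * X c * X b) - υ⁻¹ • (X b * X c * X a) + X c * X b * X a)
      + (X a * X b * X c - υ • (X a * X c * X b) - υ⁻¹ • (X b * X c * X a) + X c * X b * X a) * X b
      = 0

section Algebra

variable {k R : Type*} [Field k] [Ring R] [Algebra k R]

/-- The Serre relation is additive in pairs `(x, y)`, `(x', y')` that commute up to the powers of
`q` met between the two summands of a coproduct. -/
theorem serre_add {q : k} (hq : q ≠ 0) {x y x' y' : R}
    (hxx : x * x' = q ^ 2 • (x' * x)) (hxy : x * y' = q⁻¹ • (y' * x))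
    (hyx : y * x' = q⁻¹ • (x' * y)) :
    (x + x') ^ 2 * (y + y') - (q + q⁻¹) • ((x + x') * (y + y') * (x + x')) + (y + y') * (x + x') ^ 2
    = (x ^ 2 * y - (q + q⁻¹) • (x * y * x) + y * x ^ 2)
      + (x' ^ 2 * y' - (q + q⁻¹) • (x' * y' * x') + y' * x' ^ 2) := by
  -- Move the letters with a prime to the left of those without one.
  have hxx' : ∀ z, x * (x' * z) = q ^ 2 • (x' * (x * z)) := fun z => by
    rw [← mul_assoc, hxx, smul_mul_assoc, mul_assoc]
  have hxy' : ∀ z, x * (y' * z) = q⁻¹ • (y' * (x * z)) := fun z => by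
    rw [← mul_assoc, hxy, smul_mul_assoc, mul_assoc]
  have hyx' : ∀ z, y * (x' * z) = q⁻¹ • (x' * (y * z)) := fun z => by
    rw [← mul_assoc, hyx, smul_mul_assoc, mul_assoc]
  simp only [pow_two, mul_add, add_mul, mul_assoc, hxx, hxy, hyx, hxx', hxy', hyx',
    smul_mul_assoc, mul_smul_comm, smul_smul, smul_add]
  match_scalars <;> field_simp <;> ring

/-- The relation of degree four of `U_υ(gl_{m|n})` is additive in triples `(a, b, c)`,
`(a', b', c')` that commute up to the scalars met between the two summands of a coproduct. -/
theorem higher_serre_add {q : k} (hq : q ≠ 0) {a b c a' b' c' : R}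
    (hb : b ^ 2 = 0) (hb' : b' ^ 2 = 0) (hac : a * c = c * a) (hac' : a' * c' = c' * a')
    (hab : a * b' = q⁻¹ • (b' * a)) (hba : b * a' = q⁻¹ • (a' * b))
    (hbc : b * c' = q • (c' * b)) (hcb : c * b' = q • (b' * c))
    (hbb : b * b' = (-1 : k) • (b' * b)) (hac'' : a * c' = c' * a) (hca : c * a' = a' * c) :
    (b + b') * ((a + a') * (b + b') * (c + c') - q • ((a + a') * (c + c') * (b + b'))
        - q⁻¹ • ((b + b') * (c + c') * (a + a')) + (c + c') * (b + b') * (a + a'))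
      + ((a + a') * (b + b') * (c + c') - q • ((a + a') * (c + c') * (b + b'))
        - q⁻¹ • ((b + b') * (c + c') * (a + a')) + (c + c') * (b + b') * (a + a')) * (b + b')
    = (b * (a * b * c - q • (a * c * b) - q⁻¹ • (b * c * a) + c * b * a)
        + (a * b * c - q • (a * c * b) - q⁻¹ • (b * c * a) + c * b * a) * b)
      + (b' * (a' * b' * c' - q • (a' * c' * b') - q⁻¹ • (b' * c' * a') + c' * b' * a')
        + (a' * b' * c' - q • (a' * c' * b') - q⁻¹ • (b' * c' * a') + c' * b' * a') * b') := by
  -- Move all letters with a prime to the left of all letters without one.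
  have ext : ∀ {u v : R} {r : k}, u * v = r • (v * u) →
      ∀ z, u * (v * z) = r • (v * (u * z)) := fun h z => by
    rw [← mul_assoc, h, smul_mul_assoc, mul_assoc]
  have ext1 : ∀ {u v : R}, u * v = v * u → ∀ z, u * (v * z) = v * (u * z) := fun h z => by
    rw [← mul_assoc, h, mul_assoc]
  rw [pow_two] at hb hb'
  have ext0 : ∀ {u : R}, u * u = 0 → ∀ z, u * (u * z) = 0 := fun h z => by
    rw [← mul_assoc, h, zero_mul]
  simp only [mul_add, add_mul, mul_sub, sub_mul, mul_assoc, hb, hb', hac, hac', hab, hba, hbc, hcb,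
    hbb, hac'', hca, ext0 hb, ext0 hb', ext1 hac', ext hab, ext hba, ext hbc, ext hcb,
    ext hbb, ext1 hac'', ext1 hca, mul_zero, smul_zero,
    smul_mul_assoc, mul_smul_comm, smul_smul, smul_add]
  match_scalars <;> field_simp <;> ring

end Algebra

/-! ### The scalars by which different tensor factors commute -/

theorem υi_ne_zero (i : Fin (m + n)) : υi i ≠ 0 := zpow_ne_zero _ υ_ne_zero

theorem par_of_lt {i : Fin (m + n)} (h : i.val < m) : par i = 0 := if_pos h

theorem par_of_le {i : Fin (m + n)} (h : m ≤ i.val) : par i = 1 := if_neg (by omega)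

theorem υi_of_lt {i : Fin (m + n)} (h : i.val < m) : υi i = υ := by simp [υi, par_of_lt h]

theorem υi_of_le {i : Fin (m + n)} (h : m ≤ i.val) : υi i = υ⁻¹ := by simp [υi, par_of_le h]

theorem isOdd_of_eq {h : Fin (m + n - 1)} (hh : h.val + 1 = m) : isOdd h = 1 := if_pos hh

theorem isOdd_of_ne {h : Fin (m + n - 1)} (hh : h.val + 1 ≠ m) : isOdd h = 0 := if_neg hh

theorem isOdd_mul_isOdd {i j : Fin (m + n - 1)} (h : i ≠ j) : isOdd i * isOdd j = 0 := by
  by_cases hi : i.val + 1 = m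
  · have hj : j.val + 1 ≠ m := fun hj => h (Fin.ext (by omega))
    rw [isOdd_of_ne hj, mul_zero]
  · rw [isOdd_of_ne hi, zero_mul]

@[simp] theorem lo_val (h : Fin (m + n - 1)) : (lo h).val = h.val := rfl

@[simp] theorem hi_val (h : Fin (m + n - 1)) : (hi h).val = h.val + 1 := rfl

theorem lo_ne_hi (h : Fin (m + n - 1)) : lo h ≠ hi h := by simp [Fin.ext_iff]

theorem υi_hi_of_ne {h : Fin (m + n - 1)} (hh : h.val + 1 ≠ m) : υi (hi h) = υi (lo h) := by
  rcases lt_or_ge (h.val + 1) m with h' | h'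
  · rw [υi_of_lt (by simpa using h'), υi_of_lt (by simp; omega)]
  · rw [υi_of_le (by simpa using h'), υi_of_le (by simp; omega)]

theorem υi_hi_of_eq {h : Fin (m + n - 1)} (hh : h.val + 1 = m) : υi (hi h) = (υi (lo h))⁻¹ := by
  rw [υi_of_le (by simp; omega), υi_of_lt (by simp; omega)]

theorem υi_add_inv (i : Fin (m + n)) : υi i + (υi i)⁻¹ = υ + υ⁻¹ := by
  rcases lt_or_ge i.val m with h | h
  · rw [υi_of_lt h]
  · rw [υi_of_le h, inv_inv, add_comm]

theorem par_hi_of_ne {h : Fin (m + n - 1)} (hh : h.val + 1 ≠ m) : par (hi h) = par (lo h) := by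
  rcases lt_or_ge (h.val + 1) m with h' | h'
  · rw [par_of_lt (by simpa using h'), par_of_lt (by simp; omega)]
  · rw [par_of_le (by simpa using h'), par_of_le (by simp; omega)]

/-- The weights of `K̃_h = K_h K_{h+1}⁻¹`, which scales `X^{(a)}` by `∏ i, ktWeight h i ^ a i`. -/
def ktWeight (h : Fin (m + n - 1)) (i : Fin (m + n)) : Qv :=
  if i = lo h then υi (lo h) else if i = hi h then (υi (hi h))⁻¹ else 1

theorem ktWeight_ne_zero (h : Fin (m + n - 1)) (i : Fin (m + n)) : ktWeight h i ≠ 0 := by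
  unfold ktWeight
  split_ifs <;> simp [υi_ne_zero]

/-- The scalar `(-1)^{ij} υ^{α_i * α_j}` by which the root vectors of index `i` and `j` in two
different tensor factors commute. -/
def braid (i j : Fin (m + n - 1)) : Qv :=
  (-1) ^ (isOdd i * isOdd j) * (ktWeight i (lo j) / ktWeight i (hi j))

theorem braid_of_far {i j : Fin (m + n - 1)} (h : i.val + 1 < j.val ∨ j.val + 1 < i.val) :
    braid i j = 1 := by
  have h1 : isOdd i * isOdd j = 0 := isOdd_mul_isOdd fun hij => by subst hij; omega
  have h2 : lo j ≠ lo i := by simp [Fin.ext_iff]; omega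
  have h3 : lo j ≠ hi i := by simp [Fin.ext_iff]; omega
  have h4 : hi j ≠ lo i := by simp [Fin.ext_iff]; omega
  have h5 : hi j ≠ hi i := by simp [Fin.ext_iff]; omega
  simp [braid, ktWeight, h1, h2, h3, h4, h5]

theorem braid_self_of_ne {i : Fin (m + n - 1)} (h : i.val + 1 ≠ m) : braid i i = υi (lo i) ^ 2 := by
  simp [braid, ktWeight, isOdd_of_ne h, (lo_ne_hi i).symm, υi_hi_of_ne h, pow_two]

theorem braid_self_of_eq {i : Fin (m + n - 1)} (h : i.val + 1 = m) : braid i i = -1 := by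
  simp [braid, ktWeight, isOdd_of_eq h, (lo_ne_hi i).symm, υi_hi_of_eq h, υi_ne_zero]

theorem braid_succ {i j : Fin (m + n - 1)} (h : i.val + 1 = j.val) : braid i j = (υi (hi i))⁻¹ := by
  have h1 : isOdd i * isOdd j = 0 := isOdd_mul_isOdd fun hij => by subst hij; omega
  have h2 : lo j = hi i := by simp [Fin.ext_iff]; omega
  have h4 : hi j ≠ lo i := by simp [Fin.ext_iff]; omega
  have h5 : hi j ≠ hi i := by simp [Fin.ext_iff]; omega
  simp [braid, ktWeight, h1, h2, h4, h5, (lo_ne_hi i).symm]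

theorem braid_pred {i j : Fin (m + n - 1)} (h : j.val + 1 = i.val) : braid i j = (υi (lo i))⁻¹ := by
  have h1 : isOdd i * isOdd j = 0 := isOdd_mul_isOdd fun hij => by subst hij; omega
  have h2 : hi j = lo i := by simp [Fin.ext_iff]; omega
  have h4 : lo j ≠ lo i := by simp [Fin.ext_iff]; omega
  have h5 : lo j ≠ hi i := by simp [Fin.ext_iff]; omega
  simp [braid, ktWeight, h1, h2, h4, h5]

theorem braid_adjacent {i j : Fin (m + n - 1)} (hi' : i.val + 1 ≠ m)
    (h : i.val + 1 = j.val ∨ j.val + 1 = i.val) : braid i j = (υi (lo i))⁻¹ := by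
  rcases h with h | h
  · rw [braid_succ h, υi_hi_of_ne hi']
  · exact braid_pred h

theorem braid_adjacent' {i j : Fin (m + n - 1)} (hi' : i.val + 1 ≠ m)
    (h : i.val + 1 = j.val ∨ j.val + 1 = i.val) : braid j i = (υi (lo i))⁻¹ := by
  rcases h with h | h
  · rw [braid_pred h, ← υi_hi_of_ne hi']
    congr 2
    simp [Fin.ext_iff]; omega
  · rw [braid_succ h]
    congr 2
    simp [Fin.ext_iff]; omega

/-! ### Compatibility of the relations with the coproduct -/

namespace IsSerre

variable {R : Type*} [Ring R] [Algebra Qv R] {X Y : Fin (m + n - 1) → R}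

/-- The compatibility of the relations with the coproduct: the two summands of a coproduct commute
up to the scalars `braid`, and the mixed terms in each relation cancel. -/
theorem add (hX : IsSerre X) (hY : IsSerre Y)
    (h : ∀ i j, X i * Y j = braid i j • (Y j * X i)) : IsSerre (fun i => X i + Y i) where
  comm a b hab := by
    have h1 := h a b
    have h2 := h b a
    rw [braid_of_far hab, one_smul] at h1
    rw [braid_of_far hab.symm, one_smul] at h2
    simp only [add_mul, mul_add, hX.comm a b hab, hY.comm a b hab, h1, h2]
    abel
  serre a b ha hab := by
    rw [serre_add (υi_ne_zero (lo a)), hX.serre a b ha hab, hY.serre a b ha hab, add_zero]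
    · rw [h, braid_self_of_ne ha]
    · rw [h, braid_adjacent ha hab]
    · rw [h, braid_adjacent' ha hab]
  odd b hb := by
    have h1 := h b b
    rw [braid_self_of_eq hb] at h1
    have h2 := hX.odd b hb
    have h3 := hY.odd b hb
    rw [pow_two] at *
    simp [add_mul, mul_add, h1, h2, h3]
  higher a b c hb ha hc := by
    have e1 : υi (lo b) = υ := υi_of_lt (by simp; omega)
    have e2 : υi (hi b) = υ⁻¹ := υi_of_le (by simp; omega)
    have e3 : υi (lo c) = υ⁻¹ := υi_of_le (by simp; omega)
    have e4 : υi (hi a) = υ := υi_of_lt (by simp; omega)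
    have hac : a.val + 1 < c.val ∨ c.val + 1 < a.val := by omega
    rw [higher_serre_add υ_ne_zero (hX.odd b hb) (hY.odd b hb) (hX.comm a c hac) (hY.comm a c hac),
      hX.higher a b c hb ha hc, hY.higher a b c hb ha hc, add_zero]
    · rw [h, braid_succ ha, e4]
    · rw [h, braid_pred ha, e1]
    · rw [h, braid_succ hc, e2, inv_inv]
    · rw [h, braid_pred hc, e3, inv_inv]
    · rw [h, braid_self_of_eq hb]
    · rw [h, braid_of_far hac, one_smul]
    · rw [h, braid_of_far hac.symm, one_smul]

theorem zero : IsSerre (fun _ : Fin (m + n - 1) => (0 : R)) where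
  comm := by simp
  serre := by simp
  odd := by simp
  higher := by simp

theorem sum {ι : Type*} [LinearOrder ι] (s : Finset ι) {X : ι → Fin (m + n - 1) → R}
    (hX : ∀ k, IsSerre (X k))
    (h : ∀ k l, k < l → ∀ i j, X k i * X l j = braid i j • (X l j * X k i)) :
    IsSerre (fun i => ∑ k ∈ s, X k i) := by
  induction s using Finset.induction_on_max with
  | empty => simpa using zero
  | insert a s ha ih =>
    have hnot : a ∉ s := fun h' => lt_irrefl _ (ha a h')
    simp only [Finset.sum_insert hnot]
    simp only [add_comm (X a _)]
    refine ih.add (hX a) fun i j => ?_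
    rw [Finset.sum_mul, Finset.mul_sum, Finset.smul_sum]
    exact Finset.sum_congr rfl fun k hk => h k a (ha k hk) i j

theorem map {R' : Type*} [Ring R'] [Algebra Qv R'] (f : R →ₐ[Qv] R') (hX : IsSerre X) :
    IsSerre (fun i => f (X i)) where
  comm a b hab := by rw [← map_mul, hX.comm a b hab, map_mul]
  serre a b ha hab := by
    have := congrArg f (hX.serre a b ha hab)
    simpa only [map_add, map_sub, map_mul, map_pow, map_smul, map_zero] using this
  odd b hb := by rw [← map_pow, hX.odd b hb, map_zero]
  higher a b c hb ha hc := by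
    have := congrArg f (hX.higher a b c hb ha hc)
    simpa only [map_add, map_sub, map_mul, map_pow, map_smul, map_zero] using this

/-- The relations are homogeneous, so that they survive multiplication by elements commuting with
everything in sight. -/
theorem mul_of_commute (hX : IsSerre X) (hY : ∀ i j, Commute (Y i) (Y j))
    (h : ∀ i j, Commute (Y i) (X j)) : IsSerre (fun i => X i * Y i) := by
  have ext : ∀ {u v : R}, Commute u v → ∀ z, u * (v * z) = v * (u * z) := fun h z => by
    rw [← mul_assoc, h.eq, mul_assoc]
  refine ⟨fun a b hab => ?_, fun a b ha hab => ?_, fun b hb => ?_, fun a b c hb ha hc => ?_⟩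
  · have : X a * Y a * (X b * Y b) = X a * X b * (Y a * Y b) := by
      simp only [mul_assoc, ext (h _ _)]
    rw [this, hX.comm a b hab, (hY a b).eq]
    simp only [mul_assoc, ext (h _ _)]
  · have := congrArg (· * (Y a * Y a * Y b)) (hX.serre a b ha hab)
    simp only [zero_mul] at this
    rw [← this]
    simp only [pow_two, add_mul, sub_mul, smul_mul_assoc, mul_assoc, ext (h _ _), ext (hY b a),
      (hY b a).eq]
  · have := congrArg (· * (Y b * Y b)) (hX.odd b hb)
    simp only [zero_mul] at this
    rw [← this]
    simp only [pow_two, mul_assoc, ext (h _ _)]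
  · have := congrArg (· * (Y a * Y b * Y b * Y c)) (hX.higher a b c hb ha hc)
    simp only [zero_mul] at this
    rw [← this]
    simp only [add_mul, sub_mul, mul_add, mul_sub, smul_mul_assoc, mul_smul_comm, mul_assoc,
      ext (h _ _), ext (hY b a), (hY c a).eq, (hY c b).eq]

end IsSerre

/-! ### Oscillators -/

/-- A family of creation operators `X i` and annihilation operators `Y i` (up to rescaling), bosonic
`q`-oscillators if `î = p` and fermionic ones if `î ≠ p`.  The conditions are symmetric in `X` and
`Y`. -/
structure IsOscillator {R : Type*} [Ring R] [Algebra Qv R] (p : ℕ) (X Y : Fin (m + n) → R) :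
    Prop where
  comm_XX : ∀ i j, i ≠ j → Commute (X i) (X j)
  comm_XY : ∀ i j, i ≠ j → Commute (X i) (Y j)
  comm_YY : ∀ i j, i ≠ j → Commute (Y i) (Y j)
  serre_X : ∀ i, par i = p →
    X i * X i * Y i - (υ + υ⁻¹) • (X i * Y i * X i) + Y i * X i * X i = 0
  serre_Y : ∀ i, par i = p →
    Y i * Y i * X i - (υ + υ⁻¹) • (Y i * X i * Y i) + X i * Y i * Y i = 0
  sq_X : ∀ i, par i ≠ p → X i * X i = 0
  sq_Y : ∀ i, par i ≠ p → Y i * Y i = 0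
  XYX : ∀ i, par i ≠ p → X i * Y i * X i = X i
  YXY : ∀ i, par i ≠ p → Y i * X i * Y i = Y i

section Words

variable {k R : Type*} [Field k] [Ring R] [Algebra k R]

/-- The Serre relation for `E = xy` and `E' = x'y'`, where `x'` is paired with `y`, multiplied out
of the relation between `x'` and `y`. -/
theorem serre_of_oscillator {c : k} {x y x' y' : R} (hxy : Commute y x) (hxx : Commute x' x)
    (hxy' : Commute y' x) (hy : Commute y' y)
    (h : y * y * x' - c • (y * x' * y) + x' * y * y = 0) :
    (x * y) ^ 2 * (x' * y') - c • (x * y * (x' * y') * (x * y)) + x' * y' * (x * y) ^ 2 = 0 := by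
  have := congrArg (fun z => x * x * z * y') h
  simp only [mul_zero, zero_mul] at this
  rw [← this]
  simp only [pow_two, mul_add, mul_sub, add_mul, sub_mul, mul_assoc, smul_mul_assoc, mul_smul_comm,
    hxy.left_comm, hxx.left_comm, hxy'.left_comm, hy.left_comm, hy.eq]

/-- The Serre relation for `E = xy` and `E' = x'y'` is void if `x` is fermionic. -/
theorem serre_of_sq_eq_zero {c : k} {x y x' y' : R} (hxy : Commute y x) (hxx : Commute x' x)
    (hxy' : Commute y' x) (h : x * x = 0) :
    (x * y) ^ 2 * (x' * y') - c • (x * y * (x' * y') * (x * y)) + x' * y' * (x * y) ^ 2 = 0 := by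
  have h' : ∀ z, x * (x * z) = 0 := fun z => by rw [← mul_assoc, h, zero_mul]
  simp [pow_two, mul_assoc, hxy.left_comm, hxx.left_comm, hxy'.left_comm, h']

/-- The relation of degree four for `us`, `tv`, `wx`, where `s` is paired with `t` and `w` with `v`,
in the case that `v` and `w` are fermionic: the fermionic relations reduce it to the Serre relation
between `t` and `s`. -/
theorem higher_serre_of_right {q : k} {u s t v w x : R}
    (htu : Commute t u) (hvu : Commute v u) (hwu : Commute w u)
    (hxu : Commute x u) (hvs : Commute v s) (hvt : Commute v t) (hws : Commute w s)
    (hwt : Commute w t) (hxs : Commute x s) (hxt : Commute x t) (hxv : Commute x v)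
    (hv : v * v = 0) (hvwv : v * w * v = v)
    (h : t * t * s - (q + q⁻¹) • (t * s * t) + s * t * t = 0) :
    (t * v) * ((u * s) * (t * v) * (w * x) - q • ((u * s) * (w * x) * (t * v))
        - q⁻¹ • ((t * v) * (w * x) * (u * s)) + (w * x) * (t * v) * (u * s))
      + ((u * s) * (t * v) * (w * x) - q • ((u * s) * (w * x) * (t * v))
        - q⁻¹ • ((t * v) * (w * x) * (u * s)) + (w * x) * (t * v) * (u * s)) * (t * v) = 0 := by
  have := congrArg (fun z => u * z * v * x) h
  simp only [mul_zero, zero_mul] at this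
  rw [← this]
  have hv' : ∀ z, v * (v * z) = 0 := fun z => by rw [← mul_assoc, hv, zero_mul]
  have hvwv' : ∀ z, v * (w * (v * z)) = v * z := fun z => by
    rw [← mul_assoc, ← mul_assoc, hvwv]
  simp only [mul_add, mul_sub, add_mul, sub_mul, mul_assoc, smul_mul_assoc, mul_smul_comm,
    htu.left_comm, hvu.left_comm, hwu.left_comm, hxu.left_comm, hvs.left_comm,
    hvt.left_comm, hws.left_comm, hwt.left_comm, hxt.left_comm,
    hxs.eq, hxv.eq, hv', hvwv',
    mul_zero, smul_zero, add_smul]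
  abel

/-- The relation of degree four for `us`, `tv`, `wx`, where `s` is paired with `t` and `w` with `v`,
in the case that `s` and `t` are fermionic: the fermionic relations reduce it to the Serre relation
between `v` and `w`. -/
theorem higher_serre_of_left {q : k} {u s t v w x : R}
    (htu : Commute t u) (hvu : Commute v u) (hwu : Commute w u)
    (hxu : Commute x u) (hvs : Commute v s) (hvt : Commute v t) (hws : Commute w s)
    (hwt : Commute w t) (hxs : Commute x s) (hxt : Commute x t) (hxv : Commute x v)
    (ht : t * t = 0) (htst : t * s * t = t)
    (h : v * v * w - (q + q⁻¹) • (v * w * v) + w * v * v = 0) :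
    (t * v) * ((u * s) * (t * v) * (w * x) - q • ((u * s) * (w * x) * (t * v))
        - q⁻¹ • ((t * v) * (w * x) * (u * s)) + (w * x) * (t * v) * (u * s))
      + ((u * s) * (t * v) * (w * x) - q • ((u * s) * (w * x) * (t * v))
        - q⁻¹ • ((t * v) * (w * x) * (u * s)) + (w * x) * (t * v) * (u * s)) * (t * v) = 0 := by
  have := congrArg (fun z => u * t * z * x) h
  simp only [mul_zero, zero_mul] at this
  rw [← this]
  have ht' : ∀ z, t * (t * z) = 0 := fun z => by rw [← mul_assoc, ht, zero_mul]
  have htst' : ∀ z, t * (s * (t * z)) = t * z := fun z => by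
    rw [← mul_assoc, ← mul_assoc, htst]
  simp only [mul_add, mul_sub, add_mul, sub_mul, mul_assoc, smul_mul_assoc, mul_smul_comm,
    htu.left_comm, hvu.left_comm, hwu.left_comm, hxu.left_comm, hvs.left_comm,
    hvt.left_comm, hws.left_comm, hwt.left_comm, hxt.left_comm,
    hxs.eq, hxv.eq, ht', htst',
    mul_zero, smul_zero, add_smul]
  abel

end Words

namespace IsOscillator

variable {R : Type*} [Ring R] [Algebra Qv R] {p : ℕ} {X Y : Fin (m + n) → R}

theorem symm (h : IsOscillator p X Y) : IsOscillator p Y X where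
  comm_XX := h.comm_YY
  comm_XY i j hij := (h.comm_XY j i hij.symm).symm
  comm_YY := h.comm_XX
  serre_X := h.serre_Y
  serre_Y := h.serre_X
  sq_X := h.sq_Y
  sq_Y := h.sq_X
  XYX := h.YXY
  YXY := h.XYX

/-- The `E_h` satisfy their relations in the oscillator realization `E_h = X_h Y_{h+1}`. -/
theorem isSerre (h : IsOscillator p X Y) (hp : p < 2) :
    IsSerre (fun a : Fin (m + n - 1) => X (lo a) * Y (hi a)) where
  comm a b hab := by
    have h1 : lo a ≠ lo b := by simp [Fin.ext_iff]; omega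
    have h2 : lo a ≠ hi b := by simp [Fin.ext_iff]; omega
    have h3 : hi a ≠ lo b := by simp [Fin.ext_iff]; omega
    have h4 : hi a ≠ hi b := by simp [Fin.ext_iff]; omega
    exact (((h.comm_XX _ _ h1).mul_right (h.comm_XY _ _ h2)).mul_left
      ((h.comm_XY _ _ h3.symm).symm.mul_right (h.comm_YY _ _ h4))).eq
  serre a b ha hab := by
    rw [υi_add_inv]
    have h0 := lo_ne_hi a
    have h0' := lo_ne_hi b
    have hpar := par_hi_of_ne ha
    rcases hab with hab | hab
    · have e : lo b = hi a := by simp [Fin.ext_iff]; omega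
      have h1 : lo a ≠ hi b := by simp [Fin.ext_iff]; omega
      have h2 : hi a ≠ hi b := by rwa [← e]
      rw [e]
      by_cases hpe : par (lo a) = p
      · exact serre_of_oscillator (h.comm_XY _ _ h0).symm (h.comm_XX _ _ h0).symm
          (h.comm_XY _ _ h1).symm (h.comm_YY _ _ h2).symm
          (h.serre_Y _ (hpar.trans hpe))
      · exact serre_of_sq_eq_zero (h.comm_XY _ _ h0).symm (h.comm_XX _ _ h0).symm
          (h.comm_XY _ _ h1).symm (h.sq_X _ hpe)
    · have e : hi b = lo a := by simp [Fin.ext_iff]; omega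
      have h1 : hi a ≠ lo b := by simp [Fin.ext_iff]; omega
      have h2 : lo b ≠ lo a := by rwa [← e]
      rw [e, (h.comm_XY _ _ h0).eq, (h.comm_XY _ _ h2).eq]
      by_cases hpe : par (lo a) = p
      · exact serre_of_oscillator (h.comm_XY _ _ h0) (h.comm_YY _ _ h0)
          (h.comm_XY _ _ h1.symm) (h.comm_XX _ _ h2)
          (h.serre_X _ hpe)
      · exact serre_of_sq_eq_zero (h.comm_XY _ _ h0) (h.comm_YY _ _ h0)
          (h.comm_XY _ _ h1.symm) (h.sq_Y _ (by rwa [hpar]))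
  odd b hb := by
    have e1 : par (lo b) = 0 := par_of_lt (by simp; omega)
    have e2 : par (hi b) = 1 := par_of_le (by simp; omega)
    rw [(h.comm_XY _ _ (lo_ne_hi b)).mul_pow, pow_two, pow_two]
    by_cases hp0 : p = 0
    · rw [h.sq_Y _ (by omega), mul_zero]
    · rw [h.sq_X _ (by omega), zero_mul]
  higher a b c hb ha hc := by
    have e1 : par (lo b) = 0 := par_of_lt (by simp; omega)
    have e2 : par (hi b) = 1 := par_of_le (by simp; omega)
    have ea : hi a = lo b := by simp [Fin.ext_iff]; omega
    have ec : lo c = hi b := by simp [Fin.ext_iff]; omega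
    have h1 : lo a ≠ lo b := by simp [Fin.ext_iff]; omega
    have h2 : lo a ≠ hi b := by simp [Fin.ext_iff]; omega
    have h3 : lo a ≠ hi c := by simp [Fin.ext_iff]; omega
    have h4 : lo b ≠ hi c := by simp [Fin.ext_iff]; omega
    have h5 : hi b ≠ hi c := by simp [Fin.ext_iff]; omega
    have h6 := lo_ne_hi b
    rw [ea, ec]
    by_cases hp0 : p = 0
    · exact higher_serre_of_right (h.comm_XX _ _ h1).symm
        (h.comm_XY _ _ h2).symm (h.comm_XX _ _ h2).symm (h.comm_XY _ _ h3).symm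
        (h.comm_YY _ _ h6).symm (h.comm_XY _ _ h6).symm (h.comm_XY _ _ h6.symm)
        (h.comm_XX _ _ h6).symm (h.comm_YY _ _ h4).symm (h.comm_XY _ _ h4).symm
        (h.comm_YY _ _ h5).symm (h.sq_Y _ (by omega))
        (h.YXY _ (by omega)) (h.serre_X _ (by omega))
    · exact higher_serre_of_left (h.comm_XX _ _ h1).symm
        (h.comm_XY _ _ h2).symm (h.comm_XX _ _ h2).symm (h.comm_XY _ _ h3).symm
        (h.comm_YY _ _ h6).symm (h.comm_XY _ _ h6).symm (h.comm_XY _ _ h6.symm)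
        (h.comm_XX _ _ h6).symm (h.comm_YY _ _ h4).symm (h.comm_XY _ _ h4).symm
        (h.comm_YY _ _ h5).symm (h.sq_X _ (by omega))
        (h.XYX _ (by omega)) (h.serre_Y _ (by omega))

end IsOscillator

/-! ### Operators on a single tensor factor -/

section Factor

variable {p : ℕ}

theorem dpow_of_valid {a : Fin (m + n) → ℕ} (ha : ∀ i, par i ≠ p → a i ≤ 1) :
    dpow p a = Finsupp.single ⟨a, ha⟩ 1 := dif_pos ha

theorem dpow_of_not_valid {a : Fin (m + n) → ℕ} {i : Fin (m + n)} (hi : par i ≠ p)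
    (ha : 1 < a i) : dpow p a = 0 := dif_neg fun h => absurd (h i hi) (by omega)

theorem factor_hom_ext {f g : SFactor m n p →ₗ[Qv] SFactor m n p}
    (h : ∀ a : Fin (m + n) → ℕ, (∀ i, par i ≠ p → a i ≤ 1) → f (dpow p a) = g (dpow p a)) :
    f = g := by
  refine Finsupp.lhom_ext' fun a => LinearMap.ext_ring ?_
  have := h a.1 a.2
  rw [dpow_of_valid a.2] at this
  exact this

theorem linearCombination_dpow {v : Expo m n p → SFactor m n p} {a : Fin (m + n) → ℕ}
    (ha : ∀ i, par i ≠ p → a i ≤ 1) :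
    Finsupp.linearCombination Qv v (dpow p a) = v ⟨a, ha⟩ := by
  rw [dpow_of_valid ha, Finsupp.linearCombination_single, one_smul]

variable (p) in
/-- The creation operator `X^{(a)} ↦ [a_i + 1] X^{(a + e_i)}`, multiplication by `X_i`. -/
def osR (i : Fin (m + n)) : Module.End Qv (SFactor m n p) :=
  Finsupp.linearCombination Qv fun a => qint (a.1 i + 1) • dpow p (a.1 + Pi.single i 1)

variable (p) in
/-- The annihilation operator `X^{(a)} ↦ X^{(a - e_i)}`, a `q`-derivative in `X_i`. -/
def osL (i : Fin (m + n)) : Module.End Qv (SFactor m n p) :=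
  Finsupp.linearCombination Qv fun a => if 0 < a.1 i then dpow p (a.1 - Pi.single i 1) else 0

variable (p) in
/-- The diagonal operator `X^{(a)} ↦ (∏ i, w i ^ a i) X^{(a)}` attached to weights `w`. -/
def facDiag (w : Fin (m + n) → Qv) : Module.End Qv (SFactor m n p) :=
  Finsupp.linearCombination Qv fun a => (∏ i, w i ^ a.1 i) • dpow p a.1

theorem osR_dpow (i : Fin (m + n)) (a : Fin (m + n) → ℕ) :
    osR p i (dpow p a) = qint (a i + 1) • dpow p (a + Pi.single i 1) := by
  by_cases ha : ∀ i, par i ≠ p → a i ≤ 1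
  · exact linearCombination_dpow ha
  · push Not at ha
    obtain ⟨j, hj, h⟩ := ha
    rw [dpow_of_not_valid hj h, dpow_of_not_valid hj, map_zero, smul_zero]
    simp; omega

/-- The hypothesis cannot be dropped: for `a_i = 2` and `X_i` odd the monomial `X^{(a)}` is `0`, but
`X^{(a - e_i)}` need not be. -/
theorem osL_dpow (i : Fin (m + n)) (a : Fin (m + n) → ℕ) (hi : par i ≠ p → a i ≤ 1) :
    osL p i (dpow p a) = if 0 < a i then dpow p (a - Pi.single i 1) else 0 := by
  by_cases ha : ∀ i, par i ≠ p → a i ≤ 1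
  · exact linearCombination_dpow ha
  · push Not at ha
    obtain ⟨j, hj, h⟩ := ha
    have hji : j ≠ i := fun e => by subst e; exact absurd (hi hj) (by omega)
    rw [dpow_of_not_valid hj h, dpow_of_not_valid hj, map_zero, ite_self]
    simp [Pi.single_eq_of_ne hji, h]

theorem facDiag_dpow (w : Fin (m + n) → Qv) (a : Fin (m + n) → ℕ) :
    facDiag p w (dpow p a) = (∏ i, w i ^ a i) • dpow p a := by
  by_cases ha : ∀ i, par i ≠ p → a i ≤ 1
  · exact linearCombination_dpow ha
  · push Not at ha
    obtain ⟨j, hj, h⟩ := ha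
    rw [dpow_of_not_valid hj h, map_zero, smul_zero]

theorem facDiag_mul (w w' : Fin (m + n) → Qv) : facDiag p w * facDiag p w' = facDiag p (w * w') :=
  factor_hom_ext fun a _ => by
    simp only [Module.End.mul_apply, facDiag_dpow, map_smul, smul_smul, Pi.mul_apply, mul_pow,
      Finset.prod_mul_distrib]
    rw [mul_comm]

theorem facDiag_one : facDiag p (1 : Fin (m + n) → Qv) = 1 :=
  factor_hom_ext fun a _ => by simp [facDiag_dpow]

theorem facDiag_comm (w w' : Fin (m + n) → Qv) : Commute (facDiag p w) (facDiag p w') := by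
  rw [Commute, SemiconjBy, facDiag_mul, facDiag_mul, mul_comm]

theorem prod_pow_add_single (w : Fin (m + n) → Qv) (a : Fin (m + n) → ℕ) (i : Fin (m + n)) :
    ∏ k, w k ^ (a + Pi.single i 1 : Fin (m + n) → ℕ) k = w i * ∏ k, w k ^ a k := by
  simp only [Pi.add_apply, pow_add, Finset.prod_mul_distrib]
  rw [mul_comm]
  congr 1
  rw [Finset.prod_eq_single i (fun j _ h => by simp [h]) (by simp)]
  simp

theorem sub_add_single {a : Fin (m + n) → ℕ} {i : Fin (m + n)} (h : 0 < a i) :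
    a - Pi.single i 1 + Pi.single i 1 = a := by
  refine tsub_add_cancel_of_le fun j => ?_
  by_cases e : j = i
  · subst e; simpa using Nat.succ_le_of_lt h
  · simp [e]

theorem prod_pow_sub_single {w : Fin (m + n) → Qv} {a : Fin (m + n) → ℕ} {i : Fin (m + n)}
    (h : 0 < a i) : w i * ∏ k, w k ^ (a - Pi.single i 1 : Fin (m + n) → ℕ) k = ∏ k, w k ^ a k := by
  rw [← prod_pow_add_single, sub_add_single h]

theorem facDiag_mul_osR (w : Fin (m + n) → Qv) (i : Fin (m + n)) :
    facDiag p w * osR p i = w i • (osR p i * facDiag p w) :=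
  factor_hom_ext fun a _ => by
    simp only [Module.End.mul_apply, LinearMap.smul_apply, facDiag_dpow, osR_dpow, map_smul,
      smul_smul, prod_pow_add_single]
    congr 1; ring

theorem facDiag_mul_osL {w : Fin (m + n) → Qv} {i : Fin (m + n)} (hw : w i ≠ 0) :
    facDiag p w * osL p i = (w i)⁻¹ • (osL p i * facDiag p w) :=
  factor_hom_ext fun a ha => by
    simp only [Module.End.mul_apply, LinearMap.smul_apply, facDiag_dpow, osL_dpow i a (ha i),
      map_smul, smul_smul]
    split_ifs with h
    · rw [facDiag_dpow, ← prod_pow_sub_single h, inv_mul_cancel_left₀ hw]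
    · simp

theorem υ_sub_inv_ne_zero : υ - υ⁻¹ ≠ 0 := by
  intro h
  have h1 : υ * υ = 1 := by
    have := sub_eq_zero.1 h
    nth_rewrite 2 [this]
    exact mul_inv_cancel₀ υ_ne_zero
  have h2 : (Polynomial.X * Polynomial.X : Polynomial ℚ) = 1 := by
    apply RatFunc.algebraMap_injective ℚ
    simpa [υ, RatFunc.algebraMap_X] using h1
  have := congrArg (Polynomial.eval 0) h2
  simp at this

/-- The quantum integers are invariant under `υ ↦ υ⁻¹`. -/
theorem qint_eq (i : Fin (m + n)) (a : ℤ) :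
    qint a = (υi i ^ a - (υi i ^ a)⁻¹) / (υi i - (υi i)⁻¹) := by
  rcases lt_or_ge i.val m with h | h
  · rw [υi_of_lt h, qint, zpow_neg]
  · rw [υi_of_le h, qint, zpow_neg, inv_inv, inv_zpow', zpow_neg, inv_inv,
      ← neg_sub υ⁻¹ υ, div_neg, ← neg_div, neg_sub]

theorem υi_sub_inv_ne_zero (i : Fin (m + n)) : υi i - (υi i)⁻¹ ≠ 0 := by
  rcases lt_or_ge i.val m with h | h
  · rw [υi_of_lt h]; exact υ_sub_inv_ne_zero
  · rw [υi_of_le h, inv_inv, ← neg_sub]; exact neg_ne_zero.2 υ_sub_inv_ne_zero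

@[simp] theorem qint_zero : qint 0 = 0 := by simp [qint]

@[simp] theorem qint_one : qint 1 = 1 := by
  simp only [qint, zpow_one, zpow_neg_one]
  exact div_self υ_sub_inv_ne_zero

theorem qint_add_one_add_qint_sub_one (a : ℤ) :
    qint (a + 1) + qint (a - 1) = (υ + υ⁻¹) * qint a := by
  have := υ_sub_inv_ne_zero
  have h0 := υ_ne_zero
  simp only [qint, zpow_neg, zpow_add₀ h0, zpow_sub₀ h0, zpow_one]
  field_simp
  ring

theorem qint_mul_sub (a b : ℤ) :
    qint a * qint (b + 1) - qint (a + 1) * qint b = qint (a - b) := by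
  have := υ_sub_inv_ne_zero
  have h0 := υ_ne_zero
  simp only [qint, zpow_neg, zpow_add₀ h0, zpow_sub₀ h0, zpow_one]
  rw [div_mul_div_comm, div_mul_div_comm, ← sub_div, div_eq_div_iff (by positivity) this]
  field_simp
  ring

/-- The eigenvalue of `osL p i * osR p i` on a monomial `X^{(a)}` with `a_i = t`. -/
def lrEigen (p : ℕ) (i : Fin (m + n)) (t : ℕ) : Qv :=
  if par i = p then qint (t + 1) else if t = 0 then 1 else 0

theorem osR_osL_dpow (i : Fin (m + n)) {a : Fin (m + n) → ℕ} (ha : par i ≠ p → a i ≤ 1) :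
    osR p i (osL p i (dpow p a)) = qint (a i) • dpow p a := by
  rw [osL_dpow i a ha]
  split_ifs with h
  · rw [osR_dpow, sub_add_single h]
    congr 2
    simp only [Pi.sub_apply, Pi.single_eq_same]
    omega
  · have : a i = 0 := by omega
    simp [this]

theorem osL_osR_dpow (i : Fin (m + n)) (a : Fin (m + n) → ℕ) :
    osL p i (osR p i (dpow p a)) = lrEigen p i (a i) • dpow p a := by
  rw [osR_dpow, map_smul]
  by_cases hp : par i = p
  · rw [osL_dpow i _ fun h => absurd hp h]
    simp [lrEigen, hp]
  · rw [lrEigen, if_neg hp]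
    by_cases h : a i = 0
    · rw [osL_dpow i _ fun _ => by simp [h]]
      simp [h]
    · rw [dpow_of_not_valid hp, map_zero, smul_zero, if_neg h, zero_smul]
      simp; omega

theorem osR_comm (i j : Fin (m + n)) : Commute (osR p i) (osR p j) := by
  by_cases h : i = j
  · rw [h]
  refine factor_hom_ext fun a _ => ?_
  simp only [Module.End.mul_apply, osR_dpow, map_smul, smul_smul, Pi.add_apply,
    Pi.single_eq_of_ne h, Pi.single_eq_of_ne (Ne.symm h), add_zero, add_right_comm a]
  rw [mul_comm]

theorem osR_osL_comm {i j : Fin (m + n)} (h : i ≠ j) : Commute (osR p i) (osL p j) := by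
  refine factor_hom_ext fun a ha => ?_
  simp only [Module.End.mul_apply, osR_dpow, map_smul]
  rw [osL_dpow j a (ha j),
    osL_dpow j _ fun hj => by simpa [Pi.single_eq_of_ne h.symm] using ha j hj]
  simp only [Pi.add_apply, Pi.single_eq_of_ne h.symm, add_zero]
  split_ifs with hj
  · rw [osR_dpow]
    have e : a + Pi.single i 1 - Pi.single j 1 = a - Pi.single j 1 + Pi.single i 1 := by
      funext k
      by_cases hk : k = j
      · subst hk; simp [Pi.single_eq_of_ne h.symm]
      · simp [hk]
    rw [e]
    simp [Pi.single_eq_of_ne h]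
  · simp

theorem osL_comm (i j : Fin (m + n)) : Commute (osL p i) (osL p j) := by
  by_cases h : i = j
  · rw [h]
  have key : ∀ {i j : Fin (m + n)}, i ≠ j → ∀ a : Fin (m + n) → ℕ, (∀ i, par i ≠ p → a i ≤ 1) →
      osL p i (osL p j (dpow p a)) =
        if 0 < a i ∧ 0 < a j then dpow p (a - Pi.single i 1 - Pi.single j 1) else 0 := by
    intro i j h a ha
    rw [osL_dpow j a (ha j)]
    by_cases hj : 0 < a j
    · rw [if_pos hj, osL_dpow i _ fun hi => by simpa [Pi.single_eq_of_ne h] using ha i hi]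
      simp [Pi.single_eq_of_ne h, hj, tsub_right_comm]
    · simp [hj]
  refine factor_hom_ext fun a ha => ?_
  rw [Module.End.mul_apply, Module.End.mul_apply, key h a ha, key (Ne.symm h) a ha]
  simp only [and_comm, tsub_right_comm (c := Pi.single j 1)]

/-- For even `X_i` the relations amount to `[a] + [a + 2] = (υ + υ⁻¹)[a + 1]`. -/
theorem isOscillator_factor :
    IsOscillator p (osR p : Fin (m + n) → Module.End Qv (SFactor m n p)) (osL p) where
  comm_XX i j _ := osR_comm i j
  comm_XY _ _ h := osR_osL_comm h
  comm_YY i j _ := osL_comm i j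
  serre_X i hi := factor_hom_ext fun a _ => by
    have hv : ∀ a : Fin (m + n) → ℕ, par i ≠ p → a i ≤ 1 := fun _ h => absurd hi h
    simp only [LinearMap.add_apply, LinearMap.sub_apply, LinearMap.smul_apply,
      Module.End.mul_apply, LinearMap.zero_apply]
    rw [osR_osL_dpow i (hv _), osL_osR_dpow i]
    simp only [map_smul, osR_dpow i a]
    rw [osL_osR_dpow i]
    simp only [smul_smul, ← sub_smul, ← add_smul, lrEigen, hi, if_true]
    convert zero_smul Qv _ using 2
    have := qint_add_one_add_qint_sub_one (a i + 1)
    rw [add_sub_cancel_right] at this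
    simp only [Pi.add_apply, Pi.single_eq_same, Nat.cast_add, Nat.cast_one]
    linear_combination qint (a i + 1) * this
  serre_Y i hi := factor_hom_ext fun a ha => by
    have hv : ∀ a : Fin (m + n) → ℕ, par i ≠ p → a i ≤ 1 := fun _ h => absurd hi h
    simp only [LinearMap.add_apply, LinearMap.sub_apply, LinearMap.smul_apply,
      Module.End.mul_apply, LinearMap.zero_apply]
    rw [osL_osR_dpow i, osR_osL_dpow i (hv _)]
    simp only [map_smul]
    rw [osL_dpow i _ (hv _)]
    split_ifs with h
    · rw [osR_osL_dpow i (hv _)]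
      simp only [smul_smul, ← sub_smul, ← add_smul]
      convert zero_smul Qv _ using 2
      have := qint_add_one_add_qint_sub_one (a i)
      simp only [lrEigen, hi, if_true, Pi.sub_apply, Pi.single_eq_same]
      rw [Nat.cast_sub h, Nat.cast_one]
      linear_combination this
    · simp
  sq_X i hi := factor_hom_ext fun a ha => by
    simp only [Module.End.mul_apply, osR_dpow, map_smul]
    rw [dpow_of_not_valid hi (by simp)]
    simp
  sq_Y i hi := factor_hom_ext fun a ha => by
    have := ha i hi
    rw [Module.End.mul_apply, osL_dpow i a (ha i)]
    split_ifs
    · rw [osL_dpow i _ fun _ => by simp; omega, if_neg (by simp; omega), LinearMap.zero_apply]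
    · simp
  XYX i hi := factor_hom_ext fun a ha => by
    have := ha i hi
    simp only [Module.End.mul_apply]
    rw [osL_osR_dpow i, map_smul, osR_dpow]
    rcases Nat.eq_zero_or_pos (a i) with h | h
    · simp [lrEigen, hi, h]
    · rw [dpow_of_not_valid hi (by simp; omega)]
      simp
  YXY i hi := factor_hom_ext fun a ha => by
    have := ha i hi
    simp only [Module.End.mul_apply]
    rw [osR_osL_dpow i (ha i), map_smul, osL_dpow i _ (ha i)]
    rcases Nat.eq_zero_or_pos (a i) with h | h
    · simp [h]
    · have : a i = 1 := by omega
      simp [this]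

theorem facE_eq (h : Fin (m + n - 1)) : facE p h = osR p (lo h) * osL p (hi h) := by
  refine factor_hom_ext fun a ha => ?_
  rw [(osR_osL_comm (lo_ne_hi h)).eq, Module.End.mul_apply, osR_dpow, map_smul,
    osL_dpow (hi h) _ fun hj => by simpa [Pi.single_eq_of_ne (lo_ne_hi h).symm] using ha _ hj, facE,
    linearCombination_dpow ha]
  simp [Pi.single_eq_of_ne (lo_ne_hi h).symm]

theorem facF_eq (h : Fin (m + n - 1)) : facF p h = osL p (lo h) * osR p (hi h) := by
  refine factor_hom_ext fun a ha => ?_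
  rw [← (osR_osL_comm (lo_ne_hi h).symm).eq, Module.End.mul_apply, osL_dpow (lo h) _ (ha _), facF,
    linearCombination_dpow ha]
  split_ifs
  · rw [osR_dpow]; simp [Pi.single_eq_of_ne (lo_ne_hi h).symm]
  · simp

theorem facDiag_mul_facE {w : Fin (m + n) → Qv} (h : Fin (m + n - 1)) (hw : w (hi h) ≠ 0) :
    facDiag p w * facE p h = (w (lo h) / w (hi h)) • (facE p h * facDiag p w) := by
  rw [facE_eq, ← mul_assoc, facDiag_mul_osR, smul_mul_assoc, mul_assoc, facDiag_mul_osL hw,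
    mul_smul_comm, smul_smul, mul_assoc, div_eq_mul_inv]

theorem facDiag_mul_facF {w : Fin (m + n) → Qv} (h : Fin (m + n - 1)) (hw : w (lo h) ≠ 0) :
    facDiag p w * facF p h = (w (hi h) / w (lo h)) • (facF p h * facDiag p w) := by
  rw [facF_eq, ← mul_assoc, facDiag_mul_osL hw, smul_mul_assoc, mul_assoc, facDiag_mul_osR,
    mul_smul_comm, smul_smul, mul_assoc, div_eq_mul_inv, mul_comm]

theorem isSerre_facE (hp : p < 2) : IsSerre (facE (m := m) (n := n) p) := by
  have := isOscillator_factor.isSerre (m := m) (n := n) hp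
  simpa only [← facE_eq] using this

theorem isSerre_facF (hp : p < 2) : IsSerre (facF (m := m) (n := n) p) := by
  have := isOscillator_factor.symm.isSerre (m := m) (n := n) hp
  simpa only [← facF_eq] using this

/-- The weights of `K_i`, which scales `X^{(a)}` by `υ_i ^ a_i`. -/
def kWeight (i j : Fin (m + n)) : Qv := if j = i then υi i else 1

/-- The weights of the parity operator `X^{(a)} ↦ (-1)^{q â} X^{(a)}`. -/
def signWeight (p q : ℕ) (j : Fin (m + n)) : Qv := if par j ≠ p then (-1) ^ q else 1

theorem kWeight_ne_zero (i j : Fin (m + n)) : kWeight i j ≠ 0 := by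
  unfold kWeight; split_ifs <;> simp [υi_ne_zero]

theorem signWeight_ne_zero (p q : ℕ) (j : Fin (m + n)) : signWeight p q j ≠ 0 := by
  unfold signWeight; split_ifs <;> simp

theorem ktWeight_eq (h : Fin (m + n - 1)) :
    ktWeight h = kWeight (lo h) * (kWeight (hi h))⁻¹ := by
  have := lo_ne_hi h
  funext i
  simp only [ktWeight, kWeight, Pi.mul_apply, Pi.inv_apply]
  by_cases h1 : i = lo h
  · subst h1; simp [this]
  · by_cases h2 : i = hi h
    · subst h2; simp [this.symm]
    · simp [h1, h2]

theorem facK_eq (i : Fin (m + n)) : facK p i = facDiag p (kWeight i) :=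
  factor_hom_ext fun a ha => by
    rw [facDiag_dpow, facK, linearCombination_dpow ha]
    congr 1
    rw [Finset.prod_eq_single i (fun j _ h => by simp [kWeight, h]) (by simp)]
    simp [kWeight]

theorem facKinv_eq (i : Fin (m + n)) : facKinv p i = facDiag p (kWeight i)⁻¹ :=
  factor_hom_ext fun a ha => by
    rw [facDiag_dpow, facKinv, linearCombination_dpow ha]
    congr 1
    rw [Finset.prod_eq_single i (fun j _ h => by simp [kWeight, h]) (by simp)]
    simp [kWeight]

theorem facKt_eq (h : Fin (m + n - 1)) : facKt p h = facDiag p (ktWeight h) := by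
  rw [facKt, facK_eq, facKinv_eq, ktWeight_eq, ← facDiag_mul]; rfl

theorem facKtinv_eq (h : Fin (m + n - 1)) : facKtinv p h = facDiag p (ktWeight h)⁻¹ := by
  rw [facKtinv, facK_eq, facKinv_eq, ktWeight_eq, mul_inv, inv_inv, ← facDiag_mul]; rfl

theorem facSign_eq (q : ℕ) : facSign (m := m) (n := n) p q = facDiag p (signWeight p q) :=
  factor_hom_ext fun a ha => by
    rw [facDiag_dpow, facSign, linearCombination_dpow ha]
    congr 1
    simp only [signWeight, ite_pow, one_pow]
    rw [← Finset.prod_filter, pow_mul, Finset.prod_pow_eq_pow_sum]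

theorem facE_facF_comm {a b : Fin (m + n - 1)} (hab : a ≠ b) :
    Commute (facE (m := m) (n := n) p a) (facF p b) := by
  have h1 : lo a ≠ lo b := fun h => hab (Fin.ext (by simpa [Fin.ext_iff] using h))
  have h2 : hi a ≠ hi b := fun h => hab (Fin.ext (by simpa [Fin.ext_iff] using h))
  rw [facE_eq, facF_eq]
  exact ((osR_osL_comm h1).mul_right (osR_comm _ _)).mul_left
    ((osL_comm _ _).mul_right (osR_osL_comm h2.symm).symm)

theorem prod_ktWeight_pow (h : Fin (m + n - 1)) (a : Fin (m + n) → ℕ) :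
    ∏ i, ktWeight h i ^ a i = υi (lo h) ^ a (lo h) / υi (hi h) ^ a (hi h) := by
  have := lo_ne_hi h
  simp only [ktWeight_eq, Pi.mul_apply, Pi.inv_apply, mul_pow, Finset.prod_mul_distrib]
  rw [Finset.prod_eq_single (lo h) (fun j _ h => by simp [kWeight, h]) (by simp),
    Finset.prod_eq_single (hi h) (fun j _ h => by simp [kWeight, h]) (by simp)]
  simp [kWeight, div_eq_mul_inv]

/-- The commutator relation of `E_h` and `F_h` on one monomial: for `h ≠ m` it is
`[s][t + 1] - [s + 1][t] = [s - t]`, and for `h = m` one of `s`, `t` is at most `1`. -/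
theorem lrEigen_relation (hp : p < 2) (h : Fin (m + n - 1)) {s t : ℕ}
    (hs : par (lo h) ≠ p → s ≤ 1) (ht : par (hi h) ≠ p → t ≤ 1) :
    qint s * lrEigen p (hi h) t - (-1) ^ (isOdd h * isOdd h) * (lrEigen p (lo h) s * qint t)
      = (υi (lo h) ^ s / υi (hi h) ^ t - (υi (lo h) ^ s / υi (hi h) ^ t)⁻¹)
        / (υi (lo h) - (υi (lo h))⁻¹) := by
  by_cases ho : h.val + 1 = m
  · have e1 : par (lo h) = 0 := par_of_lt (by simp; omega)
    have e2 : par (hi h) = 1 := par_of_le (by simp; omega)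
    have : υi (lo h) ^ s / υi (hi h) ^ t = υi (lo h) ^ ((s : ℤ) + t) := by
      rw [υi_hi_of_eq ho, inv_pow, div_inv_eq_mul, zpow_add₀ (υi_ne_zero _)]; simp
    rw [this, ← qint_eq, isOdd_of_eq ho]
    obtain rfl | rfl : p = 0 ∨ p = 1 := by omega
    · have : t = 0 ∨ t = 1 := by have := ht (by omega); omega
      rcases this with rfl | rfl <;> simp [lrEigen, e1, e2]
    · have : s = 0 ∨ s = 1 := by have := hs (by omega); omega
      rcases this with rfl | rfl <;> simp [lrEigen, e1, e2, add_comm]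
  · have e := par_hi_of_ne ho
    have : υi (lo h) ^ s / υi (hi h) ^ t = υi (lo h) ^ ((s : ℤ) - t) := by
      rw [υi_hi_of_ne ho, zpow_sub₀ (υi_ne_zero _)]; simp
    rw [this, ← qint_eq, isOdd_of_ne ho]
    by_cases hpe : par (lo h) = p
    · have := qint_mul_sub s t
      simp only [lrEigen, e, hpe, if_true]
      linear_combination this
    · have h1 : s = 0 ∨ s = 1 := by have := hs hpe; omega
      have h2 : t = 0 ∨ t = 1 := by have := ht (by rwa [e]); omega
      have h3 : qint (-1) = -1 := by
        have := qint_mul_sub 0 1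
        simpa using this.symm
      rcases h1 with rfl | rfl <;> rcases h2 with rfl | rfl <;> simp [lrEigen, e, hpe, h3]

theorem facE_facF_self (hp : p < 2) (h : Fin (m + n - 1)) :
    facE p h * facF p h - (-1 : Qv) ^ (isOdd h * isOdd h) • (facF p h * facE p h)
      = (υi (lo h) - (υi (lo h))⁻¹)⁻¹ • (facDiag p (ktWeight h) - facDiag p (ktWeight h)⁻¹) := by
  have e1 : facE p h * facF p h
      = (osR p (lo h) * osL p (lo h)) * (osL p (hi h) * osR p (hi h)) := by
    rw [facE_eq, facF_eq, mul_assoc, ← mul_assoc (osL p (hi h)), (osL_comm (hi h) (lo h)).eq]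
    simp only [mul_assoc]
  have e2 : facF p h * facE p h
      = (osL p (lo h) * osR p (lo h)) * (osR p (hi h) * osL p (hi h)) := by
    rw [facE_eq, facF_eq, mul_assoc, ← mul_assoc (osR p (hi h)), (osR_comm (hi h) (lo h)).eq]
    simp only [mul_assoc]
  rw [e1, e2]
  refine factor_hom_ext fun a ha => ?_
  simp only [LinearMap.sub_apply, LinearMap.smul_apply, Module.End.mul_apply, facDiag_dpow]
  rw [osL_osR_dpow, osR_osL_dpow _ (ha _)]
  simp only [map_smul]
  rw [osL_osR_dpow, osR_osL_dpow _ (ha _)]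
  simp only [smul_smul, ← sub_smul, Pi.inv_apply, inv_pow, Finset.prod_inv_distrib]
  congr 1
  have := lrEigen_relation hp h (ha (lo h)) (ha (hi h))
  rw [prod_ktWeight_pow, mul_comm _ (_ - _), ← div_eq_mul_inv, ← this]
  ring

end Factor

/-! ### Operators on the tensor product -/

section PiTensor

variable {k ι : Type*} [Field k] {s : ι → Type*}
  [∀ i, AddCommMonoid (s i)] [∀ i, Module k (s i)]

theorem map_mul_map_of_smul [Fintype ι] {f g : ∀ i, Module.End k (s i)} {c : ι → k}
    (h : ∀ i, f i * g i = c i • (g i * f i)) :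
    (PiTensorProduct.map f * PiTensorProduct.map g : Module.End k (⨂[k] i, s i))
      = (∏ i, c i) • (PiTensorProduct.map g * PiTensorProduct.map f) := by
  rw [← PiTensorProduct.map_mul, ← PiTensorProduct.map_mul]
  simp only [h]
  exact (PiTensorProduct.mapMultilinear k s s).map_smul_univ c fun i => g i * f i

/-- The embedding of the endomorphisms of one tensor factor. -/
def singleHom [DecidableEq ι] (i : ι) : Module.End k (s i) →ₐ[k] Module.End k (⨂[k] i, s i) :=
  AlgHom.ofLinearMap ((PiTensorProduct.mapMultilinear k s s).toLinearMap (fun _ => 1) i)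
    (by
      simp only [MultilinearMap.toLinearMap_apply, PiTensorProduct.mapMultilinear_apply]
      rw [Function.update_eq_self_iff.2 rfl]
      exact PiTensorProduct.map_one)
    (fun f g => by
      simp only [MultilinearMap.toLinearMap_apply, PiTensorProduct.mapMultilinear_apply,
        ← PiTensorProduct.map_mul]
      congr 1
      funext j
      by_cases h : j = i
      · subst h; simp
      · simp [h])

theorem prod_ite_ite [Fintype ι] [DecidableEq ι] {i j : ι} (h : i ≠ j) (u v : k) :
    ∏ x, (if x = i then u else if x = j then v else 1) = u * v := by
  have : ∀ x, (if x = i then u else if x = j then v else 1)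
      = (if x = i then u else 1) * (if x = j then v else 1) := fun x => by
    by_cases h1 : x = i
    · subst h1; simp [h]
    · simp [h1]
  simp only [this, Finset.prod_mul_distrib]
  simp

end PiTensor

/-- Negation on `S^{m|n}` is multiplication by `-1`; the underlying additive monoid is
definitionally that of the tensor product. -/
instance : AddCommGroup (Smn m n) := Module.addCommMonoidToAddCommGroup Qv

/-- The embedding of the endomorphisms of the `k`-th tensor factor of `S^{m|n}`. -/
def factorHom (k : Fin (m + n)) :
    Module.End Qv (SFactor m n (par k)) →ₐ[Qv] Module.End Qv (Smn m n) :=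
  singleHom (s := fun j => SFactor m n (par j)) k

theorem factorHom_apply (k : Fin (m + n)) (f : Module.End Qv (SFactor m n (par k))) :
    factorHom k f = PiTensorProduct.map (Function.update (fun _ => 1) k f) := rfl

theorem par_lt_two (i : Fin (m + n)) : par i < 2 := by
  unfold par; split_ifs <;> omega

theorem signWeight_ratio {p : ℕ} (hp : p < 2) (q : ℕ) (h : Fin (m + n - 1)) :
    signWeight p q (lo h) / signWeight p q (hi h) = (-1) ^ (isOdd h * q) := by
  have hs : ∀ q : ℕ, ((-1 : Qv) ^ q)⁻¹ = (-1) ^ q := fun q => by rw [← inv_pow, inv_neg, inv_one]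
  by_cases ho : h.val + 1 = m
  · have e1 : par (lo h) = 0 := par_of_lt (by simp; omega)
    have e2 : par (hi h) = 1 := par_of_le (by simp; omega)
    obtain rfl | rfl : p = 0 ∨ p = 1 := by omega
    · simp [signWeight, e1, e2, isOdd_of_eq ho, hs]
    · simp [signWeight, e1, e2, isOdd_of_eq ho]
  · have e := par_hi_of_ne ho
    rw [isOdd_of_ne ho, zero_mul, pow_zero, signWeight, signWeight, e]
    exact div_self (by split_ifs <;> simp)

theorem signWeight_ratio' {p : ℕ} (hp : p < 2) (q : ℕ) (h : Fin (m + n - 1)) :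
    signWeight p q (hi h) / signWeight p q (lo h) = (-1) ^ (isOdd h * q) := by
  rw [← inv_div, signWeight_ratio hp, ← inv_pow, inv_neg, inv_one]

theorem signWeight_mul_self (p q : ℕ) :
    (signWeight p q * signWeight p q : Fin (m + n) → Qv) = 1 := by
  funext i
  simp only [signWeight, Pi.mul_apply, Pi.one_apply]
  split_ifs
  · rw [← mul_pow]; simp
  · simp

theorem facE_mul_facDiag {p : ℕ} {w : Fin (m + n) → Qv} (h : Fin (m + n - 1)) (hw : ∀ i, w i ≠ 0) :
    facE p h * facDiag p w = (w (hi h) / w (lo h)) • (facDiag p w * facE p h) := by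
  have h1 := hw (lo h)
  have h2 := hw (hi h)
  rw [facDiag_mul_facE h h2, smul_smul, div_mul_div_cancel₀ h1, div_self h2, one_smul]

theorem braid_symm (i j : Fin (m + n - 1)) : braid i j = braid j i := by
  rcases lt_trichotomy i.val j.val with h | h | h
  · by_cases h' : i.val + 1 = j.val
    · rw [braid_succ h', braid_pred h']
      congr 2
      simp [Fin.ext_iff, h']
    · rw [braid_of_far (by omega), braid_of_far (by omega)]
  · rw [Fin.ext h]
  · by_cases h' : j.val + 1 = i.val
    · rw [braid_succ h', braid_pred h']
      congr 2
      simp [Fin.ext_iff, h']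
    · rw [braid_of_far (by omega), braid_of_far (by omega)]

/-- The tensor factors of the `k`-th summand of the iterated coproduct of `E_h`. -/
def termE (h : Fin (m + n - 1)) (k j : Fin (m + n)) : Module.End Qv (SFactor m n (par j)) :=
  if j < k then facDiag (par j) (signWeight (par j) (isOdd h))
  else if j = k then facE (par j) h else facDiag (par j) (ktWeight h)

/-- The tensor factors of the `k`-th summand of the iterated coproduct of `F_h`. -/
def termF (h : Fin (m + n - 1)) (k j : Fin (m + n)) : Module.End Qv (SFactor m n (par j)) :=
  if j < k then facDiag (par j) ((ktWeight h)⁻¹ * signWeight (par j) (isOdd h))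
  else if j = k then facF (par j) h else 1

theorem opE_eq (h : Fin (m + n - 1)) : opE h = ∑ k, PiTensorProduct.map (termE h k) := by
  simp only [opE, facSign_eq, facKt_eq]
  rfl

theorem opF_eq (h : Fin (m + n - 1)) : opF h = ∑ k, PiTensorProduct.map (termF h k) := by
  simp only [opF, facSign_eq, facKtinv_eq]
  refine Finset.sum_congr rfl fun k _ => ?_
  congr 1
  funext j
  simp only [termF, ← facDiag_mul]
  rfl

/-- The operator on `S^{m|n}` acting diagonally on each tensor factor. -/
def opDiag (w : Fin (m + n) → Qv) : Module.End Qv (Smn m n) :=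
  PiTensorProduct.map fun j => facDiag (par j) w

theorem opDiag_mul (w w' : Fin (m + n) → Qv) : opDiag w * opDiag w' = opDiag (w * w') := by
  rw [opDiag, opDiag, ← PiTensorProduct.map_mul]
  simp only [facDiag_mul]; rfl

theorem opDiag_one : opDiag (1 : Fin (m + n) → Qv) = 1 := by
  simp only [opDiag, facDiag_one]
  exact PiTensorProduct.map_one

theorem opK_eq (i : Fin (m + n)) : opK i = opDiag (kWeight i) := by
  simp only [opK, opDiag, facK_eq]

/-- Terms of `E_i` and `E_j` acting on different tensor factors `k < l`: in the factor `k` the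
operator `E_i` meets the sign belonging to `E_j`, and in the factor `l` the operator `K̃_i` meets
`E_j`. -/
theorem termE_braid {k l : Fin (m + n)} (hkl : k < l) (i j : Fin (m + n - 1)) :
    PiTensorProduct.map (termE i k) * PiTensorProduct.map (termE j l)
      = braid i j • (PiTensorProduct.map (termE j l) * PiTensorProduct.map (termE i k)) := by
  rw [map_mul_map_of_smul (c := fun x => if x = k then (-1) ^ (isOdd i * isOdd j) else
    if x = l then ktWeight i (lo j) / ktWeight i (hi j) else 1), prod_ite_ite hkl.ne, braid]
  intro x
  rcases lt_trichotomy x k with h | h | h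
  · simp only [termE, h, h.ne, h.trans hkl, (h.trans hkl).ne, if_true, if_false, one_smul]
    exact facDiag_comm _ _
  · subst h
    simp only [termE, lt_irrefl, hkl, if_true, if_false]
    rw [facE_mul_facDiag _ (signWeight_ne_zero _ _), signWeight_ratio' (par_lt_two x)]
  · rcases lt_trichotomy x l with h' | h' | h'
    · simp only [termE, h.not_gt, h.ne', h', h'.ne, if_true, if_false, one_smul]
      exact facDiag_comm _ _
    · subst h'
      simp only [termE, lt_irrefl, h.not_gt, h.ne', if_true, if_false]
      exact facDiag_mul_facE _ (ktWeight_ne_zero _ _)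
    · simp only [termE, h.not_gt, h.ne', h'.not_gt, h'.ne', if_false, one_smul]
      exact facDiag_comm _ _

theorem termF_braid {k l : Fin (m + n)} (hlk : l < k) (i j : Fin (m + n - 1)) :
    PiTensorProduct.map (termF i k) * PiTensorProduct.map (termF j l)
      = braid i j • (PiTensorProduct.map (termF j l) * PiTensorProduct.map (termF i k)) := by
  rw [map_mul_map_of_smul (c := fun x => if x = l then braid i j else 1), Finset.prod_ite_eq' _ l,
    if_pos (Finset.mem_univ _)]
  intro x
  rcases lt_trichotomy x l with h | h | h
  · simp only [termF, h, h.ne, h.trans hlk, if_true, if_false, one_smul]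
    exact facDiag_comm _ _
  · subst h
    simp only [termF, lt_irrefl, hlk, if_true, if_false]
    rw [facDiag_mul_facF _
      (mul_ne_zero (inv_ne_zero (ktWeight_ne_zero _ _)) (signWeight_ne_zero _ _ _))]
    congr 1
    rw [braid, mul_comm (isOdd i), ← signWeight_ratio' (par_lt_two x)]
    simp only [Pi.mul_apply, Pi.inv_apply]
    have := ktWeight_ne_zero i (lo j)
    have := ktWeight_ne_zero i (hi j)
    field_simp
  · simp only [termF, h.not_gt, h.ne', if_false, one_smul, mul_one, one_mul]

/-- Terms of `E_i` and `F_j` super commute unless they act by `E_i` and `F_i` on the same tensor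
factor. -/
theorem termE_termF {k l : Fin (m + n)} (i j : Fin (m + n - 1)) (hne : k ≠ l ∨ i ≠ j) :
    PiTensorProduct.map (termE i k) * PiTensorProduct.map (termF j l)
      = (-1 : Qv) ^ (isOdd i * isOdd j) •
        (PiTensorProduct.map (termF j l) * PiTensorProduct.map (termE i k)) := by
  have hw : ∀ (p : ℕ) y, ((ktWeight j)⁻¹ * signWeight p (isOdd j) : Fin (m + n) → Qv) y ≠ 0 :=
    fun p y => mul_ne_zero (inv_ne_zero (ktWeight_ne_zero _ _)) (signWeight_ne_zero _ _ _)
  rcases lt_trichotomy k l with hkl | hkl | hkl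
  · rw [map_mul_map_of_smul (c := fun x => if x = k then braid j i else
      if x = l then ktWeight i (hi j) / ktWeight i (lo j) else 1), prod_ite_ite hkl.ne]
    · congr 1
      rw [braid_symm, braid, mul_assoc, div_mul_div_cancel₀ (ktWeight_ne_zero _ _),
        div_self (ktWeight_ne_zero _ _), mul_one]
    intro x
    rcases lt_trichotomy x k with h | h | h
    · simp only [termE, termF, h, h.ne, h.trans hkl, (h.trans hkl).ne, if_true, if_false, one_smul]
      exact facDiag_comm _ _
    · subst h
      simp only [termE, termF, lt_irrefl, hkl, if_true, if_false]
      rw [facE_mul_facDiag _ (hw _)]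
      congr 1
      rw [braid, mul_comm (isOdd j), ← signWeight_ratio' (par_lt_two x)]
      simp only [Pi.mul_apply, Pi.inv_apply]
      have := ktWeight_ne_zero j (lo i)
      have := ktWeight_ne_zero j (hi i)
      field_simp
    · rcases lt_trichotomy x l with h' | h' | h'
      · simp only [termE, termF, h.not_gt, h.ne', h', h'.ne, if_true, if_false, one_smul]
        exact facDiag_comm _ _
      · subst h'
        simp only [termE, termF, lt_irrefl, h.not_gt, h.ne', if_true, if_false]
        exact facDiag_mul_facF _ (ktWeight_ne_zero _ _)
      · simp only [termE, termF, h.not_gt, h.ne', h'.not_gt, h'.ne', if_false, one_smul, mul_one,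
          one_mul]
  · subst hkl
    have hij : i ≠ j := by simpa using hne
    rw [map_mul_map_of_smul (c := fun _ => 1), isOdd_mul_isOdd hij]
    · simp
    intro x
    rw [one_smul]
    rcases lt_trichotomy x k with h | h | h
    · simp only [termE, termF, h, if_true]
      exact facDiag_comm _ _
    · simp only [termE, termF, h, lt_irrefl, if_true, if_false]
      subst h
      exact facE_facF_comm hij
    · simp only [termE, termF, h.not_gt, h.ne', if_false, mul_one, one_mul]
  · rw [map_mul_map_of_smul (c := fun x => if x = l then (-1) ^ (isOdd i * isOdd j) else 1),
      Finset.prod_ite_eq' _ l, if_pos (Finset.mem_univ _)]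
    intro x
    rcases lt_trichotomy x l with h | h | h
    · simp only [termE, termF, h, h.ne, h.trans hkl, if_true, if_false, one_smul]
      exact facDiag_comm _ _
    · subst h
      simp only [termE, termF, lt_irrefl, hkl, if_true, if_false]
      rw [facDiag_mul_facF _ (signWeight_ne_zero _ _ _), signWeight_ratio' (par_lt_two x),
        mul_comm (isOdd j)]
    · simp only [termF, h.not_gt, h.ne', if_false, one_smul, mul_one, one_mul]

/-- The interpolation between `K̃_h` (at `t = 0`) and `K̃_h⁻¹` (at `t = m + n`), which acts by
`K̃_h⁻¹` on the first `t` tensor factors and by `K̃_h` on the others. -/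
def ktStep (h : Fin (m + n - 1)) (t : ℕ) : Module.End Qv (Smn m n) :=
  PiTensorProduct.map fun j =>
    if j.val < t then facDiag (par j) (ktWeight h)⁻¹ else facDiag (par j) (ktWeight h)

/-- The remaining super commutators are differences of consecutive interpolations `ktStep`. -/
theorem termE_termF_self (h : Fin (m + n - 1)) (k : Fin (m + n)) :
    PiTensorProduct.map (termE h k) * PiTensorProduct.map (termF h k)
      - (-1 : Qv) ^ (isOdd h * isOdd h) •
        (PiTensorProduct.map (termF h k) * PiTensorProduct.map (termE h k))
      = (υi (lo h) - (υi (lo h))⁻¹)⁻¹ • (ktStep h k.val - ktStep h (k.val + 1)) := by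
  -- In both products the factors other than the `k`-th are the components of `G`, since the
  -- signs cancel.
  set G : ∀ j : Fin (m + n), Module.End Qv (SFactor m n (par j)) := fun j =>
    if j < k then facDiag (par j) (ktWeight h)⁻¹ else facDiag (par j) (ktWeight h) with hG
  set L := (PiTensorProduct.mapMultilinear Qv (fun j : Fin (m + n) => SFactor m n (par j))
    (fun j => SFactor m n (par j))).toLinearMap G k with hL
  have hLa : ∀ f, L f = PiTensorProduct.map (Function.update G k f) := fun f => rfl
  have h1 : PiTensorProduct.map (termE h k) * PiTensorProduct.map (termF h k)
      = L (facE (par k) h * facF (par k) h) := by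
    rw [hLa, ← PiTensorProduct.map_mul]
    congr 1
    funext j
    rcases lt_trichotomy j k with hj | hj | hj
    · simp only [termE, termF, hj, if_true, ne_eq, hj.ne, not_false_eq_true,
        Function.update_of_ne, hG]
      rw [facDiag_mul, mul_left_comm, signWeight_mul_self, mul_one]
    · subst hj; simp [termE, termF]
    · simp [termE, termF, hG, hj.ne', hj.not_gt]
  have h2 : PiTensorProduct.map (termF h k) * PiTensorProduct.map (termE h k)
      = L (facF (par k) h * facE (par k) h) := by
    rw [hLa, ← PiTensorProduct.map_mul]
    congr 1
    funext j
    rcases lt_trichotomy j k with hj | hj | hj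
    · simp only [termE, termF, hj, if_true, ne_eq, hj.ne, not_false_eq_true,
        Function.update_of_ne, hG]
      rw [facDiag_mul, mul_assoc, signWeight_mul_self, mul_one]
    · subst hj; simp [termE, termF]
    · simp [termE, termF, hG, hj.ne', hj.not_gt]
  have h3 : ktStep h k.val = L (facDiag (par k) (ktWeight h)) := by
    rw [hLa, ktStep]
    congr 1
    funext j
    by_cases hj : j = k
    · subst hj; simp
    · simp [hG, hj]
  have h4 : ktStep h (k.val + 1) = L (facDiag (par k) (ktWeight h)⁻¹) := by
    rw [hLa, ktStep]
    congr 1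
    funext j
    by_cases hj : j = k
    · subst hj; simp
    · have : j.val < k.val + 1 ↔ j < k := by
        have : j.val ≠ k.val := fun e => hj (Fin.ext e)
        rw [Fin.lt_def]; omega
      simp [hG, hj, this]
  rw [h1, h2, h3, h4, ← map_smul, ← map_sub, ← map_sub, ← map_smul,
    facE_facF_self (par_lt_two k)]

theorem opE_opF (i j : Fin (m + n - 1)) (hij : i ≠ j) :
    opE i * opF j - (-1 : Qv) ^ (isOdd i * isOdd j) • (opF j * opE i) = 0 := by
  rw [opE_eq, opF_eq, sub_eq_zero, Finset.sum_mul_sum, Finset.sum_mul_sum, Finset.sum_comm,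
    Finset.smul_sum]
  refine Finset.sum_congr rfl fun l _ => ?_
  rw [Finset.smul_sum]
  exact Finset.sum_congr rfl fun k _ => termE_termF i j (Or.inr hij)

/-- The commutator of `E_h` and `F_h`: the terms in different tensor factors cancel, and the
diagonal ones telescope. -/
theorem opE_opF_self (h : Fin (m + n - 1)) :
    opE h * opF h - (-1 : Qv) ^ (isOdd h * isOdd h) • (opF h * opE h)
      = (υi (lo h) - (υi (lo h))⁻¹)⁻¹ • (opDiag (ktWeight h) - opDiag (ktWeight h)⁻¹) := by
  have hT : opDiag (ktWeight h) - opDiag (ktWeight h)⁻¹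
      = ∑ k : Fin (m + n), (ktStep h k.val - ktStep h (k.val + 1)) := by
    rw [Fin.sum_univ_eq_sum_range (fun k => ktStep h k - ktStep h (k + 1)) (m + n),
      Finset.sum_range_sub']
    simp [ktStep, opDiag]
  rw [hT, Finset.smul_sum, ← Finset.sum_congr rfl fun k _ => termE_termF_self h k,
    Finset.sum_sub_distrib, opE_eq, opF_eq, Finset.sum_mul_sum, Finset.sum_mul_sum,
    Finset.sum_comm (f := fun k l => PiTensorProduct.map (termF h k) * _), Finset.smul_sum,
    ← Finset.sum_sub_distrib, ← Finset.sum_sub_distrib]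
  refine Finset.sum_congr rfl fun k _ => ?_
  rw [Finset.smul_sum, ← Finset.sum_sub_distrib]
  refine Finset.sum_eq_single k (fun l _ hl => ?_) (by simp)
  rw [termE_termF h h (Or.inl hl.symm), sub_self]

theorem isSerre_opE : IsSerre (opE (m := m) (n := n)) := by
  have key : ∀ k : Fin (m + n), IsSerre fun h => PiTensorProduct.map (termE h k) := fun k => by
    -- The `k`-th term is `E_h` in the factor `k` times an operator commuting with everything.
    set C : Fin (m + n - 1) → Module.End Qv (Smn m n) := fun h =>
      PiTensorProduct.map fun j => if j = k then 1 else termE h k j with hC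
    have h1 : (fun h => PiTensorProduct.map (termE h k))
        = fun h => factorHom k (facE (par k) h) * C h := by
      funext h
      rw [factorHom_apply, hC, ← PiTensorProduct.map_mul]
      congr 1
      funext j
      by_cases hj : j = k
      · subst hj; simp [termE]
      · simp [hj]
    rw [h1]
    refine ((isSerre_facE (par_lt_two k)).map (factorHom k)).mul_of_commute (fun a b => ?_)
      fun a b => ?_
    · rw [Commute, SemiconjBy, hC, ← PiTensorProduct.map_mul, ← PiTensorProduct.map_mul]
      congr 1
      funext j
      by_cases hj : j = k
      · simp [hj]
      · simp only [hj, if_false, termE]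
        split_ifs <;> exact facDiag_comm _ _
    · rw [Commute, SemiconjBy, factorHom_apply, hC, ← PiTensorProduct.map_mul,
        ← PiTensorProduct.map_mul]
      congr 1
      funext j
      by_cases hj : j = k
      · subst hj; simp
      · simp [hj]
  have := IsSerre.sum Finset.univ key fun k l hkl i j => termE_braid hkl i j
  simpa only [← opE_eq] using this

theorem isSerre_opF : IsSerre (opF (m := m) (n := n)) := by
  have key : ∀ k : Fin (m + n), IsSerre fun h => PiTensorProduct.map (termF h k) := fun k => by
    -- The `k`-th term is `F_h` in the factor `k` times an operator commuting with everything.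
    set C : Fin (m + n - 1) → Module.End Qv (Smn m n) := fun h =>
      PiTensorProduct.map fun j => if j = k then 1 else termF h k j with hC
    have h1 : (fun h => PiTensorProduct.map (termF h k))
        = fun h => factorHom k (facF (par k) h) * C h := by
      funext h
      rw [factorHom_apply, hC, ← PiTensorProduct.map_mul]
      congr 1
      funext j
      by_cases hj : j = k
      · subst hj; simp [termF]
      · simp [hj]
    rw [h1]
    refine ((isSerre_facF (par_lt_two k)).map (factorHom k)).mul_of_commute (fun a b => ?_)
      fun a b => ?_
    · rw [Commute, SemiconjBy, hC, ← PiTensorProduct.map_mul, ← PiTensorProduct.map_mul]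
      congr 1
      funext j
      by_cases hj : j = k
      · simp [hj]
      · simp only [hj, if_false, termF]
        split_ifs
        · exact facDiag_comm _ _
        · rfl
    · rw [Commute, SemiconjBy, factorHom_apply, hC, ← PiTensorProduct.map_mul,
        ← PiTensorProduct.map_mul]
      congr 1
      funext j
      by_cases hj : j = k
      · subst hj; simp
      · simp [hj]
  -- The `K̃⁻¹` of `F_h` stand to the left of `F_h`, so that the order of the factors is reversed.
  have := IsSerre.sum (ι := (Fin (m + n))ᵒᵈ) (Finset.univ.map OrderDual.toDual.toEmbedding)
    (X := fun k h => PiTensorProduct.map (termF h (OrderDual.ofDual k))) (fun k => key _)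
    fun k l hkl i j => termF_braid (OrderDual.toDual_lt_toDual.1 hkl) i j
  simpa only [Finset.sum_map, Equiv.coe_toEmbedding, OrderDual.ofDual_toDual, ← opF_eq] using this

/-! ### The representation on the tensor product -/

/-- The operator of `K_i⁻¹` on `S^{m|n}`. -/
def opKinv (i : Fin (m + n)) : Module.End Qv (Smn m n) := opDiag (kWeight i)⁻¹

theorem opDiag_mul_opE {w : Fin (m + n) → Qv} (hw : ∀ i, w i ≠ 0) (h : Fin (m + n - 1)) :
    opDiag w * opE h = (w (lo h) / w (hi h)) • (opE h * opDiag w) := by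
  rw [opE_eq, Finset.mul_sum, Finset.sum_mul, Finset.smul_sum]
  refine Finset.sum_congr rfl fun k _ => ?_
  rw [opDiag, map_mul_map_of_smul (c := fun x => if x = k then w (lo h) / w (hi h) else 1),
    Finset.prod_ite_eq' _ k, if_pos (Finset.mem_univ _)]
  intro x
  rcases lt_trichotomy x k with hx | hx | hx
  · simp only [termE, hx, hx.ne, if_true, if_false, one_smul]
    exact facDiag_comm _ _
  · subst hx
    simp only [termE, lt_irrefl, if_true, if_false]
    exact facDiag_mul_facE _ (hw _)
  · simp only [termE, hx.not_gt, hx.ne', if_false, one_smul]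
    exact facDiag_comm _ _

theorem opDiag_mul_opF {w : Fin (m + n) → Qv} (hw : ∀ i, w i ≠ 0) (h : Fin (m + n - 1)) :
    opDiag w * opF h = (w (hi h) / w (lo h)) • (opF h * opDiag w) := by
  rw [opF_eq, Finset.mul_sum, Finset.sum_mul, Finset.smul_sum]
  refine Finset.sum_congr rfl fun k _ => ?_
  rw [opDiag, map_mul_map_of_smul (c := fun x => if x = k then w (hi h) / w (lo h) else 1),
    Finset.prod_ite_eq' _ k, if_pos (Finset.mem_univ _)]
  intro x
  rcases lt_trichotomy x k with hx | hx | hx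
  · simp only [termF, hx, hx.ne, if_true, if_false, one_smul]
    exact facDiag_comm _ _
  · subst hx
    simp only [termF, lt_irrefl, if_true, if_false]
    exact facDiag_mul_facF _ (hw _)
  · simp only [termF, hx.not_gt, hx.ne', if_false, one_smul, one_mul, mul_one]

theorem sdot_comm (x y : Fin (m + n) → ℤ) : sdot x y = sdot y x :=
  Finset.sum_congr rfl fun i _ => by ring

theorem sdot_e (x : Fin (m + n) → ℤ) (i : Fin (m + n)) : sdot x (e i) = (-1) ^ par i * x i := by
  rw [sdot, Finset.sum_eq_single i (fun j _ h => by simp [e, h]) (by simp)]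
  simp [e]

theorem sdot_add (x y z : Fin (m + n) → ℤ) : sdot x (y + z) = sdot x y + sdot x z := by
  simp only [sdot, Pi.add_apply, mul_add, Finset.sum_add_distrib]

theorem sdot_neg (x y : Fin (m + n) → ℤ) : sdot x (-y) = -sdot x y := by
  simp only [sdot, Pi.neg_apply, mul_neg, Finset.sum_neg_distrib]

theorem sdot_sub (x y z : Fin (m + n) → ℤ) : sdot x (y - z) = sdot x y - sdot x z := by
  rw [sub_eq_add_neg, sdot_add, sdot_neg, sub_eq_add_neg]

theorem υ_zpow_sdot_e (x : Fin (m + n) → ℤ) (i : Fin (m + n)) :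
    υ ^ sdot x (e i) = υi i ^ x i := by
  rw [sdot_e, υi, ← zpow_mul]

theorem kWeight_div (a : Fin (m + n)) (b : Fin (m + n - 1)) :
    kWeight a (lo b) / kWeight a (hi b) = υ ^ sdot (e a) (α b) := by
  rw [α, sdot_sub, zpow_sub₀ υ_ne_zero, υ_zpow_sdot_e, υ_zpow_sdot_e]
  have key : ∀ c, υi c ^ (e a : Fin (m + n) → ℤ) c = kWeight a c := fun c => by
    by_cases h : c = a
    · subst h; simp [e, kWeight]
    · simp [e, kWeight, h]
  rw [key, key]

/-- The operators of the generators on `S^{m|n}`. -/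
def genOp : Gen m n → Module.End Qv (Smn m n)
  | .E h => opE h
  | .F h => opF h
  | .K i => opK i
  | .Kinv i => opKinv i

theorem genOp_rel ⦃x y : Free m n⦄ (h : Rel x y) :
    FreeAlgebra.lift Qv genOp x = FreeAlgebra.lift Qv genOp y := by
  have hE : ∀ h, FreeAlgebra.lift Qv genOp (xE h : Free m n) = opE h := fun h =>
    FreeAlgebra.lift_ι_apply _ _
  have hF : ∀ h, FreeAlgebra.lift Qv genOp (xF h : Free m n) = opF h := fun h =>
    FreeAlgebra.lift_ι_apply _ _
  have hK : ∀ h, FreeAlgebra.lift Qv genOp (xK h : Free m n) = opDiag (kWeight h) := fun h =>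
    (FreeAlgebra.lift_ι_apply _ _).trans (opK_eq h)
  have hKi : ∀ h, FreeAlgebra.lift Qv genOp (xKi h : Free m n) = opDiag (kWeight h)⁻¹ := fun h =>
    FreeAlgebra.lift_ι_apply _ _
  have hw : ∀ i : Fin (m + n), kWeight i * (kWeight i)⁻¹ = 1 := fun i => by
    funext j; exact mul_inv_cancel₀ (kWeight_ne_zero i j)
  cases h with
  | KK a b => simp only [map_mul, hK, opDiag_mul, mul_comm]
  | KKinv a => simp only [map_mul, map_one, hK, hKi, opDiag_mul, hw, opDiag_one]
  | KinvK a =>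
    simp only [map_mul, map_one, hK, hKi, opDiag_mul, mul_comm _ (kWeight a), hw, opDiag_one]
  | KE a b =>
    simp only [map_mul, map_smul, hK, hE]
    rw [opDiag_mul_opE (kWeight_ne_zero a), kWeight_div]
  | KF a b =>
    simp only [map_mul, map_smul, hK, hF]
    rw [opDiag_mul_opF (kWeight_ne_zero a), sdot_neg, zpow_neg, ← kWeight_div, inv_div]
  | EF a =>
    simp only [scomm, map_sub, map_mul, map_smul, hE, hF, hK, hKi, opDiag_mul]
    rw [opE_opF_self, ktWeight_eq, mul_inv, inv_inv]
  | EF_ne a b hab =>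
    simp only [scomm, map_sub, map_mul, map_smul, hE, hF, map_zero]
    exact opE_opF a b hab
  | EE a b hab => simpa only [map_mul, hE] using isSerre_opE.comm a b hab
  | FF a b hab => simpa only [map_mul, hF] using isSerre_opF.comm a b hab
  | serreE a b ha hab =>
    simpa only [map_add, map_sub, map_mul, map_smul, map_pow, map_zero, hE] using
      isSerre_opE.serre a b ha hab
  | serreF a b ha hab =>
    simpa only [map_add, map_sub, map_mul, map_smul, map_pow, map_zero, hF] using
      isSerre_opF.serre a b ha hab
  | oddE b hb => simpa only [map_pow, map_zero, hE] using isSerre_opE.odd b hb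
  | oddF b hb => simpa only [map_pow, map_zero, hF] using isSerre_opF.odd b hb
  | higherE a b c hb ha hc =>
    simp only [scomm, map_add, map_sub, map_mul, map_smul, map_zero, hE, mul_one, pow_one, neg_smul,
      one_smul, sub_neg_eq_add]
    exact isSerre_opE.higher a b c hb ha hc
  | higherF a b c hb ha hc =>
    simp only [scomm, map_add, map_sub, map_mul, map_smul, map_zero, hF, mul_one, pow_one, neg_smul,
      one_smul, sub_neg_eq_add]
    have := isSerre_opF.higher a b c hb ha hc
    -- In the relation for the `F_h` the roles of `m - 1` and `m + 1` are interchanged.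
    convert this using 3 <;> abel

/-- The action of `U_υ(gl_{m|n})` on `S^{m|n}`. -/
def rep : Uq m n →ₐ[Qv] Module.End Qv (Smn m n) :=
  RingQuot.liftAlgHom Qv ⟨FreeAlgebra.lift Qv genOp, genOp_rel⟩

theorem rep_gen (g : Gen m n) : rep (gen g) = genOp g := by
  rw [rep, gen, RingQuot.liftAlgHom_mkAlgHom_apply, FreeAlgebra.lift_ι_apply]

theorem subalgebra_eq_top {S : Subalgebra Qv (Uq m n)} (h : ∀ g, gen g ∈ S) (u : Uq m n) :
    u ∈ S := by
  obtain ⟨x, rfl⟩ := RingQuot.mkAlgHom_surjective Qv Rel u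
  induction x using FreeAlgebra.induction with
  | grade0 r => rw [AlgHom.commutes]; exact S.algebraMap_mem r
  | grade1 g => exact h g
  | mul a b ha hb => rw [map_mul]; exact S.mul_mem ha hb
  | add a b ha hb => rw [map_add]; exact S.add_mem ha hb

/-! ### The monomial basis and the extension to power series -/

/-- A matrix is the family of its columns. -/
def columnsEquiv : (∀ j : Fin (m + n), Expo m n (par j)) ≃ Mmn m n where
  toFun c := ⟨fun i j => (c j).1 i, fun i j h => (c j).2 i h⟩
  invFun A j := ⟨fun i => A.1 i j, fun i h => A.2 i j h⟩
  left_inv _ := rfl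
  right_inv _ := rfl

/-- The basis of `S^{m|n}` formed by the monomials `X^{[A]}`. -/
def monBasis : Module.Basis (Mmn m n) Qv (Smn m n) :=
  (_root_.Basis.piTensorProduct fun j : Fin (m + n) =>
    (Finsupp.basisSingleOne : Module.Basis (Expo m n (par j)) Qv (SFactor m n (par j)))).reindex
    columnsEquiv

theorem monBasis_apply (A : Mmn m n) : monBasis A = mon A := by
  rw [monBasis, Module.Basis.reindex_apply, _root_.Basis.piTensorProduct_apply, mon]
  congr 1
  funext j
  rw [dpow_of_valid fun i h => A.2 i j h, Finsupp.coe_basisSingleOne]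
  rfl

theorem coeff_tprod (B : Mmn m n) (v : ∀ j, SFactor m n (par j)) :
    coeff B (PiTensorProduct.tprod Qv v) = ∏ j, v j (columnsEquiv.symm B j) := by
  rw [coeff, PiTensorProduct.lift.tprod]
  rfl

/-- The pure tensor `X^{(c_1)} ⊗ ⋯ ⊗ X^{(c_{m+n})}` of an arbitrary `ℕ`-matrix, which is `0` unless
the matrix lies in `M(m|n)`. -/
def monN (A : NMat m n) : Smn m n := PiTensorProduct.tprod Qv fun j => dpow (par j) fun i => A i j

theorem coeff_monN (B : Mmn m n) (A : NMat m n) : coeff B (monN A) = smon A B := by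
  rw [monN, coeff_tprod, smon]
  split_ifs with h
  · subst h
    refine Finset.prod_eq_one fun j _ => ?_
    rw [dpow_of_valid fun i h => B.2 i j h]
    exact Finsupp.single_eq_same
  · obtain ⟨j, hj⟩ : ∃ j, (fun i => B.1 i j) ≠ fun i => A i j := by
      by_contra! h'
      exact h (by ext i j; exact congrFun (h' j) i)
    refine Finset.prod_eq_zero (Finset.mem_univ j) ?_
    by_cases hv : ∀ i, par i ≠ par j → A i j ≤ 1
    · rw [dpow_of_valid hv]
      exact Finsupp.single_eq_of_ne fun e => hj (congrArg Subtype.val e)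
    · rw [dpow, dif_neg hv]; rfl

theorem coeff_mon (B A : Mmn m n) : coeff B (mon A) = if A = B then 1 else 0 := by
  have := coeff_monN B A.1
  rw [smon] at this
  refine Eq.trans this ?_
  simp only [Subtype.ext_iff, eq_comm]

/-- Matrix multiplication: the coefficients of `T v` in terms of those of `v`. -/
theorem coeff_apply_eq_sum {T : Module.End Qv (Smn m n)} {B : Mmn m n} {s : Finset (Mmn m n)}
    (hs : ∀ C, coeff B (T (mon C)) ≠ 0 → C ∈ s) (v : Smn m n) :
    coeff B (T v) = ∑ C ∈ s, coeff C v * coeff B (T (mon C)) := by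
  have : coeff B ∘ₗ T = ∑ C ∈ s, coeff B (T (mon C)) • coeff C := by
    refine monBasis.ext fun A => ?_
    simp only [monBasis_apply, LinearMap.comp_apply, LinearMap.sum_apply, LinearMap.smul_apply,
      coeff_mon, smul_eq_mul, mul_ite, mul_one, mul_zero, Finset.sum_ite_eq]
    split_ifs with h
    · rfl
    · by_contra h'
      exact h (hs A h')
  have := LinearMap.congr_fun this v
  simp only [LinearMap.comp_apply, LinearMap.sum_apply, LinearMap.smul_apply, smul_eq_mul] at this
  rw [this]
  exact Finset.sum_congr rfl fun _ _ => mul_comm _ _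

/-- The endomorphisms of `S^{m|n}` for which each monomial occurs in the images of only finitely
many monomials. -/
def rowFinite : Subalgebra Qv (Module.End Qv (Smn m n)) where
  carrier := {T | ∀ B : Mmn m n, {A : Mmn m n | coeff B (T (mon A)) ≠ 0}.Finite}
  mul_mem' := by
    intro T S hT hS B
    refine ((hT B).biUnion fun C _ => hS C).subset fun A hA => ?_
    by_contra hA'
    simp only [Set.mem_iUnion, Set.mem_ofPred_eq, not_exists] at hA'
    refine hA ?_
    rw [Module.End.mul_apply,
      coeff_apply_eq_sum (s := (hT B).toFinset) fun C hC => (hT B).mem_toFinset.2 hC]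
    refine Finset.sum_eq_zero fun C hC => ?_
    rw [not_not.1 (hA' C ((hT B).mem_toFinset.1 hC)), zero_mul]
  add_mem' := by
    intro T S hT hS B
    refine ((hT B).union (hS B)).subset fun A hA => ?_
    by_contra hA'
    simp only [Set.mem_union, Set.mem_ofPred_eq, not_or, not_not] at hA'
    exact hA (by rw [LinearMap.add_apply, map_add, hA'.1, hA'.2, add_zero])
  algebraMap_mem' := by
    intro r B
    refine (Set.finite_singleton B).subset fun A hA => ?_
    by_contra hA'
    refine hA ?_
    have hAB : A ≠ B := fun h => hA' (Set.mem_singleton_iff.2 h)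
    rw [Module.algebraMap_end_apply, map_smul, coeff_mon, if_neg hAB, smul_zero]

theorem finsum_eq_sum_of_coeff {T : Module.End Qv (Smn m n)} {B : Mmn m n} {s : Finset (Mmn m n)}
    (hs : ∀ C, coeff B (T (mon C)) ≠ 0 → C ∈ s) (f : SSeries m n) :
    ∑ᶠ A, f A * coeff B (T (mon A)) = ∑ A ∈ s, f A * coeff B (T (mon A)) :=
  finsum_eq_sum_of_support_subset _ fun A hA => hs A (right_ne_zero_of_mul hA)

/-- The natural extension of a row finite endomorphism to formal power series. -/
def extend : (rowFinite : Subalgebra Qv (Module.End Qv (Smn m n))) →ₐ[Qv]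
    Module.End Qv (SSeries m n) :=
  have hs : ∀ (T : (rowFinite : Subalgebra Qv (Module.End Qv (Smn m n)))) (B : Mmn m n) C,
      coeff B (T.1 (mon C)) ≠ 0 → C ∈ (T.2 B).toFinset := fun T B _ hC =>
    (T.2 B).mem_toFinset.2 hC
  AlgHom.ofLinearMap
    { toFun T :=
        { toFun f B := ∑ᶠ A, f A * coeff B (T.1 (mon A))
          map_add' f g := by
            funext B
            rw [Pi.add_apply, finsum_eq_sum_of_coeff (hs T B), finsum_eq_sum_of_coeff (hs T B),
              finsum_eq_sum_of_coeff (hs T B), ← Finset.sum_add_distrib]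
            exact Finset.sum_congr rfl fun A _ => add_mul _ _ _
          map_smul' c f := by
            funext B
            rw [Pi.smul_apply, finsum_eq_sum_of_coeff (hs T B), finsum_eq_sum_of_coeff (hs T B),
              Finset.smul_sum]
            exact Finset.sum_congr rfl fun A _ => mul_assoc _ _ _ }
      map_add' T S := by
        refine LinearMap.ext fun f => funext fun B => ?_
        have h1 := finsum_eq_sum_of_coeff (T := T.1) (B := B)
          (fun C hC => Finset.mem_union_left (S.2 B).toFinset (hs T B C hC)) f
        have h2 := finsum_eq_sum_of_coeff (T := S.1) (B := B)
          (fun C hC => Finset.mem_union_right (T.2 B).toFinset (hs S B C hC)) f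
        have h3 := finsum_eq_sum_of_coeff (T := (T + S).1) (B := B)
          (s := (T.2 B).toFinset ∪ (S.2 B).toFinset) (fun C hC => by
            by_contra hC'
            rw [Finset.mem_union, not_or] at hC'
            refine hC ?_
            rw [Subalgebra.coe_add, LinearMap.add_apply, map_add,
              not_not.1 (mt (hs T B C) hC'.1), not_not.1 (mt (hs S B C) hC'.2), add_zero]) f
        simp only [LinearMap.coe_mk, AddHom.coe_mk, LinearMap.add_apply, Pi.add_apply]
        rw [h1, h2, h3, ← Finset.sum_add_distrib]
        refine Finset.sum_congr rfl fun A _ => ?_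
        rw [Subalgebra.coe_add, LinearMap.add_apply, map_add, mul_add]
      map_smul' c T := by
        refine LinearMap.ext fun f => funext fun B => ?_
        simp only [LinearMap.coe_mk, AddHom.coe_mk, LinearMap.smul_apply, Pi.smul_apply,
          RingHom.id_apply]
        rw [finsum_eq_sum_of_coeff (hs T B),
          finsum_eq_sum_of_coeff (T := (c • T).1) (B := B) (s := (T.2 B).toFinset)
            (fun C hC => hs T B C fun h => hC (by
              rw [Subalgebra.coe_smul, LinearMap.smul_apply, map_smul, h, smul_zero])),
          Finset.smul_sum]
        refine Finset.sum_congr rfl fun A _ => ?_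
        rw [Subalgebra.coe_smul, LinearMap.smul_apply, map_smul, smul_eq_mul, smul_eq_mul,
          mul_left_comm] }
    (by
      refine LinearMap.ext fun f => funext fun B => ?_
      simp only [LinearMap.coe_mk, AddHom.coe_mk, Subalgebra.coe_one, Module.End.one_apply,
        coeff_mon]
      rw [finsum_eq_single _ B (fun A hA => by rw [if_neg hA, mul_zero]), if_pos rfl, mul_one])
    (by
      intro T S
      refine LinearMap.ext fun f => funext fun B => ?_
      simp only [LinearMap.coe_mk, AddHom.coe_mk, Module.End.mul_apply]
      classical
      set s := (T.2 B).toFinset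
      set t := s.biUnion fun C => (S.2 C).toFinset
      have h1 : ∀ A, coeff B ((T * S).1 (mon A))
          = ∑ C ∈ s, coeff C (S.1 (mon A)) * coeff B (T.1 (mon C)) := fun A =>
        coeff_apply_eq_sum (hs T B) (S.1 (mon A))
      have h2 : ∀ C ∈ s, ∀ A, coeff C (S.1 (mon A)) ≠ 0 → A ∈ t := fun C hC A hA =>
        Finset.mem_biUnion.2 ⟨C, hC, hs S C A hA⟩
      rw [finsum_eq_sum_of_coeff (hs T B), finsum_eq_sum_of_coeff (T := (T * S).1) (s := t)
        fun A hA => by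
          by_contra hA'
          refine hA ?_
          rw [h1]
          refine Finset.sum_eq_zero fun C hC => ?_
          rw [not_not.1 (mt (h2 C hC A) hA'), zero_mul]]
      simp only [h1, Finset.mul_sum]
      rw [Finset.sum_comm]
      refine Finset.sum_congr rfl fun C hC => ?_
      rw [finsum_eq_sum_of_coeff (h2 C hC), Finset.sum_mul]
      exact Finset.sum_congr rfl fun A _ => (mul_assoc _ _ _).symm)

theorem isExtension_extend (T : (rowFinite : Subalgebra Qv (Module.End Qv (Smn m n)))) :
    IsExtension T.1 (extend T) := fun B => ⟨T.2 B, fun _ => rfl⟩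

/-! ### The action on monomials -/

theorem prod_ite_lt_eq {N : ℕ} {k : Fin N} (a b c : Fin N → Qv) :
    ∏ j, (if j < k then a j else if j = k then b j else c j)
      = (∏ j with j < k, a j) * b k * ∏ j with k < j, c j := by
  have h : ∀ j, (if j < k then a j else if j = k then b j else c j)
      = (if j < k then a j else 1) * (if j = k then b j else 1) * (if k < j then c j else 1) := by
    intro j
    rcases lt_trichotomy j k with h | h | h
    · simp [h, h.ne, h.not_gt]
    · simp [h]
    · simp [h, h.ne', h.not_gt]
  rw [Finset.prod_congr rfl fun j _ => h j, Finset.prod_mul_distrib, Finset.prod_mul_distrib,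
    Finset.prod_ite_eq' _ k, if_pos (Finset.mem_univ _), Finset.prod_filter, Finset.prod_filter]

theorem par_eq_zero_or_one (i : Fin (m + n)) : par i = 0 ∨ par i = 1 := by
  have := par_lt_two i; omega

theorem lt_of_par_lt {i j : Fin (m + n)} (hi : par i = 0) (hj : par j = 1) : i < j := by
  rcases lt_or_ge i.val m with h | h
  · rcases lt_or_ge j.val m with h' | h'
    · rw [par_of_lt h'] at hj; omega
    · exact Fin.lt_def.2 (by omega)
  · rw [par_of_le h] at hi; omega

/-- The number `σ(i, A)` is the parity of the first `i - 1` tensor factors of `X^{[A]}`. -/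
theorem sig_eq (k : Fin (m + n)) (A : NMat m n) :
    sig k A = ∑ j with j < k, ∑ i with par i ≠ par j, A i j := by
  have hp := par_eq_zero_or_one (m := m) (n := n)
  rcases hp k with hk | hk
  · rw [sig, if_pos hk, Finset.sum_comm (f := fun s t => A s t)]
    refine Finset.sum_congr rfl fun j hj => ?_
    have hj0 : par j = 0 := by
      rcases hp j with h | h
      · exact h
      · exact absurd (Finset.mem_filter.1 hj).2 (lt_of_par_lt hk h).not_gt
    refine Finset.sum_congr (Finset.filter_congr fun i _ => ?_) fun _ _ => rfl
    have := hp i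
    omega
  · rw [sig, if_neg (by omega),
      Finset.sum_comm (s := {s : Fin (m + n) | par s = 1}) (f := fun s t => A s t),
      Finset.sum_comm (s := {s : Fin (m + n) | par s = 0}) (f := fun s t => A s t),
      ← Finset.sum_filter_add_sum_filter_not ({j | j < k} : Finset (Fin (m + n)))
        (fun j => par j = 0)]
    congr 1
    · refine Finset.sum_congr ?_ fun j hj => ?_
      · ext j
        simp only [Finset.mem_filter, Finset.mem_univ, true_and]
        exact ⟨fun h => ⟨lt_of_par_lt h hk, h⟩, fun h => h.2⟩
      · refine Finset.sum_congr (Finset.filter_congr fun i _ => ?_) fun _ _ => rfl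
        have := hp i
        have := (Finset.mem_filter.1 hj).2
        omega
    · refine Finset.sum_congr ?_ fun j hj => ?_
      · ext j
        simp only [Finset.mem_filter, Finset.mem_univ, true_and]
        have := hp j
        rw [and_comm]
        exact and_congr_right fun _ => by omega
      · refine Finset.sum_congr (Finset.filter_congr fun i _ => ?_) fun _ _ => rfl
        have := hp i
        have := hp j
        have : par j ≠ 0 := (Finset.mem_filter.1 hj).2
        omega

theorem prod_signWeight (h : Fin (m + n - 1)) (k : Fin (m + n)) (A : NMat m n) :
    ∏ j with j < k, ∏ i, signWeight (par j) (isOdd h) i ^ A i j = sgn h k A := by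
  rw [sgn, sig_eq, pow_mul, ← Finset.prod_pow_eq_pow_sum]
  refine Finset.prod_congr rfl fun j _ => ?_
  rw [← Finset.prod_pow_eq_pow_sum, Finset.prod_filter]
  refine Finset.prod_congr rfl fun i _ => ?_
  rw [signWeight, ite_pow, one_pow]

theorem υi_lo_zpow (h : Fin (m + n - 1)) (x : ℤ) :
    υi (lo h) ^ ((-1) ^ isOdd h * x) = υi (hi h) ^ x := by
  by_cases ho : h.val + 1 = m
  · rw [isOdd_of_eq ho, υi_hi_of_eq ho, pow_one, neg_one_mul, inv_zpow']
  · rw [isOdd_of_ne ho, υi_hi_of_ne ho, pow_zero, one_mul]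

theorem υi_hi_zpow (h : Fin (m + n - 1)) (x : ℤ) :
    υi (hi h) ^ ((-1) ^ isOdd h * x) = υi (lo h) ^ x := by
  rw [← υi_lo_zpow, ← mul_assoc, ← mul_pow]
  simp

theorem prod_zpow {ι : Type*} (s : Finset ι) (a : Qv) (f : ι → ℕ) :
    ∏ i ∈ s, a ^ f i = a ^ (∑ i ∈ s, (f i : ℤ)) := by
  rw [Finset.prod_pow_eq_pow_sum, ← zpow_natCast]
  push_cast; rfl

theorem prod_ktWeight (h : Fin (m + n - 1)) (k : Fin (m + n)) (A : NMat m n) :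
    ∏ j with k < j, ∏ i, ktWeight h i ^ A i j = υi (lo h) ^ fexp h k A := by
  simp only [prod_ktWeight_pow h fun i => A i _]
  rw [Finset.prod_div_distrib, prod_zpow, prod_zpow, fexp,
    zpow_sub₀ (υi_ne_zero _), υi_lo_zpow]

theorem prod_ktWeight_inv (h : Fin (m + n - 1)) (k : Fin (m + n)) (A : NMat m n) :
    ∏ j with j < k, ∏ i, (ktWeight h)⁻¹ i ^ A i j = υi (hi h) ^ gexp h k A := by
  simp only [Pi.inv_apply, inv_pow, Finset.prod_inv_distrib, prod_ktWeight_pow h fun i => A i _]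
  rw [Finset.prod_div_distrib, prod_zpow, prod_zpow, gexp,
    zpow_sub₀ (υi_ne_zero _), υi_hi_zpow, inv_div]

/-- The coefficient of `X^{[A + E_{h,k} - E_{h+1,k}]}` in `E_h . X^{[A]}`. -/
def coefE (h : Fin (m + n - 1)) (k : Fin (m + n)) (A : NMat m n) : Qv :=
  sgn h k A * υi (lo h) ^ fexp h k A * qint (A (lo h) k + 1)

/-- The coefficient of `X^{[A - E_{h,k} + E_{h+1,k}]}` in `F_h . X^{[A]}`. -/
def coefF (h : Fin (m + n - 1)) (k : Fin (m + n)) (A : NMat m n) : Qv :=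
  sgn h k A * υi (hi h) ^ gexp h k A * qint (A (hi h) k + 1)

theorem sub_add_unit {r s k : Fin (m + n)} (hrs : r ≠ s) (A : NMat m n) :
    A - unit s k + unit r k = A + unit r k - unit s k := by
  ext i j
  simp only [unit, Matrix.add_apply, Matrix.sub_apply, Matrix.single_apply]
  by_cases h1 : r = i
  · subst h1; simp [hrs.symm]
  · simp [h1]

theorem map_mon_eq_smul {φ : ∀ j : Fin (m + n), Module.End Qv (SFactor m n (par j))}
    {A : Mmn m n} {c : Fin (m + n) → Qv} {A' : NMat m n}
    (h : ∀ j, φ j (dpow (par j) fun i => A.1 i j) = c j • dpow (par j) fun i => A' i j) :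
    PiTensorProduct.map φ (mon A) = (∏ j, c j) • monN A' := by
  rw [mon, PiTensorProduct.map_tprod, monN, ← MultilinearMap.map_smul_univ]
  simp only [h]

theorem opE_mon (h : Fin (m + n - 1)) (A : Mmn m n) :
    opE h (mon A) = ∑ k, (if 0 < A.1 (hi h) k then coefE h k A.1 else 0) •
      monN (A.1 + unit (lo h) k - unit (hi h) k) := by
  rw [opE_eq, LinearMap.sum_apply]
  refine Finset.sum_congr rfl fun k _ => ?_
  rw [map_mon_eq_smul (A' := A.1 + unit (lo h) k - unit (hi h) k) (c := fun j =>
    if j < k then ∏ i, signWeight (par j) (isOdd h) i ^ A.1 i j else if j = k then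
      (if 0 < A.1 (hi h) j then qint (A.1 (lo h) j + 1) else 0)
    else ∏ i, ktWeight h i ^ A.1 i j)]
  · rw [prod_ite_lt_eq, prod_signWeight, prod_ktWeight, coefE]
    congr 1
    split_ifs
    · ring
    · ring
  · intro j
    have hcol : j ≠ k → (fun i => (A.1 + unit (lo h) k - unit (hi h) k) i j)
        = fun i => A.1 i j := fun hj => by
      funext i
      simp [unit, hj.symm]
    rcases lt_trichotomy j k with hj | hj | hj
    · simp only [termE, hj, if_true]
      rw [facDiag_dpow, hcol hj.ne]
    · subst hj
      simp only [termE, lt_irrefl, if_true, if_false]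
      rw [facE, linearCombination_dpow fun i hi => A.2 i j hi]
      dsimp only
      split_ifs with h0
      · congr 2
        funext i
        simp [unit, Matrix.single_apply, Pi.single_apply, eq_comm]
      · rw [zero_smul]
    · simp only [termE, hj.not_gt, hj.ne', if_false]
      rw [facDiag_dpow, hcol hj.ne']

theorem opF_mon (h : Fin (m + n - 1)) (A : Mmn m n) :
    opF h (mon A) = ∑ k, (if 0 < A.1 (lo h) k then coefF h k A.1 else 0) •
      monN (A.1 + unit (hi h) k - unit (lo h) k) := by
  rw [opF_eq, LinearMap.sum_apply]
  refine Finset.sum_congr rfl fun k _ => ?_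
  rw [map_mon_eq_smul (A' := A.1 + unit (hi h) k - unit (lo h) k) (c := fun j =>
    if j < k then (∏ i, signWeight (par j) (isOdd h) i ^ A.1 i j) *
      ∏ i, (ktWeight h)⁻¹ i ^ A.1 i j else if j = k then
      (if 0 < A.1 (lo h) j then qint (A.1 (hi h) j + 1) else 0)
    else 1)]
  · rw [prod_ite_lt_eq, Finset.prod_mul_distrib, prod_signWeight, prod_ktWeight_inv, coefF,
      Finset.prod_const_one]
    congr 1
    split_ifs
    · ring
    · ring
  · intro j
    have hcol : j ≠ k → (fun i => (A.1 + unit (hi h) k - unit (lo h) k) i j)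
        = fun i => A.1 i j := fun hj => by
      funext i
      simp [unit, hj.symm]
    rcases lt_trichotomy j k with hj | hj | hj
    · simp only [termF, hj, if_true]
      rw [facDiag_dpow, hcol hj.ne]
      simp only [Pi.mul_apply, mul_pow, Finset.prod_mul_distrib]
      rw [mul_comm]
    · subst hj
      rw [← sub_add_unit (lo_ne_hi h).symm]
      simp only [termF, lt_irrefl, if_true, if_false]
      rw [facF, linearCombination_dpow fun i hi => A.2 i j hi]
      dsimp only
      split_ifs with h0
      · congr 2
        funext i
        simp [unit, Matrix.single_apply, Pi.single_apply, eq_comm]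
      · rw [zero_smul]
    · simp only [termF, hj.not_gt, hj.ne', if_false]
      rw [hcol hj.ne', one_smul, Module.End.one_apply]

theorem opDiag_mon (w : Fin (m + n) → Qv) (A : Mmn m n) :
    opDiag w (mon A) = (∏ i, w i ^ ∑ j, A.1 i j) • mon A := by
  rw [opDiag, map_mon_eq_smul (A' := A.1) fun j => facDiag_dpow w _, Finset.prod_comm]
  simp only [Finset.prod_pow_eq_pow_sum]
  rfl

theorem coeff_opE (h : Fin (m + n - 1)) (A B : Mmn m n) :
    coeff B (opE h (mon A)) = ∑ k, (if 0 < A.1 (hi h) k then coefE h k A.1 else 0) *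
      smon (A.1 + unit (lo h) k - unit (hi h) k) B := by
  simp only [opE_mon, map_sum, map_smul, coeff_monN, smul_eq_mul]

theorem coeff_opF (h : Fin (m + n - 1)) (A B : Mmn m n) :
    coeff B (opF h (mon A)) = ∑ k, (if 0 < A.1 (lo h) k then coefF h k A.1 else 0) *
      smon (A.1 + unit (hi h) k - unit (lo h) k) B := by
  simp only [opF_mon, map_sum, map_smul, coeff_monN, smul_eq_mul]

theorem coeff_opDiag (w : Fin (m + n) → Qv) (A B : Mmn m n) :
    coeff B (opDiag w (mon A)) = if A = B then ∏ i, w i ^ ∑ j, A.1 i j else 0 := by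
  rw [opDiag_mon, map_smul, coeff_mon, smul_eq_mul, mul_ite, mul_one, mul_zero]

/-- An operator moving units from row `s` to row `r` within the columns of a matrix, such as `E_h`
and `F_h`, only has nonzero coefficients between matrices related by such a move. -/
theorem exists_of_coeff_ne_zero {T : Module.End Qv (Smn m n)} {r s : Fin (m + n)} (hrs : r ≠ s)
    {c : Fin (m + n) → NMat m n → Qv}
    (hT : ∀ A B : Mmn m n, coeff B (T (mon A)) = ∑ k, (if 0 < A.1 s k then c k A.1 else 0) *
      smon (A.1 + unit r k - unit s k) B) {A B : Mmn m n} (h : coeff B (T (mon A)) ≠ 0) :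
    ∃ k, 0 < A.1 s k ∧ B.1 + unit s k = A.1 + unit r k := by
  rw [hT] at h
  obtain ⟨k, -, hk⟩ := Finset.exists_ne_zero_of_sum_ne_zero h
  have h1 : 0 < A.1 s k := by
    by_contra h1
    rw [if_neg h1, zero_mul] at hk
    exact hk rfl
  have h2 : B.1 = A.1 + unit r k - unit s k := by
    by_contra h2
    rw [smon, if_neg h2, mul_zero] at hk
    exact hk rfl
  refine ⟨k, h1, ?_⟩
  rw [h2]
  ext i j
  simp only [unit, Matrix.add_apply, Matrix.sub_apply, Matrix.single_apply]
  by_cases hs : s = i ∧ k = j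
  · obtain ⟨rfl, rfl⟩ := hs
    simp only [hrs, false_and, if_false, and_self, if_true]
    omega
  · simp [hs]

theorem rowFinite_of_coeff {T : Module.End Qv (Smn m n)} {r s : Fin (m + n)} (hrs : r ≠ s)
    {c : Fin (m + n) → NMat m n → Qv}
    (hT : ∀ A B : Mmn m n, coeff B (T (mon A)) = ∑ k, (if 0 < A.1 s k then c k A.1 else 0) *
      smon (A.1 + unit r k - unit s k) B) : T ∈ (rowFinite : Subalgebra Qv _) := by
  intro B
  refine Set.Finite.subset (Set.Finite.preimage Subtype.val_injective.injOn
    (Set.finite_range fun k : Fin (m + n) => B.1 + unit s k - unit r k)) fun A hA => ?_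
  obtain ⟨k, -, hk⟩ := exists_of_coeff_ne_zero hrs hT hA
  refine ⟨k, ?_⟩
  ext i j
  have := congrFun (congrFun hk i) j
  simp only [Matrix.add_apply, Matrix.sub_apply] at this ⊢
  omega

theorem rowFinite_opDiag (w : Fin (m + n) → Qv) : opDiag w ∈ (rowFinite : Subalgebra Qv _) := by
  intro B
  refine (Set.finite_singleton B).subset fun A hA => ?_
  by_contra hA'
  refine hA ?_
  have hAB : A ≠ B := fun h => hA' (Set.mem_singleton_iff.2 h)
  rw [coeff_opDiag, if_neg hAB]

theorem rowFinite_rep (u : Uq m n) : rep u ∈ (rowFinite : Subalgebra Qv _) := by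
  refine subalgebra_eq_top (S := rowFinite.comap rep) (fun g => ?_) u
  rw [Subalgebra.mem_comap, rep_gen]
  cases g with
  | E h => exact rowFinite_of_coeff (lo_ne_hi h) (coeff_opE h)
  | F h => exact rowFinite_of_coeff (lo_ne_hi h).symm (coeff_opF h)
  | K i =>
    change opK i ∈ _
    rw [opK_eq]
    exact rowFinite_opDiag _
  | Kinv i => exact rowFinite_opDiag _

/-- The action of `U_υ(gl_{m|n})` on formal power series. -/
def repSeries : Uq m n →ₐ[Qv] Module.End Qv (SSeries m n) :=
  extend.comp (rep.codRestrict rowFinite rowFinite_rep)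

theorem isExtension_rep (u : Uq m n) : IsExtension (rep u) (repSeries u) :=
  isExtension_extend ⟨rep u, rowFinite_rep u⟩

theorem repSeries_gen_apply (g : Gen m n) (f : SSeries m n) (B : Mmn m n) :
    repSeries (gen g) f B = ∑ᶠ A, f A * coeff B (genOp g (mon A)) := by
  rw [(isExtension_rep (gen g) B).2, rep_gen]

/-! ### The series `A(j)` -/

theorem finsum_comp_of_support_subset {α β M : Type*} [AddCommMonoid M] {f : β → M} {g : α → β}
    (hg : Function.Injective g) (h : Function.support f ⊆ Set.range g) :
    ∑ᶠ b, f b = ∑ᶠ a, f (g a) := by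
  rw [← finsum_mem_range hg, finsum_mem_def, Set.indicator_eq_self.2 h]

/-- Shifting the summation variable; terms with `l i = 0` have to vanish. -/
theorem finsum_add_single {f : (Fin (m + n) → ℕ) → Qv} {i : Fin (m + n)}
    (hf : ∀ l, l i = 0 → f l = 0) : ∑ᶠ l, f l = ∑ᶠ l : Fin (m + n) → ℕ, f (l + Pi.single i 1) := by
  refine finsum_comp_of_support_subset (add_left_injective _) fun l hl => ?_
  have : 0 < l i := Nat.pos_of_ne_zero fun h => hl (hf l h)
  exact ⟨l - Pi.single i 1, sub_add_single this⟩

theorem smon_add_diagonal_subsingleton (A : NMat m n) (B : Mmn m n) :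
    {l | smon (A + Matrix.diagonal l) B ≠ 0}.Subsingleton := by
  have key : ∀ l, smon (A + Matrix.diagonal l) B ≠ 0 → B.1 = A + Matrix.diagonal l := fun l hl => by
    by_contra h
    exact hl (if_neg h)
  intro l hl l' hl'
  have h := (key l hl).symm.trans (key l' hl')
  funext i
  have := congrFun (congrFun h i) i
  simpa using this

theorem finsum_smon {A : NMat m n} (hA : ∀ i, A i i = 0) (B : Mmn m n)
    (G : (Fin (m + n) → ℕ) → Qv) :
    ∑ᶠ l, G l * smon (A + Matrix.diagonal l) B =
      G (fun i => B.1 i i) * smon (A + Matrix.diagonal fun i => B.1 i i) B := by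
  refine finsum_eq_single _ _ fun l hl => ?_
  rw [smon, if_neg, mul_zero]
  intro h
  refine hl (funext fun i => ?_)
  rw [h]
  simp [hA]

theorem ser_apply {A : NMat m n} (hA : ∀ i, A i i = 0) (j : Fin (m + n) → ℤ) (B : Mmn m n) :
    ser A j B = υ ^ sdot (fun i => (B.1 i i : ℤ)) j *
      smon (A + Matrix.diagonal fun i => B.1 i i) B :=
  finsum_smon hA B fun l => υ ^ sdot (fun i => (l i : ℤ)) j

/-- The matrix `A + diag(λ)`. -/
def withDiag (A : Mmn0 m n) (l : Fin (m + n) → ℕ) : Mmn m n :=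
  ⟨A.1 + Matrix.diagonal l, fun i j h => by
    have hij : i ≠ j := fun e => h (by rw [e])
    simpa [Matrix.diagonal_apply_ne _ hij] using A.2.1 i j h⟩

theorem withDiag_diag (A : Mmn0 m n) (l : Fin (m + n) → ℕ) (i : Fin (m + n)) :
    (withDiag A l).1 i i = l i := by
  simp [withDiag, A.2.2]

theorem withDiag_injective (A : Mmn0 m n) : Function.Injective (withDiag A) := fun l l' h =>
  funext fun i => by rw [← withDiag_diag A l, h, withDiag_diag]

theorem ser_withDiag (A : Mmn0 m n) (j : Fin (m + n) → ℤ) (l : Fin (m + n) → ℕ) :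
    ser A.1 j (withDiag A l) = υ ^ sdot (fun i => (l i : ℤ)) j := by
  rw [ser_apply A.2.2]
  simp only [withDiag_diag]
  rw [smon, if_pos (by rfl), mul_one]

theorem ser_withDiag_of_ne {A A' : Mmn0 m n} (h : A' ≠ A) (j : Fin (m + n) → ℤ)
    (l : Fin (m + n) → ℕ) : ser A'.1 j (withDiag A l) = 0 := by
  rw [ser_apply A'.2.2]
  simp only [withDiag_diag]
  rw [smon, if_neg, mul_zero]
  intro h'
  refine h (Subtype.ext (add_right_cancel h'.symm))

theorem exists_withDiag_of_ser_ne_zero {A : Mmn0 m n} {j : Fin (m + n) → ℤ} {B : Mmn m n}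
    (h : ser A.1 j B ≠ 0) : ∃ l, withDiag A l = B := by
  rw [ser_apply A.2.2] at h
  have := right_ne_zero_of_mul h
  rw [smon] at this
  exact ⟨fun i => B.1 i i, Subtype.ext (not_not.1 fun h' => this (if_neg fun e => h' e.symm))⟩

/-- `A(j) = 0` if `A ∉ M(m|n)`. -/
theorem ser_eq_zero {A : NMat m n} (hA : ∀ i, A i i = 0) {s t : Fin (m + n)} (hst : par s ≠ par t)
    (h : 1 < A s t) (j : Fin (m + n) → ℤ) : ser A j = 0 := by
  funext B
  rw [ser_apply hA, smon, if_neg, mul_zero]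
  · rfl
  · intro e
    have h1 := B.2 s t hst
    rw [e, Matrix.add_apply] at h1
    omega

/-- The series `∑_A f_A (g . X^{[A]})` for `f = A(j)`, as a sum over `λ`. -/
theorem repSeries_ser (g : Gen m n) (A : Mmn0 m n) (j : Fin (m + n) → ℤ) (B : Mmn m n) :
    repSeries (gen g) (ser A.1 j) B = ∑ᶠ l : Fin (m + n) → ℕ,
      υ ^ sdot (fun i => (l i : ℤ)) j * coeff B (genOp g (mon (withDiag A l))) := by
  rw [repSeries_gen_apply, finsum_comp_of_support_subset (withDiag_injective A)]
  · simp only [ser_withDiag]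
  · intro C hC
    exact exists_withDiag_of_ser_ne_zero (left_ne_zero_of_mul hC)

theorem υ_zpow_sdot_add (x y z : Fin (m + n) → ℤ) :
    υ ^ sdot x (y + z) = υ ^ sdot x y * υ ^ sdot x z := by
  rw [sdot_add, zpow_add₀ υ_ne_zero]

theorem υ_zpow_sdot_single (l : Fin (m + n) → ℕ) (i : Fin (m + n)) (j : Fin (m + n) → ℤ) :
    υ ^ sdot (fun k => ((l + Pi.single i 1 : Fin (m + n) → ℕ) k : ℤ)) j
      = υ ^ sdot (fun k => (l k : ℤ)) j * υi i ^ j i := by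
  rw [sdot_comm, sdot_comm _ j, ← υ_zpow_sdot_e, ← υ_zpow_sdot_add]
  congr 2
  funext k
  by_cases h : k = i
  · subst h; simp [e]
  · simp [e, h]

section RowOperator

variable {r s : Fin (m + n)} {c : Fin (m + n) → NMat m n → Qv}

theorem add_diagonal_add_sub {A : NMat m n} {k : Fin (m + n)} (hrs : r ≠ s) (h : 1 ≤ A s k)
    (l : Fin (m + n) → ℕ) : A + Matrix.diagonal l + unit r k - unit s k
      = A + unit r k - unit s k + Matrix.diagonal l := by
  ext i j
  by_cases hi : s = i
  · subst hi
    by_cases hj : k = j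
    · subst hj
      simp [unit, hrs]
      omega
    · simp [unit, hj]
  · simp [unit, Matrix.single_apply, hi, add_right_comm]

theorem diagonal_add_single (l : Fin (m + n) → ℕ) (i : Fin (m + n)) :
    Matrix.diagonal (l + Pi.single i 1) = Matrix.diagonal l + unit i i := by
  rw [unit, ← Matrix.diagonal_single]
  exact (Matrix.diagonal_add _ _).symm

theorem add_diagonal_add_sub_lower (A : NMat m n) (l : Fin (m + n) → ℕ) :
    A + Matrix.diagonal (l + Pi.single s 1) + unit r s - unit s s
      = A + unit r s + Matrix.diagonal l := by
  rw [diagonal_add_single]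
  ext i j
  simp only [Matrix.add_apply, Matrix.sub_apply]
  omega

theorem add_diagonal_add_sub_raise {A : NMat m n} (hrs : r ≠ s) (h : 1 ≤ A s r)
    (l : Fin (m + n) → ℕ) : A + Matrix.diagonal l + unit r r - unit s r
      = A - unit s r + Matrix.diagonal (l + Pi.single r 1) := by
  rw [add_diagonal_add_sub hrs h, ← sub_add_unit hrs, diagonal_add_single, add_assoc,
    add_comm (unit r r)]

theorem repSeries_ser_eq_sum {g : Gen m n}
    (hT : ∀ A B : Mmn m n, coeff B (genOp g (mon A)) = ∑ k, (if 0 < A.1 s k then c k A.1 else 0) *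
      smon (A.1 + unit r k - unit s k) B) (A : Mmn0 m n) (j : Fin (m + n) → ℤ) (B : Mmn m n) :
    repSeries (gen g) (ser A.1 j) B = ∑ k, ∑ᶠ l : Fin (m + n) → ℕ,
      υ ^ sdot (fun i => (l i : ℤ)) j *
        ((if 0 < (A.1 + Matrix.diagonal l) s k then c k (A.1 + Matrix.diagonal l) else 0) *
          smon (A.1 + Matrix.diagonal l + unit r k - unit s k) B) := by
  rw [repSeries_ser, ← finsum_sum_comm]
  · refine finsum_congr fun l => ?_
    rw [hT, Finset.mul_sum]
    rfl
  · intro k _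
    refine (Set.finite_Iic fun i => B.1 i i + 1).subset fun l hl i => ?_
    have h1 := right_ne_zero_of_mul (right_ne_zero_of_mul hl)
    have h2 : B.1 = A.1 + Matrix.diagonal l + unit r k - unit s k := by
      by_contra h2
      exact h1 (if_neg h2)
    have h3 := congrFun (congrFun h2 i) i
    simp only [Matrix.add_apply, Matrix.sub_apply, Matrix.diagonal_apply_eq, unit,
      Matrix.single_apply] at h3
    change l i ≤ B.1 i i + 1
    split_ifs at h3 <;> omega

/-- The contribution of an off-diagonal position `k`: the diagonal of the matrix only enters through
a character of `λ`, which shifts `j`. -/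
theorem finsum_generic (hrs : r ≠ s) {A : Mmn0 m n} {k : Fin (m + n)} (hk : k ≠ s)
    {δ : Fin (m + n) → ℤ} (hc : ∀ l : Fin (m + n) → ℕ,
      c k (A.1 + Matrix.diagonal l) = c k A.1 * υ ^ sdot (fun i => (l i : ℤ)) δ)
    (j : Fin (m + n) → ℤ) (B : Mmn m n) :
    ∑ᶠ l : Fin (m + n) → ℕ, υ ^ sdot (fun i => (l i : ℤ)) j *
        ((if 0 < (A.1 + Matrix.diagonal l) s k then c k (A.1 + Matrix.diagonal l) else 0) *
          smon (A.1 + Matrix.diagonal l + unit r k - unit s k) B)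
      = if 1 ≤ A.1 s k then c k A.1 * ser (A.1 + unit r k - unit s k) (j + δ) B else 0 := by
  have h0 : ∀ l : Fin (m + n) → ℕ, (A.1 + Matrix.diagonal l) s k = A.1 s k := fun l => by
    simp [Matrix.diagonal_apply_ne _ hk.symm]
  simp only [h0]
  split_ifs with h1 h2
  · rw [ser, ← smul_eq_mul, smul_finsum]
    refine finsum_congr fun l => ?_
    rw [add_diagonal_add_sub hrs h1, hc, υ_zpow_sdot_add, smul_eq_mul]
    ring
  · omega
  · omega
  · simp

/-- The contribution of the diagonal position in the lowered row `s`. -/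
theorem finsum_lower {A : Mmn0 m n}
    (hc : ∀ l : Fin (m + n) → ℕ, c s (A.1 + Matrix.diagonal l) = c s A.1)
    (j : Fin (m + n) → ℤ) (B : Mmn m n) :
    ∑ᶠ l : Fin (m + n) → ℕ, υ ^ sdot (fun i => (l i : ℤ)) j *
        ((if 0 < (A.1 + Matrix.diagonal l) s s then c s (A.1 + Matrix.diagonal l) else 0) *
          smon (A.1 + Matrix.diagonal l + unit r s - unit s s) B)
      = c s A.1 * υi s ^ j s * ser (A.1 + unit r s) j B := by
  have h0 : ∀ l : Fin (m + n) → ℕ, (A.1 + Matrix.diagonal l) s s = l s := fun l => by simp [A.2.2]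
  simp only [h0, hc]
  rw [finsum_add_single (i := s) fun l hl => by simp [hl], ser, ← smul_eq_mul, smul_finsum]
  refine finsum_congr fun l => ?_
  rw [υ_zpow_sdot_single, add_diagonal_add_sub_lower, if_pos (by simp), smul_eq_mul]
  ring

/-- The contribution of the diagonal position in the raised row `r`: the quantum integer
`[λ_r + 1]` turns into a difference of two characters of `λ`. -/
theorem finsum_raise (hrs : r ≠ s) {A : Mmn0 m n} {d : Qv} {γ : Fin (m + n) → ℤ} (hγ : γ r = 0)
    (hc : ∀ l : Fin (m + n) → ℕ, c r (A.1 + Matrix.diagonal l)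
      = d * υ ^ sdot (fun i => (l i : ℤ)) γ * qint (l r + 1))
    (j : Fin (m + n) → ℤ) (B : Mmn m n) :
    ∑ᶠ l : Fin (m + n) → ℕ, υ ^ sdot (fun i => (l i : ℤ)) j *
        ((if 0 < (A.1 + Matrix.diagonal l) s r then c r (A.1 + Matrix.diagonal l) else 0) *
          smon (A.1 + Matrix.diagonal l + unit r r - unit s r) B)
      = if A.1 s r = 0 then 0 else d * υi r ^ (-j r) / (υi r - (υi r)⁻¹) *
        (ser (A.1 - unit s r) (j + (γ + e r)) B - ser (A.1 - unit s r) (j + (γ - e r)) B) := by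
  have h0 : ∀ l : Fin (m + n) → ℕ, (A.1 + Matrix.diagonal l) s r = A.1 s r := fun l => by
    simp [Matrix.diagonal_apply_ne _ hrs.symm]
  simp only [h0]
  split_ifs with h1 h2 h2
  · omega
  · have hfin : ∀ G : (Fin (m + n) → ℕ) → Qv, Function.HasFiniteSupport fun l =>
        G l * smon (A.1 - unit s r + Matrix.diagonal l) B := fun G =>
      (smon_add_diagonal_subsingleton _ B).finite.subset fun l hl => right_ne_zero_of_mul hl
    rw [ser, ser, ← finsum_sub_distrib (hfin _) (hfin _), ← smul_eq_mul, smul_finsum]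
    conv_rhs => rw [finsum_add_single (i := r) fun l hl => by
      simp [υ_zpow_sdot_add, sub_eq_add_neg, sdot_neg, zpow_neg, υ_zpow_sdot_e, hl]]
    refine finsum_congr fun l => ?_
    have hυ := υi_ne_zero r
    have hυ' := υi_sub_inv_ne_zero r
    simp only [add_diagonal_add_sub_raise hrs h1, hc, smul_eq_mul, υ_zpow_sdot_single]
    rw [qint_eq r, ← sub_mul, υ_zpow_sdot_add, υ_zpow_sdot_add, υ_zpow_sdot_add, sub_eq_add_neg γ,
      υ_zpow_sdot_add, sdot_neg, zpow_neg υ, υ_zpow_sdot_e]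
    simp only [Pi.add_apply, Pi.neg_apply, hγ, e, Pi.single_eq_same, zero_add]
    simp only [zpow_add₀ hυ, zpow_neg, zpow_one]
    have := zpow_ne_zero (j r) hυ
    have := zpow_ne_zero (l r : ℤ) hυ
    field_simp
  · simp
  · omega

end RowOperator

/-! ### The action formulas -/

theorem sum_split (h : Fin (m + n - 1)) (f : Fin (m + n) → Qv) :
    ∑ k, f k = ∑ k with hi h < k, f k + ∑ k with k < lo h, f k + f (lo h) + f (hi h) := by
  have key : ∀ k, f k = (if hi h < k then f k else 0) + (if k < lo h then f k else 0)
      + (if k = lo h then f k else 0) + (if k = hi h then f k else 0) := fun k => by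
    have : hi h < k ∨ k < lo h ∨ k = lo h ∨ k = hi h := by
      simp only [Fin.lt_def, Fin.ext_iff, lo_val, hi_val]; omega
    have h1 := lo_ne_hi h
    have h2 : lo h < hi h := Fin.lt_def.2 (by simp)
    rcases this with hk | hk | hk | hk
    · simp [hk, hk.ne', (h2.trans hk).ne', (h2.trans hk).not_gt]
    · simp [hk, hk.ne, (hk.trans h2).ne, (hk.trans h2).not_gt]
    · subst hk; simp [h1, h2.not_gt]
    · subst hk; simp [h1.symm, h2.not_gt]
  rw [Finset.sum_congr rfl fun k _ => key k]
  simp only [Finset.sum_add_distrib, Finset.sum_filter, Finset.sum_ite_eq', Finset.mem_univ,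
    if_true]

theorem sgn_add_diagonal (h : Fin (m + n - 1)) (k : Fin (m + n)) (A : NMat m n)
    (l : Fin (m + n) → ℕ) : sgn h k (A + Matrix.diagonal l) = sgn h k A := by
  rw [sgn, sgn, sig_eq, sig_eq]
  congr 2
  refine Finset.sum_congr rfl fun j _ => Finset.sum_congr rfl fun i hi => ?_
  have : i ≠ j := fun e => (Finset.mem_filter.1 hi).2 (by rw [e])
  simp [Matrix.diagonal_apply_ne _ this]

theorem sum_diagonal (s : Fin (m + n)) (p : Fin (m + n) → Prop) [DecidablePred p]
    (l : Fin (m + n) → ℕ) :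
    ∑ j with p j, ((Matrix.diagonal l s j : ℕ) : ℤ) = if p s then (l s : ℤ) else 0 := by
  rw [Finset.sum_filter, Finset.sum_eq_single s (fun j _ hj => by
    simp [Matrix.diagonal_apply_ne _ hj.symm]) (by simp)]
  simp

theorem fexp_add_diagonal (h : Fin (m + n - 1)) (k : Fin (m + n)) (A : NMat m n)
    (l : Fin (m + n) → ℕ) : fexp h k (A + Matrix.diagonal l) = fexp h k A +
      ((if k < lo h then (l (lo h) : ℤ) else 0)
        - (-1) ^ isOdd h * if k < hi h then (l (hi h) : ℤ) else 0) := by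
  simp only [fexp, Matrix.add_apply, Nat.cast_add, Finset.sum_add_distrib, sum_diagonal]
  ring

theorem gexp_add_diagonal (h : Fin (m + n - 1)) (k : Fin (m + n)) (A : NMat m n)
    (l : Fin (m + n) → ℕ) : gexp h k (A + Matrix.diagonal l) = gexp h k A +
      ((if hi h < k then (l (hi h) : ℤ) else 0)
        - (-1) ^ isOdd h * if lo h < k then (l (lo h) : ℤ) else 0) := by
  simp only [gexp, Matrix.add_apply, Nat.cast_add, Finset.sum_add_distrib, sum_diagonal]
  ring

theorem υ_zpow_sdot_sub (x y z : Fin (m + n) → ℤ) :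
    υ ^ sdot x (y - z) = υ ^ sdot x y / υ ^ sdot x z := by
  rw [sdot_sub, zpow_sub₀ υ_ne_zero]

theorem coefE_add_diagonal_of_ne (h : Fin (m + n - 1)) {k : Fin (m + n)} (h1 : k ≠ lo h)
    (A : NMat m n) (l : Fin (m + n) → ℕ) :
    coefE h k (A + Matrix.diagonal l) = coefE h k A *
      υ ^ sdot (fun i => (l i : ℤ)) (if k < lo h then α h else 0) := by
  rw [coefE, coefE, sgn_add_diagonal, fexp_add_diagonal, zpow_add₀ (υi_ne_zero _),
    zpow_sub₀ (υi_ne_zero _), υi_lo_zpow, Matrix.add_apply, Matrix.diagonal_apply_ne _ h1.symm,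
    add_zero]
  have h3 : k < hi h ↔ k < lo h := by
    have : k.val ≠ h.val := fun e => h1 (Fin.ext e)
    simp only [Fin.lt_def, lo_val, hi_val]; omega
  by_cases h4 : k < lo h
  · simp only [h3, h4, if_true, α]
    rw [υ_zpow_sdot_sub, υ_zpow_sdot_e, υ_zpow_sdot_e]
    ring
  · simp only [h3, h4, if_false, zpow_zero]
    simp [sdot]

theorem coefE_add_diagonal_lo (h : Fin (m + n - 1)) {A : NMat m n} (hA : ∀ i, A i i = 0)
    (l : Fin (m + n) → ℕ) :
    coefE h (lo h) (A + Matrix.diagonal l) = sgn h (lo h) A * υi (lo h) ^ fexp h (lo h) A *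
      υ ^ sdot (fun i => (l i : ℤ)) (-e (hi h)) * qint (l (lo h) + 1) := by
  have h1 : lo h < hi h := Fin.lt_def.2 (by simp)
  rw [coefE, sgn_add_diagonal, fexp_add_diagonal, zpow_add₀ (υi_ne_zero _),
    if_neg (lt_irrefl _), if_pos h1, zpow_sub₀ (υi_ne_zero _), υi_lo_zpow, Matrix.add_apply,
    Matrix.diagonal_apply_eq, hA, zero_add, sdot_neg, zpow_neg, υ_zpow_sdot_e, zpow_zero, one_div]
  ring

theorem coefF_add_diagonal_of_ne (h : Fin (m + n - 1)) {k : Fin (m + n)} (h2 : k ≠ hi h)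
    (A : NMat m n) (l : Fin (m + n) → ℕ) :
    coefF h k (A + Matrix.diagonal l) = coefF h k A *
      υ ^ sdot (fun i => (l i : ℤ)) (if hi h < k then -α h else 0) := by
  rw [coefF, coefF, sgn_add_diagonal, gexp_add_diagonal, zpow_add₀ (υi_ne_zero _),
    zpow_sub₀ (υi_ne_zero _), υi_hi_zpow, Matrix.add_apply, Matrix.diagonal_apply_ne _ h2.symm,
    add_zero]
  have h3 : lo h < k ↔ hi h < k := by
    have : k.val ≠ h.val + 1 := fun e => h2 (Fin.ext e)
    simp only [Fin.lt_def, lo_val, hi_val]; omega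
  by_cases h4 : hi h < k
  · simp only [h3, h4, if_true, α, neg_sub]
    rw [υ_zpow_sdot_sub, υ_zpow_sdot_e, υ_zpow_sdot_e]
    ring
  · simp only [h3, h4, if_false, zpow_zero]
    simp [sdot]

theorem coefF_add_diagonal_hi (h : Fin (m + n - 1)) {A : NMat m n} (hA : ∀ i, A i i = 0)
    (l : Fin (m + n) → ℕ) :
    coefF h (hi h) (A + Matrix.diagonal l) = sgn h (hi h) A * υi (hi h) ^ gexp h (hi h) A *
      υ ^ sdot (fun i => (l i : ℤ)) (-e (lo h)) * qint (l (hi h) + 1) := by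
  have h1 : lo h < hi h := Fin.lt_def.2 (by simp)
  rw [coefF, sgn_add_diagonal, gexp_add_diagonal, zpow_add₀ (υi_ne_zero _),
    if_neg (lt_irrefl _), if_pos h1, zpow_sub₀ (υi_ne_zero _), υi_hi_zpow, Matrix.add_apply,
    Matrix.diagonal_apply_eq, hA, zero_add, sdot_neg, zpow_neg, υ_zpow_sdot_e, zpow_zero, one_div]
  ring

theorem repSeries_opDiag {g : Gen m n} {w : Fin (m + n) → Qv} (hg : genOp g = opDiag w)
    (f : SSeries m n) (B : Mmn m n) :
    repSeries (gen g) f B = f B * ∏ i, w i ^ ∑ j, B.1 i j := by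
  rw [repSeries_gen_apply, hg, finsum_eq_single _ B fun A hA => by
    rw [coeff_opDiag, if_neg hA, mul_zero]]
  rw [coeff_opDiag, if_pos rfl]

theorem repSeries_K (i : Fin (m + n)) (A : Mmn0 m n) (j : Fin (m + n) → ℤ) :
    repSeries (gen (.K i)) (ser A.1 j) = υi i ^ (∑ k, A.1 i k) • ser A.1 (j + e i) := by
  funext B
  rw [repSeries_opDiag (g := .K i) (w := kWeight i) (opK_eq i),
    Finset.prod_eq_single i (fun j _ h => by simp [kWeight, h]) (by simp)]
  by_cases hB : ∃ l, withDiag A l = B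
  · obtain ⟨l, rfl⟩ := hB
    have : ∑ k, (withDiag A l).1 i k = ∑ k, A.1 i k + l i := by
      simp [withDiag, Finset.sum_add_distrib, Matrix.diagonal_apply]
    rw [Pi.smul_apply, ser_withDiag, ser_withDiag, υ_zpow_sdot_add, υ_zpow_sdot_e, this, kWeight,
      if_pos rfl, pow_add, zpow_natCast, smul_eq_mul]
    ring
  · have h0 : ∀ j, ser A.1 j B = 0 := fun j => by
      by_contra h
      exact hB (exists_withDiag_of_ser_ne_zero h)
    rw [Pi.smul_apply, h0, h0, zero_mul, smul_zero]

theorem repSeries_E (A : Mmn0 m n) (j : Fin (m + n) → ℤ) (h : Fin (m + n - 1)) :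
    repSeries (gen (.E h)) (ser A.1 j) =
      (∑ i with hi h < i ∧ 1 ≤ A.1 (hi h) i,
        (sgn h i A.1 * υi (lo h) ^ fexp h i A.1 * qint (A.1 (lo h) i + 1)) •
          ser (A.1 + unit (lo h) i - unit (hi h) i) j)
      + (∑ i with i < lo h ∧ 1 ≤ A.1 (hi h) i,
        (sgn h i A.1 * υi (lo h) ^ fexp h i A.1 * qint (A.1 (lo h) i + 1)) •
          ser (A.1 + unit (lo h) i - unit (hi h) i) (j + α h))
      + (if A.1 (hi h) (lo h) = 0 then 0 else
        (sgn h (lo h) A.1 * υi (lo h) ^ (fexp h (lo h) A.1 - j (lo h))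
            / (υi (lo h) - (υi (lo h))⁻¹)) •
          (ser (A.1 - unit (hi h) (lo h)) (j + α h)
            - ser (A.1 - unit (hi h) (lo h)) (j - β h)))
      + (sgn h (hi h) A.1
          * υi (lo h) ^ (fexp h (hi h) A.1 + (-1) ^ isOdd h * j (hi h))
          * qint (A.1 (lo h) (hi h) + 1)) •
        ser (A.1 + unit (lo h) (hi h)) j := by
  have hne := lo_ne_hi h
  have hlt : lo h < hi h := Fin.lt_def.2 (by simp)
  funext B
  rw [repSeries_ser_eq_sum (coeff_opE h), sum_split h]
  simp only [Pi.add_apply]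
  congr 1
  · congr 1
    · congr 1
      · rw [Finset.sum_apply, ← Finset.filter_filter, Finset.sum_filter (p := fun i => 1 ≤ _)]
        refine Finset.sum_congr rfl fun k hk => ?_
        have hk' : hi h < k := (Finset.mem_filter.1 hk).2
        rw [finsum_generic hne hk'.ne' fun l =>
            coefE_add_diagonal_of_ne h (hlt.trans hk').ne' A.1 l,
          if_neg (hlt.trans hk').not_gt, add_zero]
        rfl
      · rw [Finset.sum_apply, ← Finset.filter_filter, Finset.sum_filter (p := fun i => 1 ≤ _)]
        refine Finset.sum_congr rfl fun k hk => ?_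
        have hk' : k < lo h := (Finset.mem_filter.1 hk).2
        rw [finsum_generic hne (hk'.trans hlt).ne fun l =>
            coefE_add_diagonal_of_ne h hk'.ne A.1 l,
          if_pos hk']
        rfl
    · rw [finsum_raise hne (by simp [e, hne]) fun l => coefE_add_diagonal_lo h A.2.2 l]
      have e1 : j + (-e (hi h) + e (lo h)) = j + α h := by rw [α]; abel
      have e2 : j + (-e (hi h) - e (lo h)) = j - β h := by rw [β]; abel
      rw [e1, e2, mul_assoc (sgn h (lo h) A.1), ← zpow_add₀ (υi_ne_zero _), ← sub_eq_add_neg]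
      split_ifs <;> rfl
  · rw [finsum_lower fun l => by
      rw [coefE_add_diagonal_of_ne h hne.symm, if_neg hlt.not_gt]; simp [sdot]]
    rw [Pi.smul_apply, smul_eq_mul, zpow_add₀ (υi_ne_zero _), υi_lo_zpow, coefE]
    ring

theorem repSeries_F (A : Mmn0 m n) (j : Fin (m + n) → ℤ) (h : Fin (m + n - 1)) :
    repSeries (gen (.F h)) (ser A.1 j) =
      (∑ i with i < lo h ∧ 1 ≤ A.1 (lo h) i,
        (sgn h i A.1 * υi (hi h) ^ gexp h i A.1 * qint (A.1 (hi h) i + 1)) •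
          ser (A.1 - unit (lo h) i + unit (hi h) i) j)
      + (∑ i with hi h < i ∧ 1 ≤ A.1 (lo h) i,
        (sgn h i A.1 * υi (hi h) ^ gexp h i A.1 * qint (A.1 (hi h) i + 1)) •
          ser (A.1 - unit (lo h) i + unit (hi h) i) (j - α h))
      + (sgn h (lo h) A.1
          * υi (hi h) ^ (gexp h (lo h) A.1 + (-1) ^ isOdd h * j (lo h))
          * qint (A.1 (hi h) (lo h) + 1)) •
        ser (A.1 + unit (hi h) (lo h)) j
      + (if A.1 (lo h) (hi h) = 0 then 0 else
        (sgn h (hi h) A.1 * υi (hi h) ^ (gexp h (hi h) A.1 - j (hi h))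
            / (υi (hi h) - (υi (hi h))⁻¹)) •
          (ser (A.1 - unit (lo h) (hi h)) (j - α h)
            - ser (A.1 - unit (lo h) (hi h)) (j - β h))) := by
  have hne := (lo_ne_hi h).symm
  have hlt : lo h < hi h := Fin.lt_def.2 (by simp)
  funext B
  rw [repSeries_ser_eq_sum (coeff_opF h), sum_split h, add_comm (∑ k with hi h < k, _)]
  simp only [Pi.add_apply]
  congr 1
  · congr 1
    · congr 1
      · rw [Finset.sum_apply, ← Finset.filter_filter, Finset.sum_filter (p := fun i => 1 ≤ _)]
        refine Finset.sum_congr rfl fun k hk => ?_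
        have hk' : k < lo h := (Finset.mem_filter.1 hk).2
        rw [finsum_generic hne hk'.ne fun l =>
            coefF_add_diagonal_of_ne h (hk'.trans hlt).ne A.1 l,
          if_neg (hk'.trans hlt).not_gt, add_zero, sub_add_unit hne]
        rfl
      · rw [Finset.sum_apply, ← Finset.filter_filter, Finset.sum_filter (p := fun i => 1 ≤ _)]
        refine Finset.sum_congr rfl fun k hk => ?_
        have hk' : hi h < k := (Finset.mem_filter.1 hk).2
        rw [finsum_generic hne (hlt.trans hk').ne' fun l =>
            coefF_add_diagonal_of_ne h hk'.ne' A.1 l,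
          if_pos hk', sub_add_unit hne, ← sub_eq_add_neg]
        rfl
    · rw [finsum_lower fun l => by
        rw [coefF_add_diagonal_of_ne h hne.symm, if_neg hlt.not_gt]; simp [sdot]]
      rw [Pi.smul_apply, smul_eq_mul, zpow_add₀ (υi_ne_zero _), υi_hi_zpow, coefF]
      ring
  · rw [finsum_raise hne (by simp [e, hne]) fun l => coefF_add_diagonal_hi h A.2.2 l]
    have e1 : j + (-e (lo h) + e (hi h)) = j - α h := by rw [α]; abel
    have e2 : j + (-e (lo h) - e (hi h)) = j - β h := by rw [β]; abel
    rw [e1, e2, mul_assoc (sgn h (hi h) A.1), ← zpow_add₀ (υi_ne_zero _), ← sub_eq_add_neg]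
    split_ifs <;> rfl

/-! ### Linear independence of the `A(j)` -/

theorem υ_pow_ne_one {k : ℕ} (hk : k ≠ 0) : υ ^ k ≠ 1 := by
  intro h
  have h2 : (Polynomial.X ^ k : Polynomial ℚ) = 1 := by
    apply RatFunc.algebraMap_injective ℚ
    rw [map_pow, map_one, RatFunc.algebraMap_X]
    exact h
  have := congrArg (Polynomial.eval 0) h2
  simp [hk] at this

theorem υ_zpow_injective : Function.Injective fun a : ℤ => υ ^ a := by
  intro a b h
  have h1 : υ ^ (a - b) = 1 := by
    rw [zpow_sub₀ υ_ne_zero, div_eq_one_iff_eq (zpow_ne_zero _ υ_ne_zero)]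
    exact h
  by_contra hab
  have h2 : (a - b).natAbs ≠ 0 := by omega
  refine υ_pow_ne_one h2 ?_
  rcases Int.natAbs_eq (a - b) with h3 | h3
  · rw [← zpow_natCast, ← h3, h1]
  · rw [← zpow_natCast, ← neg_neg ((a - b).natAbs : ℤ), ← h3, zpow_neg, h1, inv_one]

/-- The character `λ ↦ υ^{λ * j}` of the monoid `ℕ^{m+n}`. -/
def sdotChar (j : Fin (m + n) → ℤ) : Multiplicative (Fin (m + n) → ℕ) →* Qv where
  toFun l := υ ^ sdot (fun i => (l.toAdd i : ℤ)) j
  map_one' := by simp [sdot]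
  map_mul' l l' := by
    rw [← zpow_add₀ υ_ne_zero, sdot_comm, sdot_comm _ j, sdot_comm _ j, ← sdot_add]
    congr 2

theorem sdotChar_apply (j : Fin (m + n) → ℤ) (l : Fin (m + n) → ℕ) :
    sdotChar j (Multiplicative.ofAdd l) = υ ^ sdot (fun i => (l i : ℤ)) j := rfl

theorem sdotChar_injective : Function.Injective (sdotChar (m := m) (n := n)) := by
  intro j j' h
  funext i
  have h1 := DFunLike.congr_fun h (Multiplicative.ofAdd (Pi.single i 1))
  have h2 : ∀ j : Fin (m + n) → ℤ,
      sdotChar j (Multiplicative.ofAdd (Pi.single i 1)) = υ ^ ((-1) ^ par i * j i) := fun j => by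
    rw [sdotChar_apply, sdot_comm, ← sdot_e]
    congr 2
    funext k
    by_cases hk : k = i
    · subst hk; simp [e]
    · simp [e, hk]
  rw [h2, h2] at h1
  exact mul_left_cancel₀ (by simp) (υ_zpow_injective h1)

/-- The coefficients of a combination of the `A(j)` at the monomials `X^{[A + diag(λ)]}`, for fixed
`A`, form a combination of the characters `λ ↦ υ^{λ * j}`, which are independent by Dedekind. -/
theorem linearIndependent_ser :
    LinearIndependent Qv fun x : Mmn0 m n × (Fin (m + n) → ℤ) => ser x.1.1 x.2 := by
  have hchar := (linearIndependent_monoidHom (Multiplicative (Fin (m + n) → ℕ)) Qv).comp _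
    (sdotChar_injective (m := m) (n := n))
  rw [linearIndependent_iff'] at hchar ⊢
  rintro s g hg ⟨A, j⟩ hA
  have hinj : Set.InjOn (fun j : Fin (m + n) → ℤ => (A, j)) ((fun j => (A, j)) ⁻¹' ↑s) :=
    fun _ _ _ _ h => (Prod.ext_iff.1 h).2
  refine hchar (s.preimage (fun j => (A, j)) hinj) (fun j => g (A, j)) ?_ j
    (Finset.mem_preimage.2 hA)
  funext l
  have := congrFun hg (withDiag A l.toAdd)
  rw [Finset.sum_apply] at this ⊢
  rw [← Finset.sum_preimage (fun j => (A, j)) s hinj] at this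
  · rw [Pi.zero_apply] at this ⊢
    rw [← this]
    refine Finset.sum_congr rfl fun j _ => ?_
    rw [Pi.smul_apply, Pi.smul_apply, ser_withDiag]
    rfl
  · rintro ⟨A', j'⟩ _ h
    rw [Pi.smul_apply, ser_withDiag_of_ne, smul_zero]
    rintro rfl
    exact h ⟨j', rfl⟩

/-! ### The submodule `𝒰(m|n)` -/

theorem ser_mem_Umn {A : NMat m n} (hA : ∀ i, A i i = 0) (j : Fin (m + n) → ℤ) :
    ser A j ∈ Umn m n := by
  by_cases h : ∀ s t, par s ≠ par t → A s t ≤ 1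
  · exact Submodule.subset_span ⟨(⟨A, h, hA⟩, j), rfl⟩
  · push Not at h
    obtain ⟨s, t, hst, h⟩ := h
    rw [ser_eq_zero hA hst h]
    exact Submodule.zero_mem _

theorem map_Umn_le {T : Module.End Qv (SSeries m n)}
    (h : ∀ (A : Mmn0 m n) j, T (ser A.1 j) ∈ Umn m n) {v : SSeries m n} (hv : v ∈ Umn m n) :
    T v ∈ Umn m n := by
  have : Umn m n ≤ (Umn m n).comap T := Submodule.span_le.2 (by
    rintro _ ⟨x, rfl⟩
    exact h x.1 x.2)
  exact this hv

theorem gen_Kinv_mul_gen_K (i : Fin (m + n)) : gen (.Kinv i) * gen (.K i) = 1 := by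
  have := RingQuot.mkAlgHom_rel Qv (Rel.KinvK (m := m) (n := n) i)
  rwa [map_mul, map_one] at this

theorem add_sub_unit_diag {A : NMat m n} (hA : ∀ i, A i i = 0) {r s k : Fin (m + n)} (h : k ≠ r)
    (i : Fin (m + n)) : (A + unit r k - unit s k) i i = 0 := by
  have : ¬(r = i ∧ k = i) := fun e => h (e.2.trans e.1.symm)
  simp [unit, Matrix.single_apply, hA, this]

theorem repSeries_gen_mem_Umn (g : Gen m n) {v : SSeries m n} (hv : v ∈ Umn m n) :
    repSeries (gen g) v ∈ Umn m n := by
  refine map_Umn_le (fun A j => ?_) hv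
  cases g with
  | E h =>
    have hne := lo_ne_hi h
    have hlt : lo h < hi h := Fin.lt_def.2 (by simp)
    rw [repSeries_E]
    refine add_mem (add_mem (add_mem (sum_mem fun i hi' => ?_) (sum_mem fun i hi' => ?_)) ?_) ?_
    · refine Submodule.smul_mem _ _ (ser_mem_Umn (add_sub_unit_diag A.2.2 ?_) _)
      exact (hlt.trans (Finset.mem_filter.1 hi').2.1).ne'
    · refine Submodule.smul_mem _ _ (ser_mem_Umn (add_sub_unit_diag A.2.2 ?_) _)
      exact (Finset.mem_filter.1 hi').2.1.ne
    · have h0 : ∀ i, (A.1 - unit (hi h) (lo h)) i i = 0 := fun i => by simp [A.2.2]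
      split_ifs
      · exact zero_mem _
      · exact Submodule.smul_mem _ _ (sub_mem (ser_mem_Umn h0 _) (ser_mem_Umn h0 _))
    · refine Submodule.smul_mem _ _ (ser_mem_Umn (fun i => ?_) _)
      have : ¬(lo h = i ∧ hi h = i) := fun e => hne (e.1.trans e.2.symm)
      simp [unit, A.2.2, this]
  | F h =>
    have hne := lo_ne_hi h
    have hlt : lo h < hi h := Fin.lt_def.2 (by simp)
    rw [repSeries_F]
    refine add_mem (add_mem (add_mem (sum_mem fun i hi' => ?_) (sum_mem fun i hi' => ?_)) ?_) ?_
    · rw [sub_add_unit hne.symm]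
      refine Submodule.smul_mem _ _ (ser_mem_Umn (add_sub_unit_diag A.2.2 ?_) _)
      exact ((Finset.mem_filter.1 hi').2.1.trans hlt).ne
    · rw [sub_add_unit hne.symm]
      refine Submodule.smul_mem _ _ (ser_mem_Umn (add_sub_unit_diag A.2.2 ?_) _)
      exact (Finset.mem_filter.1 hi').2.1.ne'
    · refine Submodule.smul_mem _ _ (ser_mem_Umn (fun i => ?_) _)
      have : ¬(hi h = i ∧ lo h = i) := fun e => hne (e.2.trans e.1.symm)
      simp [unit, A.2.2, this]
    · have h0 : ∀ i, (A.1 - unit (lo h) (hi h)) i i = 0 := fun i => by simp [A.2.2]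
      split_ifs
      · exact zero_mem _
      · exact Submodule.smul_mem _ _ (sub_mem (ser_mem_Umn h0 _) (ser_mem_Umn h0 _))
  | K i =>
    rw [repSeries_K]
    exact Submodule.smul_mem _ _ (ser_mem_Umn A.2.2 _)
  | Kinv i =>
    -- Apply `K_i⁻¹` to the formula for `K_i . A(j - e_i)`.
    have hc : υi i ^ (∑ k, A.1 i k) ≠ 0 := pow_ne_zero _ (υi_ne_zero i)
    have h1 := repSeries_K i A (j - e i)
    rw [sub_add_cancel] at h1
    have h2 : ser A.1 j
        = (υi i ^ (∑ k, A.1 i k))⁻¹ • repSeries (gen (.K i)) (ser A.1 (j - e i)) := by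
      rw [h1, inv_smul_smul₀ hc]
    rw [h2, map_smul, ← Module.End.mul_apply, ← map_mul, gen_Kinv_mul_gen_K, map_one]
    exact Submodule.smul_mem _ _ (ser_mem_Umn A.2.2 _)

theorem repSeries_mem_Umn (u : Uq m n) : ∀ v ∈ Umn m n, repSeries u v ∈ Umn m n := by
  let S : Subalgebra Qv (Uq m n) :=
    { carrier := {u | ∀ v ∈ Umn m n, repSeries u v ∈ Umn m n}
      mul_mem' := fun {a b} ha hb v hv => by
        rw [map_mul]; exact ha _ (hb v hv)
      add_mem' := fun {a b} ha hb v hv => by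
        rw [map_add]; exact add_mem (ha v hv) (hb v hv)
      algebraMap_mem' := fun r v hv => by
        rw [AlgHom.commutes]; exact Submodule.smul_mem _ r hv }
  exact subalgebra_eq_top (S := S) (fun g v hv => repSeries_gen_mem_Umn g hv) u

/-! ### Parity -/

theorem matParity_add (A B : NMat m n) : matParity (A + B) = matParity A + matParity B := by
  simp only [matParity, Matrix.add_apply, Nat.cast_add, Finset.sum_add_distrib]

theorem matParity_unit (s k : Fin (m + n)) :
    matParity (unit s k) = if par s ≠ par k then 1 else 0 := by
  rw [matParity, Finset.sum_eq_single s (fun i _ hi => by simp [unit, hi.symm]) (by simp),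
    Finset.sum_filter, Finset.sum_eq_single k (fun i _ hi => by simp [unit, hi.symm]) (by simp)]
  simp [unit]

theorem matParity_diagonal (l : Fin (m + n) → ℕ) : matParity (Matrix.diagonal l) = 0 := by
  refine Finset.sum_eq_zero fun i _ => Finset.sum_eq_zero fun j hj => ?_
  have : i ≠ j := fun e => (Finset.mem_filter.1 hj).2 (by rw [e])
  simp [Matrix.diagonal_apply_ne _ this]

theorem matParity_unit_add (h : Fin (m + n - 1)) (k : Fin (m + n)) :
    matParity (unit (lo h) k) + matParity (unit (hi h) k) = (isOdd h : ZMod 2) := by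
  rw [matParity_unit, matParity_unit]
  by_cases ho : h.val + 1 = m
  · have e1 : par (lo h) = 0 := par_of_lt (by simp; omega)
    have e2 : par (hi h) = 1 := par_of_le (by simp; omega)
    rw [e1, e2, isOdd_of_eq ho]
    rcases par_eq_zero_or_one k with hk | hk <;> simp [hk]
  · rw [par_hi_of_ne ho, isOdd_of_ne ho, Nat.cast_zero]
    exact CharTwo.add_self_eq_zero _

/-- A generator shifts the parity of monomials by its own parity. -/
theorem matParity_of_coeff_genOp {g : Gen m n} {A B : Mmn m n}
    (h : coeff B (genOp g (mon A)) ≠ 0) : matParity B.1 = g.parity + matParity A.1 := by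
  have hdiag : ∀ {w : Fin (m + n) → Qv}, coeff B (opDiag w (mon A)) ≠ 0 → B = A := fun {w} h => by
    by_contra hAB
    exact h (by rw [coeff_opDiag, if_neg (Ne.symm hAB)])
  have hchar : ∀ {x a b y : ZMod 2}, x + a = y + b → x = a + b + y := by decide
  cases g with
  | E t =>
    obtain ⟨k, -, hk⟩ := exists_of_coeff_ne_zero (lo_ne_hi t) (coeff_opE t) h
    have := congrArg matParity hk
    rw [matParity_add, matParity_add] at this
    rw [hchar this, add_comm (matParity (unit (hi t) k)), matParity_unit_add]
    rfl
  | F t =>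
    obtain ⟨k, -, hk⟩ := exists_of_coeff_ne_zero (lo_ne_hi t).symm (coeff_opF t) h
    have := congrArg matParity hk
    rw [matParity_add, matParity_add] at this
    rw [hchar this, matParity_unit_add]
    rfl
  | K i =>
    change coeff B (opK i (mon A)) ≠ 0 at h
    rw [opK_eq] at h
    rw [hdiag h, Gen.parity, Nat.cast_zero, zero_add]
  | Kinv i => rw [hdiag h, Gen.parity, Nat.cast_zero, zero_add]

theorem repSeries_gen_mem_seriesPart (g : Gen m n) {q : ZMod 2} {v : SSeries m n}
    (hv : v ∈ seriesPart m n q) : repSeries (gen g) v ∈ seriesPart m n (g.parity + q) := by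
  intro B hB
  obtain ⟨A, hA⟩ : ∃ A, v A * coeff B (genOp g (mon A)) ≠ 0 := by
    by_contra! h
    rw [repSeries_gen_apply, finsum_eq_zero_of_forall_eq_zero h] at hB
    exact hB rfl
  rw [matParity_of_coeff_genOp (right_ne_zero_of_mul hA), hv A (left_ne_zero_of_mul hA)]

theorem repSeries_mem_seriesPart {p q : ZMod 2} {u : Uq m n} (hu : u ∈ Uq.part p)
    {v : SSeries m n} (hv : v ∈ seriesPart m n q) :
    repSeries u v ∈ seriesPart m n (p + q) := by
  have hword : ∀ w : List (Gen m n), repSeries (w.map gen).prod v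
      ∈ seriesPart m n (((w.map Gen.parity).sum : ZMod 2) + q) := fun w => by
    induction w with
    | nil => simpa using hv
    | cons g w ih =>
      have := repSeries_gen_mem_seriesPart g ih
      simpa [add_assoc] using this
  induction hu using Submodule.span_induction with
  | mem u hu =>
    obtain ⟨w, rfl, rfl⟩ := hu
    exact hword w
  | zero => rw [map_zero]; exact zero_mem _
  | add a b _ _ ha hb => rw [map_add]; exact add_mem ha hb
  | smul c a _ ha => rw [map_smul]; exact Submodule.smul_mem _ c ha

theorem ser_mem_UmnPart (A : Mmn0 m n) (j : Fin (m + n) → ℤ) :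
    ser A.1 j ∈ UmnPart m n (matParity A.1) := by
  refine ⟨ser_mem_Umn A.2.2 j, fun B hB => ?_⟩
  obtain ⟨l, rfl⟩ := exists_withDiag_of_ser_ne_zero hB
  rw [withDiag, matParity_add, matParity_diagonal, add_zero]

theorem UmnPart_sup : UmnPart m n 0 ⊔ UmnPart m n 1 = Umn m n := by
  refine le_antisymm (sup_le inf_le_left inf_le_left) (Submodule.span_le.2 ?_)
  rintro _ ⟨⟨A, j⟩, rfl⟩
  have h := ser_mem_UmnPart A j
  have h01 : ∀ p : ZMod 2, p = 0 ∨ p = 1 := by decide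
  rcases h01 (matParity A.1) with h' | h' <;> rw [h'] at h
  · exact Submodule.mem_sup_left h
  · exact Submodule.mem_sup_right h

theorem disjoint_UmnPart : Disjoint (UmnPart m n 0) (UmnPart m n 1) := by
  refine Submodule.disjoint_def.2 fun v h0 h1 => ?_
  funext B
  by_contra hB
  have := (h0.2 B hB).symm.trans (h1.2 B hB)
  exact absurd this (by decide)

end

end QuantumGL

theorem theorem3p3 (m n : ℕ) (hmn : 0 < m + n) :
    -- the action of `U_υ(gl_{m|n})` on `S^{m|n}` and its extension to formal power series
    ∃ (ρ : Uq m n →ₐ[Qv] Module.End Qv (Smn m n))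
      (ρ' : Uq m n →ₐ[Qv] Module.End Qv (SSeries m n)),
      (∀ i, ρ (gen (.K i)) = opK i) ∧
      (∀ h, ρ (gen (.E h)) = opE h) ∧
      (∀ h, ρ (gen (.F h)) = opF h) ∧
      (∀ u, IsExtension (ρ u) (ρ' u)) ∧
      -- `𝒰(m|n)` is a submodule
      (∀ (u : Uq m n), ∀ v ∈ Umn m n, ρ' u v ∈ Umn m n) ∧
      -- the `A(j)` form a basis of it
      (∃ b : Module.Basis (Mmn0 m n × (Fin (m + n) → ℤ)) Qv (Umn m n),
        ∀ x, (b x : SSeries m n) = ser x.1.1 x.2) ∧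
      -- the action of `K_i`
      (∀ (A : Mmn0 m n) (j : Fin (m + n) → ℤ) (i : Fin (m + n)),
        ρ' (gen (.K i)) (ser A.1 j) = υi i ^ (∑ k, A.1 i k) • ser A.1 (j + e i)) ∧
      -- the action of `E_h`
      (∀ (A : Mmn0 m n) (j : Fin (m + n) → ℤ) (h : Fin (m + n - 1)),
        ρ' (gen (.E h)) (ser A.1 j) =
          (∑ i with hi h < i ∧ 1 ≤ A.1 (hi h) i,
            (sgn h i A.1 * υi (lo h) ^ fexp h i A.1 * qint (A.1 (lo h) i + 1)) •
              ser (A.1 + unit (lo h) i - unit (hi h) i) j)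
          + (∑ i with i < lo h ∧ 1 ≤ A.1 (hi h) i,
            (sgn h i A.1 * υi (lo h) ^ fexp h i A.1 * qint (A.1 (lo h) i + 1)) •
              ser (A.1 + unit (lo h) i - unit (hi h) i) (j + α h))
          + (if A.1 (hi h) (lo h) = 0 then 0 else
            (sgn h (lo h) A.1 * υi (lo h) ^ (fexp h (lo h) A.1 - j (lo h))
                / (υi (lo h) - (υi (lo h))⁻¹)) •
              (ser (A.1 - unit (hi h) (lo h)) (j + α h)
                - ser (A.1 - unit (hi h) (lo h)) (j - β h)))
          + (sgn h (hi h) A.1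
              * υi (lo h) ^ (fexp h (hi h) A.1 + (-1) ^ isOdd h * j (hi h))
              * qint (A.1 (lo h) (hi h) + 1)) •
            ser (A.1 + unit (lo h) (hi h)) j) ∧
      -- the action of `F_h`
      (∀ (A : Mmn0 m n) (j : Fin (m + n) → ℤ) (h : Fin (m + n - 1)),
        ρ' (gen (.F h)) (ser A.1 j) =
          (∑ i with i < lo h ∧ 1 ≤ A.1 (lo h) i,
            (sgn h i A.1 * υi (hi h) ^ gexp h i A.1 * qint (A.1 (hi h) i + 1)) •
              ser (A.1 - unit (lo h) i + unit (hi h) i) j)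
          + (∑ i with hi h < i ∧ 1 ≤ A.1 (lo h) i,
            (sgn h i A.1 * υi (hi h) ^ gexp h i A.1 * qint (A.1 (hi h) i + 1)) •
              ser (A.1 - unit (lo h) i + unit (hi h) i) (j - α h))
          + (sgn h (lo h) A.1
              * υi (hi h) ^ (gexp h (lo h) A.1 + (-1) ^ isOdd h * j (lo h))
              * qint (A.1 (hi h) (lo h) + 1)) •
            ser (A.1 + unit (hi h) (lo h)) j
          + (if A.1 (lo h) (hi h) = 0 then 0 else
            (sgn h (hi h) A.1 * υi (hi h) ^ (gexp h (hi h) A.1 - j (hi h))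
                / (υi (hi h) - (υi (hi h))⁻¹)) •
              (ser (A.1 - unit (lo h) (hi h)) (j - α h)
                - ser (A.1 - unit (lo h) (hi h)) (j - β h)))) ∧
      -- `𝒰(m|n)` is a supermodule, each `A(j)` being homogeneous of parity `Â`
      (∀ (A : Mmn0 m n) (j : Fin (m + n) → ℤ), ser A.1 j ∈ UmnPart m n (matParity A.1)) ∧
      UmnPart m n 0 ⊔ UmnPart m n 1 = Umn m n ∧
      Disjoint (UmnPart m n 0) (UmnPart m n 1) ∧
      (∀ (p q : ZMod 2), ∀ u ∈ Uq.part p, ∀ v ∈ UmnPart m n q,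
        ρ' u v ∈ UmnPart m n (p + q)) := by
  refine ⟨rep, repSeries, fun i => rep_gen _, fun h => rep_gen _, fun h => rep_gen _,
    isExtension_rep, fun u v => repSeries_mem_Umn u v,
    ⟨Module.Basis.span linearIndependent_ser, fun x => ?_⟩,
    fun A j i => repSeries_K i A j, repSeries_E, repSeries_F, ser_mem_UmnPart, UmnPart_sup,
    disjoint_UmnPart,
    fun p q u hu v hv =>
      ⟨repSeries_mem_Umn u v hv.1, repSeries_mem_seriesPart hu hv.2⟩⟩
  exact congrArg Subtype.val (Module.Basis.span_apply linearIndependent_ser x)
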